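/- **Setting.** Let $N\ge 2$ be an integer, $0<r<\infty$, $0<t_*<\infty$, $\beta>0$, and put $\tau(t)=\dfrac{i(t_*-t)}{2\pi r^2}$ for $t\in[0,t_*)$. Let $$\vartheta_1(v;\tau)=i\sum_{n\in\mathbb Z}(-1)^n e^{\pi i\tau(n-1/2)^2}e^{\pi i v(2n-1)},\qquad \eta(\tau)=e^{\pi i\tau/12}\prod_{n\ge1}(1-e^{2\pi i n\tau}).$$ For $\mathbf x\in\mathbb R^N$ let $\overline x=\sum_{j=1}^N x_j-\kappa_N$ with $\kappa_N=\frac{\pi r}{2}(2N-3+(-1)^N)$, and let $$\check{\mathbb A}=\{\mathbf x\in\mathbb R^N:\ x_1<\dots<x_N<x_1+2\pi r,\ 0<\overline x<2\pi r\}.$$ Put $U_N(t,y)=-\log\vartheta_1(y/2\pi r;N\tau(t))$ for $0<y<2\pi r$ (with $U_N'=\partial U_N/\partial y$), and, for $\mathbf x\in\check{\mathbb A}$, $W_N(t,\mathbf x)=\sum_{j<k}U_N(t,x_k-x_j)+U_N(t,\overline x)$, $$V_N^{(\beta)}(t,\mathbf x)=\frac{\beta(\beta-2)}{8}N\Big[\sum_{j<k}U_N'(t,x_k-x_j)^2+U_N'(t,\overline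 x)^2-\frac{N-2}{N}\sum_{j<k}U_N''(t,x_k-x_j)\Big],$$ $$\mathcal L(t)u=\tfrac12\sum_j\partial_{x_j}^2u+\tfrac\beta2\sum_j\partial_{x_j}\big((\partial_{x_j}W_N)\,u\big),\qquad \mathcal H(t)u=-\tfrac12\sum_j\partial_{x_j}^2u+V_N^{(\beta)}u .$$ ($\mathcal L$ is the forward Kolmogorov operator of the elliptic Dyson model eDYS$^{(\beta)}$, $dX_j=dB_j-\frac\beta2\,\partial_{x_j}W_N(t,\mathbf X)\,dt$.) Fix $t'\in[0,t_*)$ and $\mathbf x'\in\check{\mathbb A}$. Solutions below are classical ($C^{1,2}$ on $(t',t_*)\times\check{\mathbb A}$). The condition "$u\to\delta_{\mathbf x'}$ as $t\downarrow t'$" means that $u(t,\cdot)$ is integrable on $\check{\mathbb A}$ for every $t\in(t',t_*)$ and that $u(t,\mathbf x)\,d\mathbf x$ on $\check{\mathbb A}$ converges to the point mass at $\mathbf x'$, tested against all continuous functions on $\mathbb R^N$. "$u\to0$ at $\partial\check{\mathbb A}$" means that $u(t,\mathbf x)\to0$ as $\mathbf x\to\partial\check{\mathbb A}$ from inside, locally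 uniformly in $t\in(t',t_*)$. * *Kolmogorov problem:* $[\partial_t-\mathcal L(t)]p=0$ and $p>0$ on $(t',t_*)\times\check{\mathbb A}$, $p\to\delta_{\mathbf x'}$ as $t\downarrow t'$. The transition probability density $p_N^{(\beta)}(t,\mathbf x|t',\mathbf x')$ of eDYS$^{(\beta)}$ in $\check{\mathbb A}$ is the smallest solution of this problem (the minimal fundamental solution). * *Schrödinger problem:* $[\partial_t+\mathcal H(t)]\psi=0$ and $\psi>0$ on $(t',t_*)\times\check{\mathbb A}$, $\psi\to\delta_{\mathbf x'}$ as $t\downarrow t'$, $\psi\to0$ at $\partial\check{\mathbb A}$. The function $\psi_N^{(\beta)}(t,\mathbf x|t',\mathbf x')$ is the smallest solution of this problem (so it is the only solution whenever there is only one). For $t\in[0,t_*)$ and $\mathbf x\in\mathbb R^N$ let $$h_N^r(t,\mathbf x)=\eta(N\tau(t))^{-\beta(N-1)(N-2)/4}\,\vartheta_1\Big(\frac{\overline x}{2\pi r};N\tau(t)\Big)\prod_{1\le j<k\le N}\vartheta_1\Big(\frac{x_k-x_j}{2\pi r};N\tau(t)\Big).$$ **Proposition.** (i) Let $t'\in[0,t_*)$,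 $\mathbf x'\in\check{\mathbb A}$, and put $m(t,\mathbf x)=\big(h_N^r(t,\mathbf x)/h_N^r(t',\mathbf x')\big)^{\beta/2}$. * A function $f$ is a $C^{1,2}$ solution of $[\partial_t+\mathcal H(t)]f=0$ on $(t',t_*)\times\check{\mathbb A}$ if and only if $mf$ is a $C^{1,2}$ solution of $[\partial_t-\mathcal L(t)](mf)=0$ there. * If $\psi$ is any solution of the Schrödinger problem, then $m\psi$ is a solution of the Kolmogorov problem. * If $p_N^{(\beta)}(\cdot,\cdot|t',\mathbf x')$ and $\psi_N^{(\beta)}(\cdot,\cdot|t',\mathbf x')$ are the functions defined above, then $$p_N^{(\beta)}(t,\mathbf x|t',\mathbf x')=\Big(\frac{h_N^r(t,\mathbf x)}{h_N^r(t',\mathbf x')}\Big)^{\beta/2}\psi_N^{(\beta)}(t,\mathbf x|t',\mathbf x'),\qquad t'<t<t_*,\ \mathbf x\in\check{\mathbb A},$$ and $p_N^{(\beta)}\to0$ at $\partial\check{\mathbb A}$, so that, with both functions extended by $0$, the formula holds for $\mathbf x$ in the closure of $\check{\mathbb A}$. (ii) For all $t\in[0,t_*)$ and $\mathbf x\in\mathbb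 R^N$, $$h_N^r(t,\mathbf x)=\eta(N\tau(t))^{-(\beta-2)(N-1)(N-2)/4}\Big(\frac{2\pi r}{\sqrt N}\Big)^N q_N^r(t_*-t,\mathbf v|\mathbf x),$$ where $v_j=\frac{\pi r}{2N}(4j-3+(-1)^N)$ for $1\le j\le N$, and, for $s>0$, $$q_N^r(s,\mathbf y|\mathbf x)=\det_{1\le j,k\le N}\Big[\sum_{w\in\mathbb Z}(-1)^{Nw}\,\frac{e^{-(y_j+2\pi r w-x_k)^2/2s}}{\sqrt{2\pi s}}\Big].$$ -/

import Mathlib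

open Filter Topology Set
open scoped Real

noncomputable section

namespace EllipticDyson

/-! ### Special functions -/

/-- Jacobi's theta function `ϑ₁(v; τ) = i ∑_{n ∈ ℤ} (-1)^n q^{(n-1/2)^2} z^{2n-1}`,
`q = e^{π i τ}`, `z = e^{π i v}` (the series converges for `Im τ > 0`). -/
def theta1 (v τ : ℂ) : ℂ :=
  Complex.I * ∑' n : ℤ, (-1 : ℂ) ^ n
    * Complex.exp (π * Complex.I * τ * ((n : ℂ) - 1 / 2) ^ 2)
    * Complex.exp (π * Complex.I * v * (2 * (n : ℂ) - 1))

/-- `ϑ₁(v; i s)` as a real number, for real `v` and `s`. -/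
def theta1R (v s : ℝ) : ℝ := (theta1 (v : ℂ) (Complex.I * (s : ℂ))).re

/-- The Dedekind function `η(i s)` as a real number, for real `s`. -/
def etaR (s : ℝ) : ℝ := (ModularForm.eta (Complex.I * (s : ℂ))).re

/-- At real `v` and purely imaginary `τ = i s`, `ϑ₁` is real, so nothing is lost in `theta1R`. -/
theorem ofReal_theta1R (v s : ℝ) :
    ((theta1R v s : ℝ) : ℂ) = theta1 (v : ℂ) (Complex.I * (s : ℂ)) := by
  have key : (starRingEnd ℂ) (theta1 (v : ℂ) (Complex.I * (s : ℂ)))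
      = theta1 (v : ℂ) (Complex.I * (s : ℂ)) := by
    unfold theta1
    rw [map_mul, Complex.conj_I, Complex.conj_tsum, ← (Equiv.subLeft (1 : ℤ)).tsum_eq, neg_mul,
      ← mul_neg, ← tsum_neg]
    congr 1
    refine tsum_congr fun n => ?_
    simp only [Equiv.subLeft_apply, map_mul, map_zpow₀, map_neg, map_one, ← Complex.exp_conj,
      map_pow, map_sub, Complex.conj_I, Complex.conj_ofReal, map_div₀, map_ofNat, map_intCast]
    have h1 : (-1 : ℂ) ^ (1 - n) = -(-1 : ℂ) ^ n := by
      rw [zpow_sub₀ (by norm_num), zpow_one, div_eq_mul_inv, ← inv_zpow]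
      norm_num
    rw [h1, neg_mul, neg_mul, neg_neg]
    congr 2
    · congr 1
      push_cast
      ring
    · push_cast
      ring_nf
  exact Complex.conj_eq_iff_re.mp key

/-- At purely imaginary `τ = i s`, `s > 0`, `η` is real, so nothing is lost in `etaR`. -/
theorem ofReal_etaR (s : ℝ) (hs : 0 < s) :
    ((etaR s : ℝ) : ℂ) = ModularForm.eta (Complex.I * (s : ℂ)) := by
  have hq : ∀ n : ℕ, ModularForm.eta_q n (Complex.I * (s : ℂ))
      = ((Real.exp (-(2 * π * s)) ^ (n + 1) : ℝ) : ℂ) := by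
    intro n
    rw [ModularForm.eta_q_eq_pow]
    push_cast
    congr 2
    linear_combination (2 * π * s : ℂ) * Complex.I_mul_I
  have h24 : Function.Periodic.qParam 24 (Complex.I * (s : ℂ))
      = ((Real.exp (-(2 * π * s) / 24) : ℝ) : ℂ) := by
    unfold Function.Periodic.qParam
    push_cast
    congr 1
    linear_combination (2 * π * s / 24 : ℂ) * Complex.I_mul_I
  have hlt : ‖Real.exp (-(2 * π * s))‖ < 1 := by
    rw [Real.norm_eq_abs, abs_of_pos (Real.exp_pos _), Real.exp_lt_one_iff]
    have := mul_pos (mul_pos two_pos Real.pi_pos) hs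
    linarith
  have hmul : Multipliable fun n : ℕ => (1 - Real.exp (-(2 * π * s)) ^ (n + 1) : ℝ) := by
    simp_rw [sub_eq_add_neg]
    apply multipliable_one_add_of_summable
    simpa using (summable_nat_add_iff 1).mpr
      (summable_geometric_of_lt_one (norm_nonneg _) hlt)
  have hprod : ∏' n : ℕ, (1 - ModularForm.eta_q n (Complex.I * (s : ℂ)))
      = ((∏' n : ℕ, (1 - Real.exp (-(2 * π * s)) ^ (n + 1)) : ℝ) : ℂ) := by
    have := hmul.map_tprod Complex.ofRealHom Complex.continuous_ofReal
    rw [show ((∏' n : ℕ, (1 - Real.exp (-(2 * π * s)) ^ (n + 1)) : ℝ) : ℂ)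
      = Complex.ofRealHom (∏' n : ℕ, (1 - Real.exp (-(2 * π * s)) ^ (n + 1))) from rfl, this]
    refine tprod_congr fun n => ?_
    rw [hq]
    simp
  have hval : ModularForm.eta (Complex.I * (s : ℂ))
      = ((Real.exp (-(2 * π * s) / 24)
          * ∏' n : ℕ, (1 - Real.exp (-(2 * π * s)) ^ (n + 1)) : ℝ) : ℂ) := by
    rw [ModularForm.eta, h24, hprod, Complex.ofReal_mul]
  rw [etaR, hval, Complex.ofReal_re]

/-- `Im τ(t)`, where `τ(t) = i (t_* - t) / (2 π r²)` is purely imaginary. -/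
def tauIm (r ts t : ℝ) : ℝ := (ts - t) / (2 * π * r ^ 2)

/-! ### Configurations -/

/-- The parity `σ(N) = (-1)^N`. -/
def parity (N : ℕ) : ℝ := (-1) ^ N

/-- `κ_N = (π r / 2) (2 N - 3 + (-1)^N)`. -/
def kappa (N : ℕ) (r : ℝ) : ℝ := π * r / 2 * (2 * (N : ℝ) - 3 + parity N)

/-- The shifted centre of mass `x̄ = ∑ x_j - κ_N`. -/
def bar {N : ℕ} (r : ℝ) (x : Fin N → ℝ) : ℝ := ∑ j, x j - kappa N r

/-- The alcove `{x_1 < ⋯ < x_N < x_1 + 2 π r}` restricted by `0 < x̄ < 2 π r`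
(the condition `x_N < x_1 + 2 π r` is written for all pairs, which is the same for `N ≥ 1`). -/
def alcove (N : ℕ) (r : ℝ) : Set (Fin N → ℝ) :=
  {x | StrictMono x ∧ (∀ j k, x k < x j + 2 * π * r) ∧ bar r x ∈ Ioo 0 (2 * π * r)}

/-- The equidistant configuration `v_j = (π r / 2N) (4 j - 3 + (-1)^N)`, `1 ≤ j ≤ N`;
the index `j : Fin N` stands for `j + 1`. -/
def equidistant (N : ℕ) (r : ℝ) (j : Fin N) : ℝ :=
  π * r / (2 * (N : ℝ)) * (4 * ((j : ℝ) + 1) - 3 + parity N)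

/-! ### Heat kernels -/

/-- Brownian transition density at times `t > 0`. -/
def pBM (t y x : ℝ) : ℝ := Real.exp (-(y - x) ^ 2 / (2 * t)) / Real.sqrt (2 * π * t)

/-- The (signed) wrapped heat kernel `∑_{w ∈ ℤ} σ^w p^BM(t, x + 2 π r w | x')`. -/
def pWrapped (σ r t x x' : ℝ) : ℝ := ∑' w : ℤ, σ ^ w * pBM t (x + 2 * π * r * (w : ℝ)) x'

/-- `q_N^r(t, x | x') = det [p^r_{σ(N)}(t, x_j | x'_k)]`. -/
def qDet (N : ℕ) (r t : ℝ) (x x' : Fin N → ℝ) : ℝ :=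
  Matrix.det (Matrix.of fun j k : Fin N => pWrapped (parity N) r t (x j) (x' k))

/-! ### The function `h_N^r` -/

/-- `h_N^r(t, x) = η(Nτ(t))^{-β(N-1)(N-2)/4} ϑ₁(x̄/2πr; Nτ(t)) ∏_{j<k} ϑ₁((x_k-x_j)/2πr; Nτ(t))`. -/
def hN (N : ℕ) (r ts β t : ℝ) (x : Fin N → ℝ) : ℝ :=
  etaR (N * tauIm r ts t) ^ (-β * ((N : ℝ) - 1) * ((N : ℝ) - 2) / 4)
    * theta1R (bar r x / (2 * π * r)) (N * tauIm r ts t)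
    * ∏ j : Fin N, ∏ k ∈ Finset.Ioi j,
        theta1R ((x k - x j) / (2 * π * r)) (N * tauIm r ts t)

/-! ### Potentials and operators -/

/-- `U_N(t, y) = - log ϑ₁(y / 2πr; N τ(t))`, `0 < y < 2πr`. -/
def potU (N : ℕ) (r ts t y : ℝ) : ℝ :=
  -Real.log (theta1R (y / (2 * π * r)) (N * tauIm r ts t))

/-- `W_N(t, x) = ∑_{j<k} U_N(t, x_k - x_j) + U_N(t, x̄)`. -/
def potW (N : ℕ) (r ts t : ℝ) (x : Fin N → ℝ) : ℝ :=
  (∑ j : Fin N, ∑ k ∈ Finset.Ioi j, potU N r ts t (x k - x j)) + potU N r ts t (bar r x)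

/-- The interaction `V_N^{(β)}(t, x)` of the Hamiltonian. -/
def potV (N : ℕ) (r ts β t : ℝ) (x : Fin N → ℝ) : ℝ :=
  β * (β - 2) / 8 * N *
    ((∑ j : Fin N, ∑ k ∈ Finset.Ioi j, deriv (potU N r ts t) (x k - x j) ^ 2)
      + deriv (potU N r ts t) (bar r x) ^ 2
      - ((N : ℝ) - 2) / N *
          ∑ j : Fin N, ∑ k ∈ Finset.Ioi j, deriv (deriv (potU N r ts t)) (x k - x j))

/-- The partial derivative `∂f/∂x_j`. -/
def pd {N : ℕ} (j : Fin N) (f : (Fin N → ℝ) → ℝ) (x : Fin N → ℝ) : ℝ :=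
  fderiv ℝ f x (Pi.single j 1)

/-- The (forward) Kolmogorov operator
`ℒ u = ½ ∑ ∂²u/∂x_j² + (β/2) ∑ ∂/∂x_j ((∂W_N/∂x_j) u)`, that is, the Fokker-Planck operator of
`dX_j = dB_j - (β/2) (∂W_N/∂x_j)(t, X) dt`. -/
def kolmogorovOp (N : ℕ) (r ts β t : ℝ) (u : (Fin N → ℝ) → ℝ) (x : Fin N → ℝ) : ℝ :=
  1 / 2 * ∑ j, pd j (pd j u) x
    + β / 2 * ∑ j, pd j (fun y => pd j (potW N r ts t) y * u y) x

/-- The Hamiltonian `ℋ u = -½ ∑ ∂²u/∂x_j² + V_N^{(β)} u`. -/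
def hamiltonian (N : ℕ) (r ts β t : ℝ) (u : (Fin N → ℝ) → ℝ) (x : Fin N → ℝ) : ℝ :=
  -(1 / 2) * ∑ j, pd j (pd j u) x + potV N r ts β t x * u x

/-! ### Classical solutions -/

/-- `u` is of class `C^{1,2}` (once in time, twice in space) on `(a, b) × D`. -/
structure IsC12On {N : ℕ} (u : ℝ → (Fin N → ℝ) → ℝ) (a b : ℝ) (D : Set (Fin N → ℝ)) : Prop where
  continuousOn : ContinuousOn (fun z : ℝ × (Fin N → ℝ) => u z.1 z.2) (Ioo a b ×ˢ D)
  time_differentiable : ∀ x ∈ D, DifferentiableOn ℝ (fun t => u t x) (Ioo a b)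
  space_contDiff : ∀ t ∈ Ioo a b, ContDiffOn ℝ 2 (u t) D
  time_continuousOn :
    ContinuousOn (fun z : ℝ × (Fin N → ℝ) => deriv (fun t => u t z.2) z.1) (Ioo a b ×ˢ D)
  pd_continuousOn : ∀ j,
    ContinuousOn (fun z : ℝ × (Fin N → ℝ) => pd j (u z.1) z.2) (Ioo a b ×ˢ D)
  pd2_continuousOn : ∀ j k,
    ContinuousOn (fun z : ℝ × (Fin N → ℝ) => pd k (pd j (u z.1)) z.2) (Ioo a b ×ˢ D)

/-- `u` solves `[∂/∂t - ℒ_N^{(β)}(t)] u = 0` classically on `(t', t_*) × alcove`. -/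
def SolvesKolmogorov (N : ℕ) (r ts β t' : ℝ) (u : ℝ → (Fin N → ℝ) → ℝ) : Prop :=
  IsC12On u t' ts (alcove N r) ∧
    ∀ t ∈ Ioo t' ts, ∀ x ∈ alcove N r,
      deriv (fun s => u s x) t - kolmogorovOp N r ts β t (u t) x = 0

/-- `u` solves `[∂/∂t + ℋ_N^{(β)}(t)] u = 0` classically on `(t', t_*) × alcove`. -/
def SolvesSchrodinger (N : ℕ) (r ts β t' : ℝ) (u : ℝ → (Fin N → ℝ) → ℝ) : Prop :=
  IsC12On u t' ts (alcove N r) ∧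
    ∀ t ∈ Ioo t' ts, ∀ x ∈ alcove N r,
      deriv (fun s => u s x) t + hamiltonian N r ts β t (u t) x = 0

/-- `u(t, ·)` is integrable over the alcove at every time, and
`lim_{t ↓ t'} u(t, x) dx = δ(x - x')` in the sense of weak convergence of measures. (The alcove is
bounded, so that every continuous test function is bounded there.) -/
def StartsAtDelta (N : ℕ) (r ts t' : ℝ) (x' : Fin N → ℝ) (u : ℝ → (Fin N → ℝ) → ℝ) : Prop :=
  (∀ t ∈ Ioo t' ts, MeasureTheory.IntegrableOn (u t) (alcove N r)) ∧
    ∀ φ : (Fin N → ℝ) → ℝ, Continuous φ →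
      Tendsto (fun t => ∫ x in alcove N r, φ x * u t x) (𝓝[>] t') (𝓝 (φ x'))

/-- `u > 0` on `(t', t_*) × alcove`. -/
def PositiveInside (N : ℕ) (r ts t' : ℝ) (u : ℝ → (Fin N → ℝ) → ℝ) : Prop :=
  ∀ t ∈ Ioo t' ts, ∀ x ∈ alcove N r, 0 < u t x

/-- `u(t, x) → 0` as `x` tends to the boundary of the alcove, locally uniformly in
`t ∈ (t', t_*)`; equivalently, the extension of `u` by `0` to the boundary is continuous there. -/
def VanishesAtBoundary (N : ℕ) (r ts t' : ℝ) (u : ℝ → (Fin N → ℝ) → ℝ) : Prop :=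
  ∀ t ∈ Ioo t' ts, ∀ y ∈ frontier (alcove N r),
    Tendsto (fun z : ℝ × (Fin N → ℝ) => u z.1 z.2)
      (𝓝[Ioo t' ts ×ˢ alcove N r] (t, y)) (𝓝 0)

/-- Positive solutions of the forward Kolmogorov equation started at `δ(x - x')` at time `t'`. -/
structure IsKolmogorovSolution (N : ℕ) (r ts β t' : ℝ) (x' : Fin N → ℝ)
    (p : ℝ → (Fin N → ℝ) → ℝ) : Prop where
  equation : SolvesKolmogorov N r ts β t' p
  initial : StartsAtDelta N r ts t' x' p
  positive : PositiveInside N r ts t' p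

/-- Solutions of the Schrödinger-type equation with the initial condition `δ(x - x')` at time
`t'`, positive in the alcove and vanishing at its boundary. -/
structure IsSchrodingerSolution (N : ℕ) (r ts β t' : ℝ) (x' : Fin N → ℝ)
    (ψ : ℝ → (Fin N → ℝ) → ℝ) : Prop where
  equation : SolvesSchrodinger N r ts β t' ψ
  initial : StartsAtDelta N r ts t' x' ψ
  positive : PositiveInside N r ts t' ψ
  boundary : VanishesAtBoundary N r ts t' ψ

/-- The transition probability density `p_N^{(β)}(·, · | t', x')` of the diffusion in the alcove
with forward Kolmogorov operator `ℒ_N^{(β)}`: the minimal positive fundamental solution of the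
forward Kolmogorov equation. It is the only solution whenever there is only one. -/
def IsTransitionDensity (N : ℕ) (r ts β t' : ℝ) (x' : Fin N → ℝ)
    (p : ℝ → (Fin N → ℝ) → ℝ) : Prop :=
  IsKolmogorovSolution N r ts β t' x' p ∧
    ∀ p₂, IsKolmogorovSolution N r ts β t' x' p₂ →
      ∀ t ∈ Ioo t' ts, ∀ x ∈ alcove N r, p t x ≤ p₂ t x

/-- The function `ψ_N^{(β)}(·, · | t', x')`: the minimal solution of the Schrödinger-type problem.
It is the only solution whenever there is only one. -/
def IsPsi (N : ℕ) (r ts β t' : ℝ) (x' : Fin N → ℝ) (ψ : ℝ → (Fin N → ℝ) → ℝ) : Prop :=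
  IsSchrodingerSolution N r ts β t' x' ψ ∧
    ∀ ψ₂, IsSchrodingerSolution N r ts β t' x' ψ₂ →
      ∀ t ∈ Ioo t' ts, ∀ x ∈ alcove N r, ψ t x ≤ ψ₂ t x

/-- The multiplier `(h_N^r(t, x) / h_N^r(t', x'))^{β/2}`. -/
def multiplier (N : ℕ) (r ts β t' : ℝ) (x' : Fin N → ℝ) (t : ℝ) (x : Fin N → ℝ) : ℝ :=
  (hN N r ts β t x / hN N r ts β t' x') ^ (β / 2)

end EllipticDyson

end

/-!
For (ii), both sides are alternating in `x`, and as functions of one particle they continue to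
entire functions with the quasi-periodicity of theta functions of degree `N`. Such functions form
a space of dimension at most `N`, so an alternating function with slices in it is determined up to
a constant by interpolation. The constant is found at the equidistant points, where the Gaussian
matrix is diagonalized by the discrete Fourier transform and Jacobi's triple product evaluates
both sides.

For (i), the determinant of heat kernels solves the backward heat equation, hence so does the
product of theta functions up to a power of `η`. In terms of its logarithm `-W_N` this says that
`∂W_N/∂t` is a combination of `ΔW_N`, `|∇W_N|²` and `∂ log η/∂t`; together with the heat equation
of `ϑ₁` itself, it is what makes conjugation by `h_N^{β/2}` turn `∂/∂t + ℋ` into `∂/∂t - ℒ`. The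
multiplier `m` is continuous up to the boundary with value `1` at `(t', x')`, so multiplication by
it preserves the initial and boundary conditions. Minimality of `p` gives `p ≤ m ψ`; then `p / m ≤
ψ` vanishes at the boundary, so it solves the Schrödinger problem and minimality of `ψ` gives
equality.
-/

noncomputable section

namespace EllipticDyson

/-! ### `q`-products -/

/-- The finite `q`-Pochhammer symbol `(a; q)_n`. -/
def qPochhammer {R : Type*} [CommRing R] (a q : R) (n : ℕ) : R :=
  ∏ i ∈ Finset.range n, (1 - a * q ^ i)

/-- The infinite `q`-Pochhammer symbol `(a; q)_∞`, which converges for `‖q‖ < 1`. -/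
def qPochhammerInf {R : Type*} [CommRing R] [TopologicalSpace R] (a q : R) : R :=
  ∏' i : ℕ, (1 - a * q ^ i)

section NormedField

variable {K : Type*} [NormedField K] {a q z : K}

theorem one_sub_mul_pow_ne_zero (ha : ‖a‖ < 1) (hq : ‖q‖ ≤ 1) (n : ℕ) : 1 - a * q ^ n ≠ 0 := by
  intro h
  have hlt : ‖a * q ^ n‖ < 1 := by
    rw [norm_mul, norm_pow]
    exact mul_lt_one_of_nonneg_of_lt_one_left (norm_nonneg _) ha
      (pow_le_one₀ (norm_nonneg _) hq)
  rw [← sub_eq_zero.mp h, norm_one] at hlt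
  exact lt_irrefl _ hlt

theorem summable_norm_mul_pow (hq : ‖q‖ < 1) (a : K) : Summable fun n : ℕ => ‖-(a * q ^ n)‖ := by
  simp_rw [norm_neg, norm_mul, norm_pow]
  exact (summable_geometric_of_lt_one (norm_nonneg _) hq).mul_left _

theorem qPochhammer_ne_zero (ha : ‖a‖ < 1) (hq : ‖q‖ ≤ 1) (n : ℕ) : qPochhammer a q n ≠ 0 :=
  Finset.prod_ne_zero_iff.mpr fun i _ => one_sub_mul_pow_ne_zero ha hq i

variable [CompleteSpace K]

theorem multipliable_one_sub_mul_pow (hq : ‖q‖ < 1) (a : K) :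
    Multipliable fun n : ℕ => 1 - a * q ^ n := by
  simp_rw [sub_eq_add_neg]
  exact multipliable_one_add_of_summable (summable_norm_mul_pow hq a)

theorem tendsto_qPochhammer (hq : ‖q‖ < 1) (a : K) :
    Tendsto (qPochhammer a q) atTop (𝓝 (qPochhammerInf a q)) :=
  (multipliable_one_sub_mul_pow hq a).hasProd.tendsto_prod_nat

theorem qPochhammerInf_ne_zero (hq : ‖q‖ < 1) (ha : ‖a‖ < 1) : qPochhammerInf a q ≠ 0 := by
  simp_rw [qPochhammerInf, sub_eq_add_neg]
  refine tprod_one_add_ne_zero_of_summable (fun n => ?_) (summable_norm_mul_pow hq a)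
  rw [← sub_eq_add_neg]
  exact one_sub_mul_pow_ne_zero ha hq.le n

theorem qPochhammerInf_eq_mul (hq : ‖q‖ < 1) (a : K) :
    qPochhammerInf a q = (1 - a) * qPochhammerInf (a * q) q := by
  have hshift (n : ℕ) : 1 - a * q ^ (n + 1) = 1 - a * q * q ^ n := by ring
  have h : Multipliable fun n : ℕ => 1 - a * q ^ (n + 1) := by
    simp_rw [hshift]
    exact multipliable_one_sub_mul_pow hq _
  have hzero := tprod_eq_zero_mul' (f := fun n : ℕ => 1 - a * q ^ n) h
  simp only [pow_zero, mul_one, hshift] at hzero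
  exact hzero

theorem prod_qPochhammerInf_pow (hq : ‖q‖ < 1) (a : K) {N : ℕ} (hN : 0 < N) :
    ∏ i ∈ Finset.range N, qPochhammerInf (a * q ^ i) (q ^ N) = qPochhammerInf a q := by
  have : NeZero N := ⟨hN.ne'⟩
  have hqN : ‖q ^ N‖ < 1 := by
    rw [norm_pow]
    exact pow_lt_one₀ (norm_nonneg _) hq hN.ne'
  have hmul (i : Fin N) (n : ℕ) : 1 - a * q ^ (i : ℕ) * (q ^ N) ^ n = 1 - a * q ^ (n * N + i) := by
    ring
  have hblocks := (Nat.divModEquiv N).symm.multipliable_iff.mpr (multipliable_one_sub_mul_pow hq a)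
  simp_rw [Finset.prod_range, qPochhammerInf]
  rw [← Multipliable.tprod_finsetProd fun i _ => multipliable_one_sub_mul_pow hqN _,
    ← (Nat.divModEquiv N).symm.tprod_eq fun n => 1 - a * q ^ n]
  refine Eq.trans ?_ (hblocks.tprod_prod' fun _ => Multipliable.of_finite).symm
  refine tprod_congr fun n => ?_
  simp only [tprod_fintype, hmul, Function.comp_apply, Nat.divModEquiv_symm_apply]

theorem prod_qPochhammerInf_primitiveRoot (hq : ‖q‖ < 1) (a : K) {N : ℕ} (hN : 0 < N)
    (hz : IsPrimitiveRoot z N) :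
    ∏ i ∈ Finset.range N, qPochhammerInf (a * z ^ i) q = qPochhammerInf (a ^ N) (q ^ N) := by
  simp_rw [qPochhammerInf]
  rw [← Multipliable.tprod_finsetProd fun i _ => multipliable_one_sub_mul_pow hq _]
  refine tprod_congr fun n => ?_
  have h := congrArg (Polynomial.eval 1)
    (X_pow_sub_C_eq_prod hz hN (α := a * q ^ n) (a := a ^ N * (q ^ N) ^ n) (by ring))
  simp only [Polynomial.eval_prod, Polynomial.eval_sub, Polynomial.eval_pow, Polynomial.eval_X,
    Polynomial.eval_C, one_pow] at h
  rw [h]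
  exact Finset.prod_congr rfl fun i _ => by ring

end NormedField

theorem ofReal_qPochhammerInf {q : ℝ} (hq : ‖q‖ < 1) (a : ℝ) :
    ((qPochhammerInf a q : ℝ) : ℂ) = qPochhammerInf (a : ℂ) (q : ℂ) := by
  refine ((multipliable_one_sub_mul_pow hq a).map_tprod Complex.ofRealHom
    Complex.continuous_ofReal).trans (tprod_congr fun n => ?_)
  simp

theorem qPochhammerInf_pos {a q : ℝ} (ha : ‖a‖ < 1) (hq : 0 ≤ q) (hq1 : q < 1) :
    0 < qPochhammerInf a q := by
  have hq' : ‖q‖ < 1 := by rwa [Real.norm_of_nonneg hq]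
  refine lt_of_le_of_ne (tprod_nonneg fun n => ?_) (qPochhammerInf_ne_zero hq' ha).symm
  have h : a * q ^ n ≤ ‖a‖ * 1 := by
    gcongr
    · exact Real.le_norm_self a
    · exact pow_le_one₀ hq hq1.le
  linarith

/-! ### Jacobi's triple product -/

theorem exists_norm_le_of_tendsto {E : Type*} [SeminormedAddCommGroup E] {u : ℕ → E} {a : E}
    (h : Tendsto u atTop (𝓝 a)) :
    ∃ C, 0 ≤ C ∧ ∀ n, ‖u n‖ ≤ C := by
  obtain ⟨C, hC⟩ := (Metric.isBounded_range_of_tendsto u h).exists_norm_le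
  exact ⟨C, (norm_nonneg _).trans (hC _ ⟨0, rfl⟩), fun n => hC _ ⟨n, rfl⟩⟩

section TripleProduct

variable {K : Type*} [NormedField K] {q z : K}

/-- `1 / (q; q)_n`, with the usual convention that it vanishes for `n < 0`. -/
def qFactorialInv (q : K) (n : ℤ) : K := if n < 0 then 0 else (qPochhammer q q n.toNat)⁻¹

/-- The coefficient of `z ^ k` in `∏_{j < m} (1 + q^{2j+1} z) (1 + q^{2j+1} z⁻¹)`. -/
def tripleCoeff (q : K) (m : ℕ) (k : ℤ) : K :=
  q ^ (k ^ 2) * qPochhammer (q ^ 2) (q ^ 2) (2 * m) * qFactorialInv (q ^ 2) (m + k)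
    * qFactorialInv (q ^ 2) (m - k)

theorem norm_sq_lt_one (hq : ‖q‖ < 1) : ‖q ^ 2‖ < 1 := by
  rw [norm_pow]
  exact pow_lt_one₀ (norm_nonneg _) hq two_ne_zero

theorem qFactorialInv_sub_one (hq : ‖q‖ < 1) (n : ℤ) :
    qFactorialInv q (n - 1) = (1 - q ^ n) * qFactorialInv q n := by
  rcases lt_trichotomy n 0 with hneg | rfl | hpos
  · simp [qFactorialInv, hneg, show n - 1 < 0 by omega]
  · simp [qFactorialInv]
  · obtain ⟨m, rfl⟩ : ∃ m : ℕ, n = m + 1 := ⟨(n - 1).toNat, by omega⟩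
    have hfactor := one_sub_mul_pow_ne_zero hq hq.le m
    have hprod := qPochhammer_ne_zero hq hq.le m
    have hpow : q ^ ((m : ℤ) + 1) = q * q ^ m := by
      rw [← pow_succ']
      exact_mod_cast zpow_natCast q (m + 1)
    have hsucc : qPochhammer q q (m + 1) = qPochhammer q q m * (1 - q * q ^ m) :=
      Finset.prod_range_succ _ _
    simp only [qFactorialInv, add_sub_cancel_right, Int.toNat_natCast, hpow,
      if_neg (show ¬ (m : ℤ) < 0 by omega), if_neg (show ¬ (m : ℤ) + 1 < 0 by omega),
      show ((m : ℤ) + 1).toNat = m + 1 by omega, hsucc]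
    field_simp

theorem zpow_add_one_sq (hq : q ≠ 0) (k : ℤ) :
    q ^ ((k + 1) ^ 2) = q ^ (k ^ 2) * (q * (q ^ 2) ^ k) := by
  rw [← zpow_natCast, ← zpow_mul, ← zpow_one_add₀ hq, ← zpow_add₀ hq]
  congr 1
  push_cast
  ring

theorem zpow_sub_one_sq (hq : q ≠ 0) (k : ℤ) :
    q ^ ((k - 1) ^ 2) = q ^ (k ^ 2) * (q * ((q ^ 2) ^ k)⁻¹) := by
  have h := zpow_add_one_sq hq (-k)
  rwa [neg_sq, zpow_neg, show (-k + 1) ^ 2 = (k - 1) ^ 2 by ring] at h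

theorem qPochhammer_two_mul_succ {R : Type*} [CommRing R] (Q : R) (m : ℕ) :
    qPochhammer Q Q (2 * (m + 1))
      = qPochhammer Q Q (2 * m) * (1 - Q * (Q ^ m) ^ 2) * (1 - Q ^ 2 * (Q ^ m) ^ 2) := by
  rw [show 2 * (m + 1) = 2 * m + 1 + 1 by ring, qPochhammer, Finset.prod_range_succ,
    Finset.prod_range_succ, ← qPochhammer]
  ring

theorem tripleCoeff_succ (hq : ‖q‖ < 1) (hq0 : q ≠ 0) (m : ℕ) (k : ℤ) :
    tripleCoeff q (m + 1) k = (1 + q ^ (4 * m + 2)) * tripleCoeff q m k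
      + q ^ (2 * m + 1) * (tripleCoeff q m (k - 1) + tripleCoeff q m (k + 1)) := by
  have hQ := norm_sq_lt_one hq
  have hrec := qFactorialInv_sub_one hQ
  have hplus := zpow_add_one_sq hq0 k
  have hminus := zpow_sub_one_sq hq0 k
  have hodd : q ^ (2 * m + 1) = q * (q ^ 2) ^ m := by ring
  have heven : q ^ (4 * m + 2) = q ^ 2 * ((q ^ 2) ^ m) ^ 2 := by ring
  have hQ0 : q ^ 2 ≠ 0 := pow_ne_zero _ hq0
  simp only [tripleCoeff, hplus, hminus, hodd, heven, qPochhammer_two_mul_succ]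
  have hqq : q * q = q ^ 2 := (sq q).symm
  generalize q ^ 2 = Q at *
  have hm_add : qFactorialInv Q (m + k) = (1 - Q ^ ((m + 1 : ℕ) + k)) *
      qFactorialInv Q ((m + 1 : ℕ) + k) := by
    rw [← hrec, Nat.cast_add_one, add_right_comm, add_sub_cancel_right]
  have hm_sub : qFactorialInv Q (m - k) = (1 - Q ^ ((m + 1 : ℕ) - k)) *
      qFactorialInv Q ((m + 1 : ℕ) - k) := by
    rw [← hrec, Nat.cast_add_one, sub_right_comm, add_sub_cancel_right]
  rw [← add_sub_assoc, ← sub_sub, hrec, hrec, hm_add, hm_sub,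
    show (m : ℤ) - (k - 1) = (m + 1 : ℕ) - k by push_cast; ring,
    show (m : ℤ) + (k + 1) = (m + 1 : ℕ) + k by push_cast; ring]
  simp only [zpow_add₀ hQ0, zpow_sub₀ hQ0, zpow_natCast, pow_succ]
  have hk0 : Q ^ k ≠ 0 := zpow_ne_zero _ hQ0
  generalize Q ^ k = b at *
  generalize Q ^ m = a at *
  generalize qFactorialInv Q ((m + 1 : ℕ) + k) = G
  generalize qFactorialInv Q ((m + 1 : ℕ) - k) = G'
  generalize qPochhammer Q Q (2 * m) = A
  subst hqq
  field_simp
  ring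

theorem hasSum_tripleCoeff (hq : ‖q‖ < 1) (hq0 : q ≠ 0) (hz : z ≠ 0) (m : ℕ) :
    HasSum (fun k : ℤ => tripleCoeff q m k * z ^ k)
      (qPochhammer (-(q * z)) (q ^ 2) m * qPochhammer (-(q * z⁻¹)) (q ^ 2) m) := by
  induction m with
  | zero =>
    have hcoeff : (fun k : ℤ => tripleCoeff q 0 k * z ^ k) = fun k => if k = 0 then 1 else 0 := by
      funext k
      rcases lt_trichotomy k 0 with hk | rfl | hk
      · simp [tripleCoeff, qFactorialInv, hk, hk.ne]
      · simp [tripleCoeff, qFactorialInv, qPochhammer]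
      · simp [tripleCoeff, qFactorialInv, hk, hk.ne']
    simpa [hcoeff, qPochhammer] using hasSum_ite_eq (0 : ℤ) (1 : K)
  | succ m ih =>
    have hpred := ((Equiv.subRight (1 : ℤ)).hasSum_iff.mpr ih).mul_left z
    have hsucc := ((Equiv.addRight (1 : ℤ)).hasSum_iff.mpr ih).mul_left z⁻¹
    have hsum := (ih.mul_left (1 + q ^ (4 * m + 2))).add
      ((hpred.add hsucc).mul_left (q ^ (2 * m + 1)))
    have hprod (a b : K) :
        (a * (1 - -(q * z) * (q ^ 2) ^ m)) * (b * (1 - -(q * z⁻¹) * (q ^ 2) ^ m))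
        = (1 + q ^ (4 * m + 2)) * (a * b)
          + q ^ (2 * m + 1) * (z * (a * b) + z⁻¹ * (a * b)) := by
      field_simp
      ring
    rw [qPochhammer, Finset.prod_range_succ, qPochhammer, Finset.prod_range_succ, hprod]
    refine hsum.congr_fun fun k => ?_
    rw [tripleCoeff_succ hq hq0]
    simp only [Function.comp_apply, Equiv.subRight_apply, Equiv.coe_addRight, zpow_sub_one₀ hz,
      zpow_add_one₀ hz]
    field_simp

theorem summable_norm_zpow_sq_mul_zpow (hq : ‖q‖ < 1) (hq0 : q ≠ 0) (hz : z ≠ 0) :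
    Summable fun k : ℤ => ‖q ^ (k ^ 2) * z ^ k‖ := by
  have hlog : Real.log ‖q‖ < 0 := Real.log_neg (norm_pos_iff.mpr hq0) hq
  set τ : ℂ := Complex.I * (-Real.log ‖q‖ / π : ℝ) with hτ
  set w : ℂ := -Complex.I * (Real.log ‖z‖ / (2 * π) : ℝ) with hw
  have hτ_im : 0 < τ.im := by
    rw [hτ, Complex.I_mul_im, Complex.ofReal_re]
    exact div_pos (neg_pos.mpr hlog) Real.pi_pos
  refine ((summable_jacobiTheta₂_term_iff w τ).mpr hτ_im).norm.congr fun k => ?_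
  have hpi : (π : ℂ) ≠ 0 := by exact_mod_cast Real.pi_ne_zero
  have hexp : 2 * π * Complex.I * k * w + π * Complex.I * k ^ 2 * τ
      = (((k ^ 2 : ℤ) * Real.log ‖q‖ + k * Real.log ‖z‖ : ℝ) : ℂ) := by
    rw [hτ, hw]
    push_cast
    field_simp
    linear_combination (-k * (Real.log ‖z‖ + k * Real.log ‖q‖) : ℂ) * Complex.I_sq
  rw [jacobiTheta₂_term, hexp, Complex.norm_exp, Complex.ofReal_re, Real.exp_add,
    norm_mul, norm_zpow, norm_zpow, ← Real.log_zpow, ← Real.log_zpow,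
    Real.exp_log (zpow_pos (norm_pos_iff.mpr hq0) _),
    Real.exp_log (zpow_pos (norm_pos_iff.mpr hz) _)]

variable [CompleteSpace K]

theorem tendsto_qFactorialInv (hq : ‖q‖ < 1) {f : ℕ → ℤ} (hf : Tendsto f atTop atTop) :
    Tendsto (fun m => qFactorialInv q (f m)) atTop (𝓝 (qPochhammerInf q q)⁻¹) := by
  have htoNat : Tendsto (fun m => (f m).toNat) atTop atTop := by
    refine tendsto_atTop.mpr fun b => ?_
    filter_upwards [hf.eventually_ge_atTop (b : ℤ)] with m hm
    omega
  refine (((tendsto_qPochhammer hq q).inv₀ (qPochhammerInf_ne_zero hq hq)).comp htoNat).congr' ?_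
  filter_upwards [hf.eventually_ge_atTop 0] with m hm
  rw [qFactorialInv, if_neg (by omega), Function.comp_apply]

theorem exists_norm_tripleCoeff_le (hq : ‖q ^ 2‖ < 1) :
    ∃ C, ∀ (m : ℕ) (k : ℤ), ‖tripleCoeff q m k‖ ≤ C * ‖q ^ (k ^ 2)‖ := by
  have hlim := tendsto_qPochhammer hq (q ^ 2)
  obtain ⟨A, hA0, hA⟩ := exists_norm_le_of_tendsto hlim
  obtain ⟨B, hB0, hB⟩ :=
    exists_norm_le_of_tendsto (hlim.inv₀ (qPochhammerInf_ne_zero hq hq))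
  have hinv (n : ℤ) : ‖qFactorialInv (q ^ 2) n‖ ≤ B := by
    rw [qFactorialInv]
    split_ifs
    · simpa using hB0
    · exact hB _
  refine ⟨A * B * B, fun m k => ?_⟩
  calc ‖tripleCoeff q m k‖
      = ‖qPochhammer (q ^ 2) (q ^ 2) (2 * m)‖ * ‖qFactorialInv (q ^ 2) (m + k)‖
          * ‖qFactorialInv (q ^ 2) (m - k)‖ * ‖q ^ (k ^ 2)‖ := by
        simp only [tripleCoeff, norm_mul]
        ring
    _ ≤ A * B * B * ‖q ^ (k ^ 2)‖ := by
        gcongr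
        exacts [hA _, hinv _, hinv _]

theorem tendsto_tripleCoeff (hq : ‖q ^ 2‖ < 1) (k : ℤ) :
    Tendsto (fun m => tripleCoeff q m k) atTop
      (𝓝 ((qPochhammerInf (q ^ 2) (q ^ 2))⁻¹ * q ^ (k ^ 2))) := by
  have hP := qPochhammerInf_ne_zero hq hq
  have hprod := (tendsto_qPochhammer hq (q ^ 2)).comp (tendsto_id.const_mul_atTop' two_pos)
  have hplus := tendsto_qFactorialInv hq (f := fun m : ℕ => (m : ℤ) + k)
    (tendsto_atTop_add_const_right _ _ tendsto_natCast_atTop_atTop)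
  have hminus := tendsto_qFactorialInv hq (f := fun m : ℕ => (m : ℤ) - k)
    (tendsto_atTop_add_const_right _ _ tendsto_natCast_atTop_atTop)
  convert ((hprod.const_mul (q ^ (k ^ 2))).mul hplus).mul hminus using 2
  · rfl
  · field_simp

theorem jacobi_triple_product (hq : ‖q‖ < 1) (hq0 : q ≠ 0) (hz : z ≠ 0) :
    ∑' k : ℤ, q ^ (k ^ 2) * z ^ k = qPochhammerInf (q ^ 2) (q ^ 2)
      * (qPochhammerInf (-(q * z)) (q ^ 2) * qPochhammerInf (-(q * z⁻¹)) (q ^ 2)) := by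
  have hQ := norm_sq_lt_one hq
  obtain ⟨C, hC⟩ := exists_norm_tripleCoeff_le hQ
  have hseries : Tendsto (fun m : ℕ => ∑' k : ℤ, tripleCoeff q m k * z ^ k) atTop
      (𝓝 (∑' k : ℤ, (qPochhammerInf (q ^ 2) (q ^ 2))⁻¹ * (q ^ (k ^ 2) * z ^ k))) := by
    refine tendsto_tsum_of_dominated_convergence
      ((summable_norm_zpow_sq_mul_zpow hq hq0 hz).mul_left C) (fun k => ?_)
      (Eventually.of_forall fun m k => ?_)
    · simpa only [mul_assoc] using (tendsto_tripleCoeff hQ k).mul_const (z ^ k)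
    · rw [norm_mul, norm_mul, ← mul_assoc]
      exact mul_le_mul_of_nonneg_right (hC m k) (norm_nonneg _)
  have hproduct : Tendsto (fun m : ℕ => ∑' k : ℤ, tripleCoeff q m k * z ^ k) atTop
      (𝓝 (qPochhammerInf (-(q * z)) (q ^ 2) * qPochhammerInf (-(q * z⁻¹)) (q ^ 2))) := by
    simp_rw [(hasSum_tripleCoeff hq hq0 hz _).tsum_eq]
    exact (tendsto_qPochhammer hQ _).mul (tendsto_qPochhammer hQ _)
  rw [← tendsto_nhds_unique hseries hproduct, tsum_mul_left,
    mul_inv_cancel_left₀ (qPochhammerInf_ne_zero hQ hQ)]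

end TripleProduct

/-! ### Product formulas for `ϑ₁` and `η` -/

/-- The square `q² = e^{2πiτ}` of the nome at `τ = i s`. -/
def nomeSq (s : ℝ) : ℝ := Real.exp (-(2 * π * s))

theorem nomeSq_pos (s : ℝ) : 0 < nomeSq s := Real.exp_pos _

theorem norm_nomeSq_lt_one {s : ℝ} (hs : 0 < s) : ‖nomeSq s‖ < 1 := by
  rw [nomeSq, Real.norm_eq_abs, Real.abs_exp, Real.exp_lt_one_iff, neg_lt_zero]
  positivity

theorem nomeSq_natCast_mul (N : ℕ) (s : ℝ) : nomeSq (N * s) = nomeSq s ^ N := by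
  rw [nomeSq, nomeSq, ← Real.exp_nat_mul]
  ring_nf

local notation "𝕢" => Function.Periodic.qParam 1

theorem two_mul_sin_pi_mul (v : ℂ) :
    2 * Complex.sin (π * v) = Complex.I * Complex.exp (-(π * Complex.I * v)) * (1 - 𝕢 v) := by
  have hmul : Complex.exp (-(π * Complex.I * v)) * 𝕢 v = Complex.exp (π * v * Complex.I) := by
    rw [Function.Periodic.qParam, ← Complex.exp_add]
    push_cast
    ring_nf
  have hneg : Complex.exp (-(π * v) * Complex.I) = Complex.exp (-(π * Complex.I * v)) := by
    ring_nf
  rw [Complex.two_sin, hneg]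
  linear_combination Complex.I * hmul

theorem theta1_term_eq (v τ : ℂ) (n : ℤ) :
    (-1 : ℂ) ^ n * Complex.exp (π * Complex.I * τ * ((n : ℂ) - 1 / 2) ^ 2)
        * Complex.exp (π * Complex.I * v * (2 * (n : ℂ) - 1))
      = Complex.exp (π * Complex.I * τ / 4) * Complex.exp (-(π * Complex.I * v))
        * (Complex.exp (π * Complex.I * τ) ^ (n ^ 2)
          * (-(𝕢 v * (Complex.exp (π * Complex.I * τ))⁻¹)) ^ n) := by
  rw [neg_eq_neg_one_mul (𝕢 v * _), mul_zpow, mul_zpow, Function.Periodic.qParam,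
    ← Complex.exp_neg, mul_assoc, ← Complex.exp_add, mul_left_comm (Complex.exp _ ^ (n ^ 2)),
    mul_left_comm _ ((-1 : ℂ) ^ n)]
  simp only [← Complex.exp_int_mul, ← Complex.exp_add]
  push_cast
  ring_nf

theorem theta1_eq_qPochhammerInf (v : ℂ) {τ : ℂ} (hτ : 0 < τ.im) :
    theta1 v τ = 2 * Complex.exp (π * Complex.I * τ / 4) * Complex.sin (π * v)
      * qPochhammerInf (𝕢 τ) (𝕢 τ)
      * (qPochhammerInf (𝕢 v * 𝕢 τ) (𝕢 τ) * qPochhammerInf ((𝕢 v)⁻¹ * 𝕢 τ) (𝕢 τ)) := by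
  set q := Complex.exp (π * Complex.I * τ) with hq
  set w := 𝕢 v
  have hq_lt : ‖q‖ < 1 := by
    rw [hq, Complex.norm_exp, Real.exp_lt_one_iff]
    simp only [mul_assoc, Complex.re_ofReal_mul, Complex.I_mul_re]
    exact mul_neg_of_pos_of_neg Real.pi_pos (neg_lt_zero.mpr hτ)
  have hq0 : q ≠ 0 := Complex.exp_ne_zero _
  have hw0 : w ≠ 0 := Complex.exp_ne_zero _
  have hsq : 𝕢 τ = q ^ 2 := by
    rw [hq, ← Complex.exp_nat_mul, Function.Periodic.qParam]
    push_cast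
    ring_nf
  have hz : -(w * q⁻¹) ≠ 0 := neg_ne_zero.mpr (mul_ne_zero hw0 (inv_ne_zero hq0))
  have hqz : -(q * -(w * q⁻¹)) = w := by field_simp
  have hqz' : -(q * (-(w * q⁻¹))⁻¹) = w⁻¹ * q ^ 2 := by field_simp
  simp_rw [theta1, theta1_term_eq]
  rw [tsum_mul_left, jacobi_triple_product hq_lt hq0 hz, hqz, hqz',
    qPochhammerInf_eq_mul (norm_sq_lt_one hq_lt) w, hsq]
  linear_combination (-Complex.exp (π * Complex.I * τ / 4) * qPochhammerInf (q ^ 2) (q ^ 2)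
    * qPochhammerInf (w * q ^ 2) (q ^ 2) * qPochhammerInf (w⁻¹ * q ^ 2) (q ^ 2))
    * two_mul_sin_pi_mul v

theorem qParam_I_mul_ofReal (s : ℝ) : 𝕢 (Complex.I * s) = (nomeSq s : ℝ) := by
  rw [nomeSq, Complex.ofReal_exp, Function.Periodic.qParam]
  congr 1
  push_cast
  linear_combination (2 * π * s : ℂ) * Complex.I_mul_I

theorem norm_qParam_ofReal (v : ℝ) : ‖𝕢 (v : ℂ)‖ = 1 := by
  simp [Function.Periodic.norm_qParam]

theorem conj_qPochhammerInf {q : ℂ} (hq : ‖q‖ < 1) (a : ℂ) :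
    (starRingEnd ℂ) (qPochhammerInf a q)
      = qPochhammerInf (starRingEnd ℂ a) (starRingEnd ℂ q) := by
  rw [qPochhammerInf, (multipliable_one_sub_mul_pow hq a).map_tprod _ Complex.continuous_conj]
  simp only [map_sub, map_one, map_mul, map_pow, qPochhammerInf]

theorem theta1R_eq_qPochhammerInf (v : ℝ) {s : ℝ} (hs : 0 < s) :
    theta1R v s = 2 * Real.exp (-(π * s / 4)) * Real.sin (π * v)
      * qPochhammerInf (nomeSq s) (nomeSq s)
      * ‖qPochhammerInf (𝕢 v * nomeSq s) (nomeSq s : ℂ)‖ ^ 2 := by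
  have hτ : 0 < (Complex.I * s).im := by simpa using hs
  have hQ : ‖(nomeSq s : ℂ)‖ < 1 := by simpa using norm_nomeSq_lt_one hs
  have hexp : Complex.exp (π * Complex.I * (Complex.I * s) / 4) = Complex.exp (-(π * s / 4)) := by
    congr 1
    linear_combination (π * s / 4 : ℂ) * Complex.I_mul_I
  have hconj : qPochhammerInf ((𝕢 v)⁻¹ * nomeSq s) (nomeSq s : ℂ)
      = (starRingEnd ℂ) (qPochhammerInf (𝕢 v * nomeSq s) (nomeSq s : ℂ)) := by
    rw [conj_qPochhammerInf hQ, map_mul, Complex.conj_ofReal,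
      Complex.inv_eq_conj (norm_qParam_ofReal v)]
  apply Complex.ofReal_injective
  rw [ofReal_theta1R, theta1_eq_qPochhammerInf _ hτ, qParam_I_mul_ofReal, hconj, hexp,
    Complex.mul_conj']
  push_cast [ofReal_qPochhammerInf (norm_nomeSq_lt_one hs)]
  rfl

theorem theta1R_pos {v s : ℝ} (hv : v ∈ Ioo 0 1) (hs : 0 < s) : 0 < theta1R v s := by
  have hsin : 0 < Real.sin (π * v) := by
    refine Real.sin_pos_of_pos_of_lt_pi (mul_pos Real.pi_pos hv.1) ?_
    simpa using mul_lt_mul_of_pos_left hv.2 Real.pi_pos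
  have hQ := norm_nomeSq_lt_one hs
  have hQ' : ‖(nomeSq s : ℂ)‖ < 1 := by rwa [Complex.norm_real]
  have hne : qPochhammerInf (𝕢 v * nomeSq s) (nomeSq s : ℂ) ≠ 0 :=
    qPochhammerInf_ne_zero hQ' (by rwa [norm_mul, norm_qParam_ofReal, one_mul])
  have := qPochhammerInf_pos hQ (nomeSq_pos s).le (lt_of_abs_lt hQ)
  rw [theta1R_eq_qPochhammerInf v hs]
  positivity

theorem etaR_eq_qPochhammerInf {s : ℝ} (hs : 0 < s) :
    etaR s = Real.exp (-(π * s / 12)) * qPochhammerInf (nomeSq s) (nomeSq s) := by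
  have hq24 : Function.Periodic.qParam 24 (Complex.I * s) = Complex.exp (-(π * s / 12)) := by
    rw [Function.Periodic.qParam]
    congr 1
    push_cast
    linear_combination (2 * π * s / 24 : ℂ) * Complex.I_mul_I
  have hprod : ∏' n, (1 - ModularForm.eta_q n (Complex.I * s))
      = qPochhammerInf (nomeSq s : ℂ) (nomeSq s : ℂ) := by
    refine tprod_congr fun n => ?_
    rw [ModularForm.eta_q, qParam_I_mul_ofReal, pow_succ']
  apply Complex.ofReal_injective
  rw [ofReal_etaR s hs, ModularForm.eta, hq24, hprod]
  push_cast [ofReal_qPochhammerInf (norm_nomeSq_lt_one hs)]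
  rfl

theorem etaR_pos {s : ℝ} (hs : 0 < s) : 0 < etaR s := by
  have hQ := norm_nomeSq_lt_one hs
  have := qPochhammerInf_pos hQ (nomeSq_pos s).le (lt_of_abs_lt hQ)
  rw [etaR_eq_qPochhammerInf hs]
  positivity

/-! ### Special values of theta functions -/

theorem prod_two_mul_sin {N : ℕ} (hN : 0 < N) :
    ∏ d ∈ Finset.range (N - 1), (2 * Real.sin (π * (((d : ℝ) + 1) / N))) = N := by
  obtain ⟨n, rfl⟩ := Nat.exists_eq_add_one.mpr hN
  have hζ := Complex.isPrimitiveRoot_exp (n + 1) hN.ne'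
  have hnorm := congrArg norm hζ.prod_one_sub_pow_eq_order
  rw [norm_prod, ← Nat.cast_succ, Complex.norm_natCast] at hnorm
  refine Eq.trans ?_ hnorm
  rw [Nat.add_sub_cancel]
  refine Finset.prod_congr rfl fun d hd => ?_
  have hangle : Complex.exp (2 * π * Complex.I / (n + 1 : ℕ)) ^ (d + 1)
      = Complex.exp (Complex.I * ((2 * (π * (((d : ℝ) + 1) / (n + 1 : ℕ))) : ℝ) : ℂ)) := by
    rw [← Complex.exp_nat_mul]
    push_cast
    ring_nf
  have hle : ((d : ℝ) + 1) / (n + 1 : ℕ) ≤ 1 := by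
    rw [div_le_one (by positivity)]
    exact_mod_cast Nat.succ_le_succ (Finset.mem_range.mp hd).le
  have hsin : 0 ≤ Real.sin (π * (((d : ℝ) + 1) / (n + 1 : ℕ))) :=
    Real.sin_nonneg_of_nonneg_of_le_pi (by positivity) (mul_le_of_le_one_right Real.pi_pos.le hle)
  rw [hangle, norm_sub_rev, Complex.norm_exp_I_mul_ofReal_sub_one,
    mul_div_cancel_left₀ _ two_ne_zero, Real.norm_of_nonneg (by positivity)]

theorem prod_norm_qPochhammerInf_sq {N : ℕ} (hN : 0 < N) {s : ℝ} (hs : 0 < s) :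
    ∏ d ∈ Finset.range N, ‖qPochhammerInf (𝕢 (((d : ℝ) / N : ℝ)) * nomeSq s) (nomeSq s : ℂ)‖ ^ 2
      = qPochhammerInf (nomeSq s ^ N) (nomeSq s ^ N) ^ 2 := by
  have hQ : ‖(nomeSq s : ℂ)‖ < 1 := by simpa using norm_nomeSq_lt_one hs
  have hQN : ‖nomeSq s ^ N‖ < 1 := by
    simpa using pow_lt_one₀ (norm_nonneg _) (norm_nomeSq_lt_one hs) hN.ne'
  have hpow (d : ℕ) : 𝕢 (((d : ℝ) / N : ℝ)) * nomeSq s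
      = nomeSq s * Complex.exp (2 * π * Complex.I / N) ^ d := by
    rw [mul_comm, ← Complex.exp_nat_mul, Function.Periodic.qParam]
    push_cast
    ring_nf
  rw [Finset.prod_pow, ← norm_prod]
  simp only [hpow]
  rw [prod_qPochhammerInf_primitiveRoot hQ _ hN (Complex.isPrimitiveRoot_exp N hN.ne'),
    ← Complex.ofReal_pow, ← ofReal_qPochhammerInf hQN, Complex.norm_real, Real.norm_eq_abs, sq_abs]

theorem prod_theta1R_div {N : ℕ} (hN : 0 < N) {s : ℝ} (hs : 0 < s) :
    (∏ d ∈ Finset.range (N - 1), theta1R (((d : ℝ) + 1) / N) s)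
        * qPochhammerInf (nomeSq s) (nomeSq s) ^ 2
      = N * Real.exp (-(π * s / 4)) ^ (N - 1)
        * qPochhammerInf (nomeSq s) (nomeSq s) ^ (N - 1)
        * qPochhammerInf (nomeSq s ^ N) (nomeSq s ^ N) ^ 2 := by
  have hsin := prod_two_mul_sin hN
  have hroots := prod_norm_qPochhammerInf_sq hN hs
  obtain ⟨n, rfl⟩ := Nat.exists_eq_add_one.mpr hN
  have hzero : ‖qPochhammerInf (𝕢 (((0 : ℕ) : ℝ) / (n + 1 : ℕ) : ℝ) * nomeSq s) (nomeSq s : ℂ)‖ ^ 2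
      = qPochhammerInf (nomeSq s) (nomeSq s) ^ 2 := by
    rw [Nat.cast_zero, zero_div, Complex.ofReal_zero, Function.Periodic.qParam, mul_zero, zero_div,
      Complex.exp_zero, one_mul, ← ofReal_qPochhammerInf (norm_nomeSq_lt_one hs),
      Complex.norm_real, Real.norm_eq_abs, sq_abs]
  rw [Finset.prod_range_succ', hzero] at hroots
  rw [Nat.add_sub_cancel, Finset.prod_mul_distrib, Finset.prod_const, Finset.card_range] at hsin
  rw [← hroots, Nat.add_sub_cancel]
  simp only [theta1R_eq_qPochhammerInf _ hs, Finset.prod_mul_distrib, Finset.prod_const,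
    Finset.card_range, Nat.cast_succ] at hsin ⊢
  linear_combination
    (Real.exp (-(π * s / 4)) ^ n * qPochhammerInf (nomeSq s) (nomeSq s) ^ (n + 2)
      * ∏ d ∈ Finset.range n, ‖qPochhammerInf (𝕢 ((((d : ℝ) + 1) / (n + 1) : ℝ)) * nomeSq s)
          (nomeSq s : ℂ)‖ ^ 2) * hsin

theorem theta1R_half {s : ℝ} (hs : 0 < s) :
    theta1R (1 / 2) s = 2 * Real.exp (-(π * s / 4)) * qPochhammerInf (nomeSq s) (nomeSq s)
      * qPochhammerInf (-nomeSq s) (nomeSq s) ^ 2 := by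
  have hw : 𝕢 ((1 / 2 : ℝ) : ℂ) = -1 := by
    rw [← Complex.exp_pi_mul_I, Function.Periodic.qParam]
    push_cast
    ring_nf
  rw [theta1R_eq_qPochhammerInf _ hs, hw, neg_one_mul, ← Complex.ofReal_neg,
    ← ofReal_qPochhammerInf (norm_nomeSq_lt_one hs), Complex.norm_real, Real.norm_eq_abs, sq_abs,
    mul_one_div, Real.sin_pi_div_two, mul_one]

theorem tsum_exp_neg_sq {s : ℝ} (hs : 0 < s) (α : ℝ) :
    ∑' m : ℤ, Real.exp (-(π * s) * (α + m) ^ 2)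
      = Real.exp (-(π * s) * α ^ 2) * (qPochhammerInf (nomeSq s) (nomeSq s)
        * (qPochhammerInf (-Real.exp (-(2 * π * s) * (1 / 2 + α))) (nomeSq s)
          * qPochhammerInf (-Real.exp (-(2 * π * s) * (1 / 2 - α))) (nomeSq s))) := by
  have hq : ‖Real.exp (-(π * s))‖ < 1 := by
    rw [Real.norm_eq_abs, Real.abs_exp, Real.exp_lt_one_iff, neg_lt_zero]
    positivity
  have hsq : nomeSq s = Real.exp (-(π * s)) ^ 2 := by
    rw [nomeSq, ← Real.exp_nat_mul]
    push_cast
    ring_nf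
  have hterm (m : ℤ) : Real.exp (-(π * s) * (α + m) ^ 2)
      = Real.exp (-(π * s) * α ^ 2)
        * (Real.exp (-(π * s)) ^ (m ^ 2) * Real.exp (-(2 * π * s * α)) ^ m) := by
    rw [← Real.rpow_intCast, ← Real.rpow_intCast, ← Real.exp_mul, ← Real.exp_mul, ← Real.exp_add,
      ← Real.exp_add]
    push_cast
    ring_nf
  simp_rw [hterm]
  rw [tsum_mul_left, jacobi_triple_product hq (Real.exp_ne_zero _) (Real.exp_ne_zero _), hsq,
    ← Real.exp_neg, ← Real.exp_add, ← Real.exp_add]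
  ring_nf

theorem sum_range_sq_centered {N : ℕ} (hN : 0 < N) :
    ∑ i ∈ Finset.range N, (((i : ℝ) + 1) / N - 1 / 2) ^ 2 * N = (N : ℝ) ^ 2 / 12 + 1 / 6 := by
  have hpartial (M : ℕ) : ∑ i ∈ Finset.range M, (((i : ℝ) + 1) / N - 1 / 2) ^ 2 * N
      = ((M : ℝ) * (M + 1) * (2 * M + 1) / 6 - N * (M * (M + 1) / 2) + N ^ 2 * M / 4) / N := by
    induction M with
    | zero => simp
    | succ M ih =>
      rw [Finset.sum_range_succ, ih]
      push_cast
      field_simp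
      ring
  rw [hpartial]
  field_simp
  ring

theorem prod_tsum_exp_neg_sq {N : ℕ} (hN : 0 < N) {s : ℝ} (hs : 0 < s) :
    ∏ i ∈ Finset.range N,
        ∑' m : ℤ, Real.exp (-(π * (N * s)) * ((((i : ℝ) + 1) / N - 1 / 2) + m) ^ 2)
      = Real.exp (-(π * s / 12)) ^ (N ^ 2 + 2)
        * qPochhammerInf (nomeSq s ^ N) (nomeSq s ^ N) ^ N
        * (2 * qPochhammerInf (-nomeSq s) (nomeSq s) ^ 2) := by
  have hQ := norm_nomeSq_lt_one hs
  have hgauss : ∏ i ∈ Finset.range N, Real.exp (-(π * (N * s)) * (((i : ℝ) + 1) / N - 1 / 2) ^ 2)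
      = Real.exp (-(π * s / 12)) ^ (N ^ 2 + 2) := by
    have hsum : ∑ i ∈ Finset.range N, -(π * (N * s)) * (((i : ℝ) + 1) / N - 1 / 2) ^ 2
        = -(π * s) * ∑ i ∈ Finset.range N, (((i : ℝ) + 1) / N - 1 / 2) ^ 2 * N := by
      rw [Finset.mul_sum]
      exact Finset.sum_congr rfl fun i _ => by ring
    rw [← Real.exp_sum, ← Real.exp_nat_mul, hsum, sum_range_sq_centered hN]
    push_cast
    ring_nf
  have hleft : ∏ i ∈ Finset.range N,
      qPochhammerInf (-Real.exp (-(2 * π * (N * s)) * (1 / 2 + (((i : ℝ) + 1) / N - 1 / 2))))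
        (nomeSq s ^ N) = qPochhammerInf (-nomeSq s) (nomeSq s) := by
    rw [← prod_qPochhammerInf_pow hQ _ hN]
    refine Finset.prod_congr rfl fun i _ => ?_
    rw [neg_mul (nomeSq s), ← pow_succ', nomeSq, ← Real.exp_nat_mul _ (i + 1)]
    congr 3
    push_cast
    field_simp
    ring
  have hright : ∏ i ∈ Finset.range N,
      qPochhammerInf (-Real.exp (-(2 * π * (N * s)) * (1 / 2 - (((i : ℝ) + 1) / N - 1 / 2))))
        (nomeSq s ^ N) = 2 * qPochhammerInf (-nomeSq s) (nomeSq s) := by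
    have htwo := qPochhammerInf_eq_mul hQ (-1)
    rw [neg_one_mul, sub_neg_eq_add, one_add_one_eq_two] at htwo
    rw [← htwo, ← prod_qPochhammerInf_pow hQ _ hN, ← Finset.prod_range_reflect]
    refine Finset.prod_congr rfl fun i hi => ?_
    have hi' := Finset.mem_range.mp hi
    rw [neg_one_mul, nomeSq, ← Real.exp_nat_mul _ i, Nat.sub_right_comm, Nat.cast_sub (by lia)]
    congr 3
    push_cast [Nat.cast_sub hi'.le]
    field_simp
    ring
  simp only [tsum_exp_neg_sq (show (0 : ℝ) < N * s by positivity), Finset.prod_mul_distrib,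
    Finset.prod_const, Finset.card_range, nomeSq_natCast_mul, hgauss, hleft, hright]
  ring

theorem sq_theta1R_half_mul_prod {N : ℕ} (hN : 0 < N) {s : ℝ} (hs : 0 < s) :
    theta1R (1 / 2) s ^ 2 * (∏ d ∈ Finset.range (N - 1), theta1R (((d : ℝ) + 1) / N) s) ^ N
      = etaR s ^ ((N - 1) * (N - 2)) * (N : ℝ) ^ N
        * (∏ i ∈ Finset.range N,
            ∑' m : ℤ, Real.exp (-(π * (N * s)) * ((((i : ℝ) + 1) / N - 1 / 2) + m) ^ 2)) ^ 2 := by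
  have hQ := norm_nomeSq_lt_one hs
  have hP := qPochhammerInf_pos hQ (nomeSq_pos s).le (lt_of_abs_lt hQ)
  have hexp : Real.exp (-(π * s / 4)) = Real.exp (-(π * s / 12)) ^ 3 := by
    rw [← Real.exp_nat_mul]
    push_cast
    ring_nf
  have hprod := congrArg (· ^ N) (prod_theta1R_div hN hs)
  rw [prod_tsum_exp_neg_sq hN hs, theta1R_half hs, etaR_eq_qPochhammerInf hs]
  refine mul_right_cancel₀ (pow_ne_zero (2 * N) hP.ne') ?_
  simp only [hexp, mul_pow, ← pow_mul] at hprod ⊢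
  have hyexp : 2 * 3 + 3 * ((N - 1) * N) = (N - 1) * (N - 2) + (N ^ 2 + 2) * 2 := by
    obtain _ | _ | n := N
    · contradiction
    · rfl
    · change 2 * 3 + 3 * ((n + 1) * (n + 2)) = (n + 1) * n + ((n + 2) ^ 2 + 2) * 2
      ring
  have hPexp : 2 + (N - 1) * N = (N - 1) * (N - 2) + 2 * N := by
    obtain _ | _ | n := N
    · contradiction
    · rfl
    · change 2 + (n + 1) * (n + 2) = (n + 1) * n + 2 * (n + 2)
      ring
  set y := Real.exp (-(π * s / 12))
  set P := qPochhammerInf (nomeSq s) (nomeSq s)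
  set R := qPochhammerInf (-nomeSq s) (nomeSq s)
  set P' := qPochhammerInf (nomeSq s ^ N) (nomeSq s ^ N)
  have hy := congrArg (y ^ ·) hyexp
  have hPow := congrArg (P ^ ·) hPexp
  simp only [pow_add] at hy hPow
  linear_combination (4 * R ^ 4 * y ^ (2 * 3) * P ^ 2) * hprod
    + (4 * R ^ 4 * N ^ N * P' ^ (2 * N)) * (P ^ 2 * P ^ ((N - 1) * N)) * hy
    + (4 * R ^ 4 * N ^ N * P' ^ (2 * N)) * (y ^ ((N - 1) * (N - 2)) * y ^ ((N ^ 2 + 2) * 2)) * hPow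

/-! ### Gaussian Fourier series -/

/-- The terms `(i k)^m e^{-s k² + i k y}`, `k = n + a`, as functions of the pair `p = (y, s)`. -/
def gaussTerm (a : ℝ) (m : ℕ) (n : ℤ) (p : ℂ × ℂ) : ℂ :=
  (Complex.I * (n + a)) ^ m * Complex.exp (-p.2 * ((n : ℂ) + a) ^ 2 + Complex.I * (n + a) * p.1)

/-- The series `∑ (i k)^m e^{-s k² + i k y}` over `k ∈ ℤ + a`. The factor `(i k)^m` makes the family
closed under differentiation: `∂/∂y` raises `m` by one and `∂/∂s` by two, which is at once the
smoothness of the series and the heat equation. -/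
def gaussSeries (a : ℝ) (m : ℕ) (p : ℂ × ℂ) : ℂ := ∑' n : ℤ, gaussTerm a m n p

/-- A summable bound of `gaussTerm a m n (y, s)` on `|Im y| ≤ R`, `Re s ≥ c`. -/
def gaussBound (a : ℝ) (m : ℕ) (R c : ℝ) (n : ℤ) : ℝ :=
  m.factorial * Real.exp ((R + 1) ^ 2 / (2 * c)) * Real.exp (c * a ^ 2 / 2)
    * Real.exp (-c / 4 * n ^ 2)

theorem summable_exp_neg_mul_int_sq {c : ℝ} (hc : 0 < c) :
    Summable fun n : ℤ => Real.exp (-c * n ^ 2) := by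
  refine (summable_pow_mul_jacobiTheta₂_term_bound 0 (div_pos hc Real.pi_pos) 0).congr fun n => ?_
  rw [pow_zero, one_mul]
  congr 1
  field_simp
  ring

theorem summable_gaussBound (a : ℝ) (m : ℕ) (R : ℝ) {c : ℝ} (hc : 0 < c) :
    Summable (gaussBound a m R c) := by
  have hexp := summable_exp_neg_mul_int_sq (c := c / 4) (by positivity)
  simp only [← neg_div] at hexp
  exact hexp.mul_left _

theorem abs_pow_mul_exp_le {c : ℝ} (hc : 0 < c) (m : ℕ) (R k : ℝ) :
    |k| ^ m * Real.exp (-c * k ^ 2 + R * |k|)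
      ≤ m.factorial * Real.exp ((R + 1) ^ 2 / (2 * c)) * Real.exp (-c / 2 * k ^ 2) := by
  have hpow : |k| ^ m ≤ m.factorial * Real.exp |k| := by
    have := Real.pow_div_factorial_le_exp |k| (abs_nonneg k) m
    rwa [div_le_iff₀ (by positivity), mul_comm] at this
  have hsq : (R + 1) * |k| ≤ (R + 1) ^ 2 / (2 * c) + c / 2 * k ^ 2 := by
    have hdiff : (R + 1) ^ 2 / (2 * c) + c / 2 * k ^ 2 - (R + 1) * |k|
        = (R + 1 - c * |k|) ^ 2 / (2 * c) := by
      rw [← sq_abs k]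
      field_simp
      ring
    rw [← sub_nonneg, hdiff]
    positivity
  calc |k| ^ m * Real.exp (-c * k ^ 2 + R * |k|)
      ≤ m.factorial * Real.exp |k| * Real.exp (-c * k ^ 2 + R * |k|) := by gcongr
    _ = m.factorial * Real.exp (|k| + (-c * k ^ 2 + R * |k|)) := by rw [Real.exp_add |k|, mul_assoc]
    _ ≤ m.factorial * Real.exp ((R + 1) ^ 2 / (2 * c) + -c / 2 * k ^ 2) := by
        exact mul_le_mul_of_nonneg_left (Real.exp_le_exp.mpr (by linarith)) (by positivity)
    _ = _ := by rw [Real.exp_add, mul_assoc]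

theorem norm_gaussTerm_le (a : ℝ) (m : ℕ) {R c : ℝ} (hc : 0 < c) (n : ℤ) {p : ℂ × ℂ}
    (hR : |p.1.im| ≤ R) (hcp : c ≤ p.2.re) : ‖gaussTerm a m n p‖ ≤ gaussBound a m R c n := by
  set k : ℝ := n + a
  have hk : (n : ℂ) + a = (k : ℂ) := by push_cast [k]; rfl
  have hre : (-p.2 * (k : ℂ) ^ 2 + Complex.I * k * p.1).re = -p.2.re * k ^ 2 - k * p.1.im := by
    rw [← Complex.ofReal_pow, mul_comm Complex.I, mul_assoc, Complex.add_re,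
      Complex.re_ofReal_mul, Complex.re_mul_ofReal, Complex.I_mul_re, Complex.neg_re, mul_neg,
      sub_eq_add_neg]
  have hexponent : -p.2.re * k ^ 2 - k * p.1.im ≤ -c * k ^ 2 + R * |k| := by
    have hlin : -(k * p.1.im) ≤ R * |k| :=
      (neg_le_abs _).trans (by rw [abs_mul, mul_comm]; gcongr)
    nlinarith [sq_nonneg k]
  have hshift : -c / 2 * k ^ 2 ≤ c * a ^ 2 / 2 + -c / 4 * n ^ 2 := by
    simp only [k]
    nlinarith [sq_nonneg ((n : ℝ) + 2 * a)]
  rw [gaussTerm, hk, norm_mul, norm_pow, norm_mul, Complex.norm_I, one_mul, Complex.norm_real,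
    Complex.norm_exp, hre, gaussBound, Real.norm_eq_abs]
  calc |k| ^ m * Real.exp (-p.2.re * k ^ 2 - k * p.1.im)
      ≤ |k| ^ m * Real.exp (-c * k ^ 2 + R * |k|) := by gcongr
    _ ≤ _ := abs_pow_mul_exp_le hc m R k
    _ ≤ m.factorial * Real.exp ((R + 1) ^ 2 / (2 * c))
          * Real.exp (c * a ^ 2 / 2 + -c / 4 * n ^ 2) := by gcongr
    _ = _ := by rw [Real.exp_add, ← mul_assoc]

theorem summable_gaussTerm (a : ℝ) (m : ℕ) {p : ℂ × ℂ} (hp : 0 < p.2.re) :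
    Summable fun n => gaussTerm a m n p :=
  .of_norm_bounded (summable_gaussBound a m |p.1.im| hp)
    fun n => norm_gaussTerm_le a m hp n le_rfl le_rfl

theorem hasFDerivAt_gaussTerm (a : ℝ) (m : ℕ) (n : ℤ) (p : ℂ × ℂ) :
    HasFDerivAt (gaussTerm a m n) (gaussTerm a (m + 1) n p • ContinuousLinearMap.fst ℂ ℂ ℂ
      + gaussTerm a (m + 2) n p • ContinuousLinearMap.snd ℂ ℂ ℂ) p := by
  have hexp := (((hasFDerivAt_snd (𝕜 := ℂ) (p := p)).neg.mul_const (((n : ℂ) + a) ^ 2)).add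
    ((hasFDerivAt_fst (𝕜 := ℂ) (p := p)).const_mul (Complex.I * (n + a)))).cexp.const_mul
      ((Complex.I * ((n : ℂ) + a)) ^ m)
  refine hexp.congr_fderiv ?_
  have hsucc (j : ℕ) : gaussTerm a (j + 1) n p = Complex.I * (n + a) * gaussTerm a j n p := by
    rw [gaussTerm, gaussTerm, pow_succ']
    ring
  rw [hsucc (m + 1), hsucc m, gaussTerm]
  ext
  · simp
    ring
  · simp
    linear_combination (-(n + a : ℂ) ^ 2 * (Complex.I * (n + a)) ^ m
      * Complex.exp (-(p.2 * (n + a) ^ 2) + Complex.I * (n + a) * p.1)) * Complex.I_sq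

theorem hasFDerivAt_gaussSeries (a : ℝ) (m : ℕ) {p : ℂ × ℂ} (hp : 0 < p.2.re) :
    HasFDerivAt (gaussSeries a m) (gaussSeries a (m + 1) p • ContinuousLinearMap.fst ℂ ℂ ℂ
      + gaussSeries a (m + 2) p • ContinuousLinearMap.snd ℂ ℂ ℂ) p := by
  set R := |p.1.im| + 1
  set c := p.2.re / 2
  have hc0 : 0 < c := half_pos hp
  let U : Set (ℂ × ℂ) := (Complex.im ⁻¹' Ioo (-R) R) ×ˢ (Complex.re ⁻¹' Ioi c)
  have hUo : IsOpen U := (isOpen_Ioo.preimage Complex.continuous_im).prod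
    (isOpen_Ioi.preimage Complex.continuous_re)
  have hUc : Convex ℝ U := ((convex_Ioo (-R) R).linear_preimage Complex.imLm).prod
    ((convex_Ioi c).linear_preimage Complex.reLm)
  have hpU : p ∈ U := ⟨abs_lt.mp (lt_add_one |p.1.im|), half_lt_self hp⟩
  have hbound (j : ℕ) (n : ℤ) (q) (hq : q ∈ U) : ‖gaussTerm a j n q‖ ≤ gaussBound a j R c n :=
    norm_gaussTerm_le a j hc0 n (abs_lt.mpr hq.1).le (le_of_lt hq.2)
  have hsum (j : ℕ) := summable_gaussTerm a j hp
  have hderiv := hasFDerivAt_tsum_of_isPreconnected (𝕜 := ℂ)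
    ((summable_gaussBound a (m + 1) R hc0).add (summable_gaussBound a (m + 2) R hc0)) hUo
    hUc.isPreconnected (fun n q _ => hasFDerivAt_gaussTerm a m n q) (fun n q hq => ?_) hpU
    (hsum m) hpU
  · refine hderiv.congr_fderiv ?_
    rw [((hsum (m + 1)).smul_const _).tsum_add ((hsum (m + 2)).smul_const _),
      (hsum (m + 1)).tsum_smul_const, (hsum (m + 2)).tsum_smul_const]
    rfl
  · refine (norm_add_le _ _).trans (add_le_add ?_ ?_) <;> rw [norm_smul]
    · exact (mul_le_of_le_one_right (norm_nonneg _) (ContinuousLinearMap.norm_fst_le ..)).trans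
        (hbound _ _ _ hq)
    · exact (mul_le_of_le_one_right (norm_nonneg _) (ContinuousLinearMap.norm_snd_le ..)).trans
        (hbound _ _ _ hq)

theorem contDiffOn_gaussSeries (a : ℝ) (n m : ℕ) :
    ContDiffOn ℂ n (gaussSeries a m) {p : ℂ × ℂ | 0 < p.2.re} := by
  have hopen : IsOpen {p : ℂ × ℂ | 0 < p.2.re} :=
    isOpen_lt continuous_const (Complex.continuous_re.comp continuous_snd)
  have hdiff (m : ℕ) : DifferentiableOn ℂ (gaussSeries a m) {p : ℂ × ℂ | 0 < p.2.re} :=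
    fun p hp => (hasFDerivAt_gaussSeries a m hp).differentiableAt.differentiableWithinAt
  induction n generalizing m with
  | zero => exact contDiffOn_zero.mpr (hdiff m).continuousOn
  | succ n ih =>
    rw [Nat.cast_succ, contDiffOn_succ_iff_fderiv_of_isOpen hopen]
    refine ⟨hdiff m, by simp, ?_⟩
    exact (((ih (m + 1)).smul contDiffOn_const).add ((ih (m + 2)).smul contDiffOn_const)).congr
      fun p hp => (hasFDerivAt_gaussSeries a m hp).fderiv

theorem hasDerivAt_gaussSeries_fst (a : ℝ) (m : ℕ) (y : ℂ) {s : ℂ} (hs : 0 < s.re) :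
    HasDerivAt (fun z => gaussSeries a m (z, s)) (gaussSeries a (m + 1) (y, s)) y := by
  have h := (hasFDerivAt_gaussSeries a m (p := (y, s)) hs).comp_hasDerivAt y
    ((hasDerivAt_id y).prodMk (hasDerivAt_const y s))
  exact h.congr_deriv (by simp)

theorem hasDerivAt_gaussSeries_snd (a : ℝ) (m : ℕ) (y : ℂ) {s : ℂ} (hs : 0 < s.re) :
    HasDerivAt (fun z => gaussSeries a m (y, z)) (gaussSeries a (m + 2) (y, s)) s := by
  have h := (hasFDerivAt_gaussSeries a m (p := (y, s)) hs).comp_hasDerivAt s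
    ((hasDerivAt_const s y).prodMk (hasDerivAt_id s))
  exact h.congr_deriv (by simp)

theorem gaussSeries_add_quasiPeriod (a : ℝ) (M : ℤ) (y s : ℂ) :
    gaussSeries a 0 (y + 2 * Complex.I * M * s, s)
      = Complex.exp (M ^ 2 * s - Complex.I * M * y) * gaussSeries a 0 (y, s) := by
  rw [gaussSeries, gaussSeries, ← tsum_mul_left, ← (Equiv.addRight M).tsum_eq fun n =>
    Complex.exp (M ^ 2 * s - Complex.I * M * y) * gaussTerm a 0 n (y, s)]
  refine tsum_congr fun n => ?_
  simp only [gaussTerm, pow_zero, one_mul, Equiv.coe_addRight, ← Complex.exp_add]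
  congr 1
  push_cast
  linear_combination (2 * M * s * (n + a) : ℂ) * Complex.I_sq

theorem gaussSeries_add_two_pi (a : ℝ) (y s : ℂ) :
    gaussSeries a 0 (y + 2 * π, s)
      = Complex.exp (2 * π * Complex.I * a) * gaussSeries a 0 (y, s) := by
  rw [gaussSeries, gaussSeries, ← tsum_mul_left]
  refine tsum_congr fun n => ?_
  simp only [gaussTerm, pow_zero, one_mul, ← Complex.exp_add]
  rw [← Complex.exp_periodic.int_mul n (2 * π * Complex.I * a + _)]
  ring_nf

theorem gaussSeries_neg (N : ℕ) (y s : ℂ) :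
    gaussSeries (-(N / 2)) 0 (-y, s) = gaussSeries (-(N / 2)) 0 (y, s) := by
  rw [gaussSeries, gaussSeries, ← (Equiv.subLeft (N : ℤ)).tsum_eq]
  refine tsum_congr fun n => ?_
  simp only [gaussTerm, pow_zero, one_mul, Equiv.subLeft_apply]
  push_cast
  ring_nf

theorem theta1_eq_gaussSeries (v s : ℂ) :
    theta1 v (Complex.I * s) = -gaussSeries (-1 / 2) 0 (2 * π * v + π, π * s) := by
  rw [theta1, gaussSeries, ← tsum_mul_left, ← tsum_neg]
  refine tsum_congr fun n => ?_
  have hexp : Complex.exp (-(π * s) * ((n : ℂ) + ((-1 / 2 : ℝ) : ℂ)) ^ 2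
      + Complex.I * (n + ((-1 / 2 : ℝ) : ℂ)) * (2 * π * v + π))
      = Complex.exp (π * Complex.I * (Complex.I * s) * ((n : ℂ) - 1 / 2) ^ 2)
        * Complex.exp (π * Complex.I * v * (2 * (n : ℂ) - 1)) * Complex.exp (n * (π * Complex.I))
        * Complex.exp (-(π / 2 * Complex.I)) := by
    rw [← Complex.exp_add, ← Complex.exp_add, ← Complex.exp_add]
    congr 1
    push_cast
    linear_combination (-(π * s * (n - 1 / 2) ^ 2 : ℂ)) * Complex.I_sq
  rw [gaussTerm, hexp, pow_zero, one_mul, Complex.exp_int_mul, Complex.exp_pi_mul_I,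
    Complex.exp_neg, Complex.exp_pi_div_two_mul_I, Complex.inv_I]
  ring

theorem ofReal_parity_zpow_mul_pBM (N : ℕ) (r : ℝ) {t : ℝ} (ht : t ≠ 0) (x x' : ℝ) (w : ℤ) :
    ((parity N ^ w * pBM t (x + 2 * π * r * w) x' : ℝ) : ℂ)
      = Complex.exp (-(x - x') ^ 2 / (2 * t)) / Real.sqrt (2 * π * t)
        * Complex.exp (-π * (2 * π * r ^ 2 / t : ℝ) * w ^ 2
          + 2 * π * (-(r * (x - x') / t) + Complex.I * N / 2) * w) := by
  have hparity : ((parity N ^ w : ℝ) : ℂ) = Complex.exp (w * (N * (π * Complex.I))) := by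
    rw [Complex.exp_int_mul, Complex.exp_nat_mul, Complex.exp_pi_mul_I, parity]
    push_cast
    rfl
  have htc : (t : ℂ) ≠ 0 := Complex.ofReal_ne_zero.mpr ht
  rw [Complex.ofReal_mul, hparity, pBM]
  push_cast
  rw [mul_div_assoc', div_mul_eq_mul_div, ← Complex.exp_add, ← Complex.exp_add]
  congr 2
  field_simp
  ring

theorem exp_neg_pi_div_mul_sq (N : ℕ) {r t : ℝ} (hr : r ≠ 0) (ht : t ≠ 0) (X : ℂ) (n : ℤ) :
    Complex.exp (-π / (2 * π * r ^ 2 / t : ℝ)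
        * (n + Complex.I * (-(r * X / t) + Complex.I * N / 2)) ^ 2)
      = Complex.exp (X ^ 2 / (2 * t)) * gaussTerm (-(N / 2)) 0 n (X / r, t / (2 * r ^ 2)) := by
  have hrc : (r : ℂ) ≠ 0 := Complex.ofReal_ne_zero.mpr hr
  have htc : (t : ℂ) ≠ 0 := Complex.ofReal_ne_zero.mpr ht
  have hpic : (π : ℂ) ≠ 0 := Complex.ofReal_ne_zero.mpr Real.pi_ne_zero
  have hcenter : (n : ℂ) + Complex.I * (-(r * X / t) + Complex.I * N / 2)
      = (n - N / 2) - Complex.I * (r * X / t) := by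
    linear_combination ((N : ℂ) / 2) * Complex.I_sq
  rw [gaussTerm, pow_zero, one_mul, ← Complex.exp_add, hcenter, sub_sq, mul_pow, Complex.I_sq]
  congr 1
  push_cast
  field_simp
  ring

/-- Poisson summation for the wrapped heat kernel. -/
theorem ofReal_pWrapped (N : ℕ) {r t : ℝ} (hr : 0 < r) (ht : 0 < t) (x x' : ℝ) :
    ((pWrapped (parity N) r t x x' : ℝ) : ℂ) = 1 / (2 * π * r)
      * gaussSeries (-(N / 2)) 0 (((x : ℂ) - x') / r, t / (2 * r ^ 2)) := by
  set a : ℝ := 2 * π * r ^ 2 / t with ha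
  have ha0 : 0 < a := by positivity
  have hsqrt : (a : ℂ) ^ (1 / 2 : ℂ) = (Real.sqrt a : ℂ) := by
    rw [Real.sqrt_eq_rpow, Complex.ofReal_cpow ha0.le]
    push_cast
    rfl
  have hnorm : (Real.sqrt a : ℂ) * Real.sqrt (2 * π * t) = 2 * π * r := by
    have hsq : a * (2 * π * t) = (2 * π * r) ^ 2 := by
      rw [ha]
      field_simp
    have : Real.sqrt a * Real.sqrt (2 * π * t) = 2 * π * r := by
      rw [← Real.sqrt_mul ha0.le, hsq, Real.sqrt_sq (by positivity)]
    exact_mod_cast this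
  have hcancel : Complex.exp (-(x - x') ^ 2 / (2 * t)) * Complex.exp ((x - x') ^ 2 / (2 * t)) = 1 :=
    by rw [← Complex.exp_add, neg_div, neg_add_cancel, Complex.exp_zero]
  rw [pWrapped, Complex.ofReal_tsum]
  simp_rw [ofReal_parity_zpow_mul_pBM N r ht.ne']
  rw [tsum_mul_left, Complex.tsum_exp_neg_quadratic (by rw [Complex.ofReal_re]; exact ha0)]
  simp_rw [exp_neg_pi_div_mul_sq N hr.ne' ht.ne']
  rw [tsum_mul_left, hsqrt, ← gaussSeries, ← hnorm]
  simp only [div_eq_mul_inv, mul_inv] at hcancel ⊢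
  linear_combination ((Real.sqrt (2 * π * t) : ℂ)⁻¹ * (Real.sqrt a : ℂ)⁻¹
    * gaussSeries (-(N * 2⁻¹)) 0 ((x - x') * (r : ℂ)⁻¹, t * (2⁻¹ * ((r : ℂ) ^ 2)⁻¹))) * hcancel

/-! ### Interpolation of alternating functions -/

section Interpolation

variable {X R : Type*}

theorem eq_sum_prod_of_slices {ι : Type*} [Fintype ι] [CommSemiring R] {n : ℕ} (v : ι → X)
    (e : ι → X → R) (F : (Fin n → X) → R)
    (h : ∀ j x, F x = ∑ i, e i (x j) * F (Function.update x j (v i))) (x : Fin n → X) :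
    F x = ∑ i : Fin n → ι, (∏ j, e (i j) (x j)) * F (v ∘ i) := by
  induction n with
  | zero => simp [Subsingleton.elim x (v ∘ default)]
  | succ n ih =>
    rw [h 0 x, ← (Fin.consEquiv fun _ => ι).sum_comp, Fintype.sum_prod_type]
    refine Finset.sum_congr rfl fun i _ => ?_
    have hupdate : Function.update x 0 (v i) = Fin.cons (v i) (Fin.tail x) := by
      rw [← Fin.update_cons_zero (x 0), Fin.cons_self_tail]
    rw [hupdate, ih (fun y => F (Fin.cons (v i) y)) (fun j y => ?_) (Fin.tail x), Finset.mul_sum]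
    · refine Finset.sum_congr rfl fun i' _ => ?_
      have hcons : v ∘ Fin.consEquiv (fun _ => ι) (i, i') = Fin.cons (v i) (v ∘ i') :=
        Fin.comp_cons ..
      rw [Fin.prod_univ_succ, hcons, ← mul_assoc]
      rfl
    · simpa only [Fin.cons_succ, Fin.cons_update] using h j.succ (Fin.cons (v i) y)

theorem alternating_eq_zero_of_eq {ι : Type*} [Fintype ι] [DecidableEq ι] [Ring R]
    [NoZeroDivisors R] [CharZero R] {F : (ι → X) → R}
    (halt : ∀ (σ : Equiv.Perm ι) x, F (x ∘ σ) = (σ.sign : ℤ) * F x) {x : ι → X} {a b : ι}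
    (hab : x a = x b) (hne : a ≠ b) : F x = 0 := by
  have hswap : x ∘ Equiv.swap a b = x := by
    rw [Equiv.comp_swap_eq_update, hab, Function.update_eq_self, ← hab, Function.update_eq_self]
  have h := halt (Equiv.swap a b) x
  rw [hswap, Equiv.Perm.sign_swap hne] at h
  exact self_eq_neg.mp (by simpa using h)

/-- Only the terms of `eq_sum_prod_of_slices` indexed by permutations survive. -/
theorem eq_mul_det_of_slices [CommRing R] [NoZeroDivisors R] [CharZero R] {n : ℕ}
    (v : Fin n → X) (e : Fin n → X → R) (F : (Fin n → X) → R)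
    (h : ∀ j x, F x = ∑ i, e i (x j) * F (Function.update x j (v i)))
    (halt : ∀ (σ : Equiv.Perm (Fin n)) x, F (x ∘ σ) = (σ.sign : ℤ) * F x) (x : Fin n → X) :
    F x = F v * (Matrix.of fun i j => e i (x j)).det := by
  rw [eq_sum_prod_of_slices v e F h x, Matrix.det_apply', Finset.mul_sum]
  refine (Fintype.sum_of_injective (fun σ : Equiv.Perm (Fin n) => (σ : Fin n → Fin n))
    DFunLike.coe_injective _ _ (fun i hi => ?_) (fun σ => ?_)).symm
  · have hnot : ¬ Function.Injective i := fun hinj =>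
      hi ⟨Equiv.ofBijective i (Finite.injective_iff_bijective.mp hinj), rfl⟩
    obtain ⟨a, b, hab, hne⟩ := Function.not_injective_iff.mp hnot
    rw [alternating_eq_zero_of_eq (x := v ∘ i) halt (congrArg v hab) hne, mul_zero]
  · rw [halt σ v]
    simp only [Matrix.of_apply]
    ring

theorem slices_of_slice [CommRing R] {n : ℕ} {S : Submodule R (X → R)} {F : (Fin n → X) → R}
    (halt : ∀ (σ : Equiv.Perm (Fin n)) x, F (x ∘ σ) = (σ.sign : ℤ) * F x) {i : Fin n}
    (hslice : ∀ x, (fun t => F (Function.update x i t)) ∈ S) (j : Fin n) (x : Fin n → X) :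
    (fun t => F (Function.update x j t)) ∈ S := by
  set σ := Equiv.swap i j
  have hupdate (t : X) : Function.update x j t = Function.update (x ∘ σ) i t ∘ σ := by
    rw [Function.update_comp_equiv, Function.comp_assoc, ← Equiv.Perm.coe_mul]
    simp [σ]
  have hmem := S.smul_mem ((σ.sign : ℤ) : R) (hslice (x ∘ σ))
  convert hmem using 2 with t
  rw [hupdate, halt]
  rfl

theorem eq_sum_inv_mulVec_of_mem_span {ι : Type*} [Fintype ι] [DecidableEq ι] [CommRing R]
    {P : ι → X → R} {v : ι → X} (hdet : IsUnit (Matrix.of fun j k => P j (v k)).det) {f : X → R}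
    (hf : f ∈ Submodule.span R (range P)) (t : X) :
    f t = ∑ i, ((Matrix.of fun j k => P j (v k))⁻¹.mulVec fun j => P j t) i * f (v i) := by
  obtain ⟨a, rfl⟩ := (Submodule.mem_span_range_iff_exists_fun R).mp hf
  set M := Matrix.of fun j k => P j (v k)
  have heval (t : X) : (∑ j, a j • P j) t = a ⬝ᵥ fun j => P j t := by
    simp only [Finset.sum_apply, Pi.smul_apply, smul_eq_mul, dotProduct]
  calc (∑ j, a j • P j) t = a ⬝ᵥ M.mulVec (M⁻¹.mulVec fun j => P j t) := by
        rw [heval, Matrix.mulVec_mulVec, Matrix.mul_nonsing_inv _ hdet, Matrix.one_mulVec]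
    _ = (M⁻¹.mulVec fun j => P j t) ⬝ᵥ Matrix.vecMul a M := by
        rw [Matrix.dotProduct_mulVec, dotProduct_comm]
    _ = _ := Finset.sum_congr rfl fun i _ => by rw [heval]; rfl

theorem alternating_mul_det_eq [Field R] [CharZero R] {n : ℕ} {P : Fin n → X → R} {v : Fin n → X}
    (hdet : (Matrix.of fun j k => P j (v k)).det ≠ 0) {F : (Fin n → X) → R}
    (halt : ∀ (σ : Equiv.Perm (Fin n)) x, F (x ∘ σ) = (σ.sign : ℤ) * F x) {i : Fin n}
    (hslice : ∀ x, (fun t => F (Function.update x i t)) ∈ Submodule.span R (range P))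
    (x : Fin n → X) :
    F x * (Matrix.of fun j k => P j (v k)).det = F v * (Matrix.of fun j k => P j (x k)).det := by
  set M := Matrix.of fun j k => P j (v k)
  have hunit : IsUnit M.det := isUnit_iff_ne_zero.mpr hdet
  have hslices (j : Fin n) (y : Fin n → X) :
      F y = ∑ i, (M⁻¹.mulVec fun k => P k (y j)) i * F (Function.update y j (v i)) := by
    simpa only [Function.update_eq_self] using
      eq_sum_inv_mulVec_of_mem_span hunit (slices_of_slice halt hslice j y) (y j)
  have hdetInv : (Matrix.of fun i j => (M⁻¹.mulVec fun k => P k (x j)) i).det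
      = M.det⁻¹ * (Matrix.of fun j k => P j (x k)).det := by
    rw [← Ring.inverse_eq_inv', ← Matrix.det_nonsing_inv, ← Matrix.det_mul]
    rfl
  rw [eq_mul_det_of_slices v (fun i t => (M⁻¹.mulVec fun k => P k t) i) F hslices halt x, hdetInv,
    mul_assoc, mul_right_comm, inv_mul_cancel₀ hdet, one_mul]

end Interpolation

/-! ### Theta functions of degree `N` -/

/-- Entire functions with the quasi-periods `2 π` and `2 i N κ` of the theta functions of degree
`N`. -/
def thetaSpace (N : ℕ) (κ : ℝ) : Submodule ℂ (ℂ → ℂ) where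
  carrier := {f | Differentiable ℂ f ∧ (∀ y, f (y + 2 * π) = (-1) ^ N * f y) ∧
    ∀ y, f (y + 2 * N * κ * Complex.I)
      = (-1) ^ (N + 1) * Complex.exp (N ^ 2 * κ - Complex.I * N * y) * f y}
  add_mem' := fun ⟨hf, hfReal, hfImag⟩ ⟨hg, hgReal, hgImag⟩ =>
    ⟨hf.add hg, fun y => by simp only [Pi.add_apply, hfReal, hgReal, mul_add],
      fun y => by simp only [Pi.add_apply, hfImag, hgImag, mul_add]⟩
  zero_mem' := ⟨differentiable_const 0, fun y => by simp, fun y => by simp⟩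
  smul_mem' := fun c _ ⟨hf, hfReal, hfImag⟩ =>
    ⟨hf.const_smul c, fun y => by simp only [Pi.smul_apply, hfReal, mul_smul_comm],
      fun y => by simp only [Pi.smul_apply, hfImag, mul_smul_comm]⟩

/-- The Fourier coefficient of `f` on `[0, 2 π]` at the frequency `n - N/2`, without the factor
`1 / 2π`. -/
def thetaCoeff (N : ℕ) (n : ℤ) (f : ℂ → ℂ) : ℂ :=
  ∫ y in (0 : ℝ)..2 * π, f y * Complex.exp (Complex.I * (N / 2 - n) * y)

theorem integral_add_mul_I_of_periodic {g : ℂ → ℂ} (hg : Differentiable ℂ g)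
    (hper : ∀ y, g (y + 2 * π) = g y) (Y : ℝ) :
    ∫ x in (0 : ℝ)..2 * π, g (x + Y * Complex.I) = ∫ x in (0 : ℝ)..2 * π, g x := by
  have hrect := Complex.integral_boundary_rect_eq_zero_of_differentiableOn g 0
    ((2 * π : ℝ) + Y * Complex.I) hg.differentiableOn
  simp only [Complex.zero_re, Complex.zero_im, Complex.add_re, Complex.ofReal_re, Complex.mul_re,
    Complex.I_re, mul_zero, Complex.ofReal_im, Complex.I_im, mul_one, sub_self, add_zero,
    Complex.add_im, Complex.mul_im, zero_add, zero_mul, Complex.ofReal_zero] at hrect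
  have hsides (y : ℝ) : g ((2 * π : ℝ) + y * Complex.I) = g (y * Complex.I) := by
    rw [← hper (y * Complex.I), add_comm]
    push_cast
    rfl
  simp only [hsides] at hrect
  rw [add_sub_cancel_right, sub_eq_zero] at hrect
  exact hrect.symm

theorem mul_exp_add_two_pi {N : ℕ} {f : ℂ → ℂ} (hf : ∀ y, f (y + 2 * π) = (-1) ^ N * f y) (n : ℤ)
    (y : ℂ) : f (y + 2 * π) * Complex.exp (Complex.I * (N / 2 - n) * (y + 2 * π))
      = f y * Complex.exp (Complex.I * (N / 2 - n) * y) := by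
  have hexp : Complex.exp (Complex.I * (N / 2 - n) * (y + 2 * π))
      = (-1) ^ N * Complex.exp (Complex.I * (N / 2 - n) * y) := by
    rw [← Complex.exp_pi_mul_I, ← Complex.exp_nat_mul, ← Complex.exp_add,
      ← Complex.exp_periodic.int_mul n]
    ring_nf
  have hsq : ((-1 : ℂ) ^ N) * (-1) ^ N = 1 := by rw [← mul_pow, neg_one_mul, neg_neg, one_pow]
  rw [hf, hexp]
  linear_combination (f y * Complex.exp (Complex.I * (N / 2 - n) * y)) * hsq

/-- Shifting the contour by the imaginary quasi-period relates Fourier coefficients `N` apart. -/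
theorem thetaCoeff_eq_mul {N : ℕ} {κ : ℝ} {f : ℂ → ℂ} (hf : f ∈ thetaSpace N κ) (n : ℤ) :
    thetaCoeff N n f = (-1) ^ (N + 1) * Complex.exp (N ^ 2 * κ + 2 * N * κ * (n - N / 2))
      * thetaCoeff N (n + N) f := by
  obtain ⟨hdiff, hreal, himag⟩ := hf
  have hshift := integral_add_mul_I_of_periodic
    (g := fun y => f y * Complex.exp (Complex.I * (N / 2 - n) * y)) (hdiff.mul (by fun_prop))
    (mul_exp_add_two_pi hreal n) (2 * N * κ)
  rw [thetaCoeff, thetaCoeff, ← intervalIntegral.integral_const_mul]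
  refine hshift.symm.trans (intervalIntegral.integral_congr fun x _ => ?_)
  have hexp : Complex.exp (N ^ 2 * κ - Complex.I * N * x)
      * Complex.exp (Complex.I * (N / 2 - n) * (x + 2 * N * κ * Complex.I))
      = Complex.exp (N ^ 2 * κ + 2 * N * κ * (n - N / 2))
        * Complex.exp (Complex.I * (N / 2 - (n + N : ℤ)) * x) := by
    rw [← Complex.exp_add, ← Complex.exp_add]
    congr 1
    push_cast
    linear_combination (2 * N * κ * (N / 2 - n) : ℂ) * Complex.I_sq
  push_cast at hexp ⊢
  rw [himag]
  linear_combination ((-1) ^ (N + 1) * f x) * hexp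

theorem thetaCoeff_eq_zero {N : ℕ} (hN : 0 < N) {κ : ℝ} {f : ℂ → ℂ} (hf : f ∈ thetaSpace N κ)
    (h : ∀ i : Fin N, thetaCoeff N (i : ℕ) f = 0) (n : ℤ) : thetaCoeff N n f = 0 := by
  have hstep (m : ℤ) : thetaCoeff N m f = 0 ↔ thetaCoeff N (m + N) f = 0 := by
    rw [thetaCoeff_eq_mul hf m]
    simp [Complex.exp_ne_zero]
  have hmul (m q : ℤ) : thetaCoeff N (m + q * N) f = 0 ↔ thetaCoeff N m f = 0 := by
    induction q with
    | zero => rw [zero_mul, add_zero]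
    | succ i ih => rw [add_one_mul, ← add_assoc, ← hstep, ih]
    | pred i ih => rw [hstep, sub_one_mul, add_assoc, sub_add_cancel, ih]
  have hrem : 0 ≤ n % N ∧ n % N < N :=
    ⟨Int.emod_nonneg n (by omega), Int.emod_lt_of_pos n (by omega)⟩
  have hzero := h ⟨(n % N).toNat, by omega⟩
  rw [Int.toNat_of_nonneg hrem.1] at hzero
  rw [← Int.emod_add_ediv_mul n N, hmul, hzero]

theorem eq_zero_of_forall_integral_exp_mul_eq_zero {F : ℝ → ℂ} (hF : Continuous F)
    (hper : Function.Periodic F (2 * π))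
    (h : ∀ n : ℤ, ∫ x in (0 : ℝ)..2 * π, Complex.exp (-(Complex.I * n * x)) * F x = 0) : F = 0 := by
  have : Fact (0 < 2 * π) := ⟨Real.two_pi_pos⟩
  let G : C(AddCircle (2 * π), ℂ) := ⟨hper.lift, continuous_coinduced_dom.mpr hF⟩
  have hcoeff : fourierCoeff G = 0 := by
    funext n
    have hintegral : ∫ x in (0 : ℝ)..2 * π, fourier (-n) (x : AddCircle (2 * π)) • G x = 0 := by
      refine (intervalIntegral.integral_congr fun x _ => ?_).trans (h n)
      change fourier (-n) (x : AddCircle (2 * π)) • F x = _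
      rw [fourier_coe_apply, smul_eq_mul]
      have := Real.pi_ne_zero
      congr 2
      push_cast
      field_simp
    rw [fourierCoeff_eq_intervalIntegral _ n 0, zero_add, hintegral, smul_zero, Pi.zero_apply]
  have hsum : Summable (fourierCoeff G) := hcoeff ▸ summable_zero
  funext x
  have hseries := has_pointwise_sum_fourier_series_of_summable hsum (x : AddCircle (2 * π))
  simp only [hcoeff, Pi.zero_apply, zero_smul] at hseries
  exact hseries.unique hasSum_zero

theorem eq_zero_of_thetaCoeff_eq_zero {N : ℕ} {κ : ℝ} {f : ℂ → ℂ} (hf : f ∈ thetaSpace N κ)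
    (h : ∀ n, thetaCoeff N n f = 0) (x : ℝ) : f x = 0 := by
  obtain ⟨hdiff, hreal, -⟩ := hf
  have hzero := eq_zero_of_forall_integral_exp_mul_eq_zero
    (F := fun x => f x * Complex.exp (Complex.I * (N / 2 - (0 : ℤ)) * x))
    ((hdiff.continuous.comp Complex.continuous_ofReal).mul (by fun_prop))
    (fun y => by simpa using mul_exp_add_two_pi hreal 0 y) (fun n => ?_)
  · exact (mul_eq_zero.mp (congrFun hzero x)).resolve_right (Complex.exp_ne_zero _)
  · refine (intervalIntegral.integral_congr fun x _ => ?_).trans (h n)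
    rw [mul_left_comm, ← Complex.exp_add]
    push_cast
    ring_nf

/-- The first `N` Fourier coefficients. -/
def thetaCoeffs (N : ℕ) (κ : ℝ) : thetaSpace N κ →ₗ[ℂ] (Fin N → ℂ) where
  toFun f i := thetaCoeff N (i : ℕ) f
  map_add' f g := by
    have hint (f : thetaSpace N κ) (n : ℕ) : IntervalIntegrable
        (fun y : ℝ => f.1 y * Complex.exp (Complex.I * (N / 2 - n) * y)) MeasureTheory.volume
        0 (2 * π) :=
      ((f.2.1.continuous.comp Complex.continuous_ofReal).mul (by fun_prop)).intervalIntegrable ..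
    funext i
    simp only [Submodule.coe_add, Pi.add_apply, thetaCoeff, add_mul]
    exact intervalIntegral.integral_add (hint f i) (hint g i)
  map_smul' c f := by
    funext i
    simp only [Submodule.coe_smul, Pi.smul_apply, thetaCoeff, smul_eq_mul, mul_assoc,
      intervalIntegral.integral_const_mul, RingHom.id_apply]

theorem eq_zero_of_thetaCoeffs_eq_zero {N : ℕ} (hN : 0 < N) {κ : ℝ} {f : thetaSpace N κ}
    (h : thetaCoeffs N κ f = 0) (x : ℝ) : f.1 x = 0 :=
  eq_zero_of_thetaCoeff_eq_zero f.2 (thetaCoeff_eq_zero hN f.2 (congrFun h)) x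

/-- By the recursion `thetaCoeff_eq_mul` there are only `N` independent Fourier coefficients. -/
theorem restrict_mem_span_of_mem_thetaSpace {N : ℕ} (hN : 0 < N) {κ : ℝ} {P : Fin N → ℂ → ℂ}
    (hP : ∀ j, P j ∈ thetaSpace N κ) {v : Fin N → ℝ}
    (hdet : (Matrix.of fun j k => P j (v k)).det ≠ 0) {f : ℂ → ℂ} (hf : f ∈ thetaSpace N κ) :
    (fun x : ℝ => f x) ∈ Submodule.span ℂ (range fun j (x : ℝ) => P j x) := by
  let comb : (Fin N → ℂ) →ₗ[ℂ] thetaSpace N κ :=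
    Fintype.linearCombination ℂ fun j => (⟨P j, hP j⟩ : thetaSpace N κ)
  have hcomb (a : Fin N → ℂ) (z : ℂ) : (comb a).1 z = ∑ j, a j * P j z := by
    simp [comb, Fintype.linearCombination_apply, Finset.sum_apply]
  have hinj : Function.Injective ((thetaCoeffs N κ).comp comb) := by
    refine (injective_iff_map_eq_zero _).mpr fun b hb => ?_
    by_contra hne
    refine hdet (Matrix.exists_vecMul_eq_zero_iff.mp ⟨b, hne, funext fun k => ?_⟩)
    exact (hcomb b (v k)).symm.trans (eq_zero_of_thetaCoeffs_eq_zero hN hb (v k))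
  obtain ⟨a, ha⟩ := LinearMap.injective_iff_surjective.mp hinj (thetaCoeffs N κ ⟨f, hf⟩)
  refine (Submodule.mem_span_range_iff_exists_fun ℂ).mpr ⟨a, funext fun x => ?_⟩
  have hdiff : thetaCoeffs N κ (comb a - ⟨f, hf⟩) = 0 := by rw [map_sub, sub_eq_zero, ← ha]; rfl
  have hzero := eq_zero_of_thetaCoeffs_eq_zero hN hdiff x
  simpa [hcomb, sub_eq_zero] using hzero

/-! ### The product of theta functions as a function of one particle -/

/-- `ϑ₁(z / 2π; i s)`, so that `z` is an angle. -/
def thetaAngle (s : ℝ) (z : ℂ) : ℂ := theta1 (z / (2 * π)) (Complex.I * (s : ℂ))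

theorem thetaAngle_eq_gaussSeries (s : ℝ) (z : ℂ) :
    thetaAngle s z = -gaussSeries (-1 / 2) 0 (z + π, π * s) := by
  have : (π : ℂ) ≠ 0 := Complex.ofReal_ne_zero.mpr Real.pi_ne_zero
  rw [thetaAngle, theta1_eq_gaussSeries]
  congr 3
  field_simp

theorem thetaAngle_ofReal (s y : ℝ) : thetaAngle s (y : ℂ) = theta1R (y / (2 * π)) s := by
  rw [ofReal_theta1R, thetaAngle]
  push_cast
  rfl

theorem re_pi_mul_pos {s : ℝ} (hs : 0 < s) : 0 < ((π : ℂ) * s).re := by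
  rw [← Complex.ofReal_mul, Complex.ofReal_re]
  exact mul_pos Real.pi_pos hs

theorem differentiable_gaussSeries_fst (a : ℝ) (m : ℕ) {s : ℂ} (hs : 0 < s.re) :
    Differentiable ℂ fun z => gaussSeries a m (z, s) := fun y =>
  (hasDerivAt_gaussSeries_fst a m y hs).differentiableAt

theorem differentiable_thetaAngle {s : ℝ} (hs : 0 < s) : Differentiable ℂ (thetaAngle s) := by
  rw [funext (thetaAngle_eq_gaussSeries s)]
  exact ((differentiable_gaussSeries_fst _ _ (re_pi_mul_pos hs)).comp
    (differentiable_id.add_const (π : ℂ))).neg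

theorem thetaAngle_add_two_pi (s : ℝ) (z : ℂ) : thetaAngle s (z + 2 * π) = -thetaAngle s z := by
  have hexp : Complex.exp (2 * π * Complex.I * ((-1 / 2 : ℝ) : ℂ)) = -1 := by
    rw [← Complex.exp_neg_pi_mul_I]
    congr 1
    push_cast
    ring
  rw [thetaAngle_eq_gaussSeries, thetaAngle_eq_gaussSeries, add_right_comm,
    gaussSeries_add_two_pi, hexp, neg_one_mul]

theorem thetaAngle_sub_two_pi (s : ℝ) (z : ℂ) : thetaAngle s (z - 2 * π) = -thetaAngle s z := by
  rw [← neg_eq_iff_eq_neg, ← thetaAngle_add_two_pi, sub_add_cancel]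

theorem thetaAngle_neg (s : ℝ) (z : ℂ) : thetaAngle s (-z) = -thetaAngle s z := by
  have heven := gaussSeries_neg 1 (z - π) (π * s)
  rw [Nat.cast_one, ← neg_div] at heven
  rw [← thetaAngle_sub_two_pi, thetaAngle_eq_gaussSeries, thetaAngle_eq_gaussSeries,
    show z - 2 * π + π = z - π by ring, ← heven]
  congr 3
  ring

theorem thetaAngle_add_quasiPeriod (s : ℝ) (z : ℂ) :
    thetaAngle s (z + 2 * π * s * Complex.I)
      = -Complex.exp (π * s - Complex.I * z) * thetaAngle s z := by
  have hquasi := gaussSeries_add_quasiPeriod (-1 / 2) 1 (z + π) (π * s)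
  have hexp : Complex.exp (((1 : ℤ) : ℂ) ^ 2 * (π * s) - Complex.I * ((1 : ℤ) : ℂ) * (z + π))
      = -Complex.exp (π * s - Complex.I * z) := by
    rw [← mul_neg_one, ← Complex.exp_neg_pi_mul_I, ← Complex.exp_add]
    congr 1
    push_cast
    ring
  rw [hexp, Int.cast_one] at hquasi
  rw [thetaAngle_eq_gaussSeries, thetaAngle_eq_gaussSeries, mul_neg, ← hquasi]
  congr 3
  ring

theorem thetaAngle_sub_quasiPeriod (s : ℝ) (z : ℂ) :
    thetaAngle s (z - 2 * π * s * Complex.I)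
      = -Complex.exp (π * s + Complex.I * z) * thetaAngle s z := by
  rw [← neg_neg (z - _), thetaAngle_neg, neg_sub, sub_eq_neg_add, thetaAngle_add_quasiPeriod,
    thetaAngle_neg]
  ring_nf

theorem theta1R_neg (v s : ℝ) : theta1R (-v) s = -theta1R v s := by
  have hneg := thetaAngle_neg s ((2 * π * v : ℝ) : ℂ)
  rw [← Complex.ofReal_neg, thetaAngle_ofReal, thetaAngle_ofReal, ← mul_neg,
    mul_div_cancel_left₀ _ Real.two_pi_pos.ne', mul_div_cancel_left₀ _ Real.two_pi_pos.ne'] at hneg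
  exact_mod_cast hneg

theorem theta1R_one_sub (v s : ℝ) : theta1R (1 - v) s = theta1R v s := by
  have hper := thetaAngle_add_two_pi s ((2 * π * (-v) : ℝ) : ℂ)
  have hcast : ((2 * π * (-v) : ℝ) : ℂ) + 2 * π = ((2 * π * (1 - v) : ℝ) : ℂ) := by
    push_cast
    ring
  rw [hcast, thetaAngle_ofReal, thetaAngle_ofReal, mul_div_cancel_left₀ _ Real.two_pi_pos.ne',
    mul_div_cancel_left₀ _ Real.two_pi_pos.ne', theta1R_neg, Complex.ofReal_neg, neg_neg] at hper
  exact_mod_cast hper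

/-- `ϑ₁(x̄) ∏_{j<k} ϑ₁(x_k - x_j)` at `τ = i N T`, on the circle of radius `r = 1`. -/
def thetaProd (N : ℕ) (T : ℝ) (y : Fin N → ℝ) : ℝ :=
  theta1R (bar 1 y / (2 * π)) (N * T)
    * ∏ j : Fin N, ∏ k ∈ Finset.Ioi j, theta1R ((y k - y j) / (2 * π)) (N * T)

theorem thetaProd_comp_perm {N : ℕ} (T : ℝ) (σ : Equiv.Perm (Fin N)) (y : Fin N → ℝ) :
    thetaProd N T (y ∘ σ) = (σ.sign : ℤ) * thetaProd N T y := by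
  have hbar : bar 1 (y ∘ σ) = bar 1 y := congrArg (· - kappa N 1) (Equiv.sum_comp σ y)
  have hprod := σ.prod_Ioi_comp_eq_sign_mul_prod
    (f := fun j k => theta1R ((y k - y j) / (2 * π)) (N * T))
    fun i j => by rw [← theta1R_neg, ← neg_div, neg_sub]
  rw [thetaProd, thetaProd, hbar, mul_left_comm]
  exact congrArg _ hprod

/-- The dependence of `thetaProd` on one of `n + 1` particles, up to a constant factor; `u` are the
positions of the other particles. -/
def thetaSlice {n : ℕ} (s : ℝ) (c : ℂ) (u : Fin n → ℂ) (z : ℂ) : ℂ :=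
  thetaAngle s (z + c) * ∏ k, thetaAngle s (u k - z)

theorem thetaSlice_mem_thetaSpace {n : ℕ} {T : ℝ} (hT : 0 < T) {c : ℂ} {u : Fin n → ℂ}
    (hc : Complex.exp (Complex.I * (∑ k, u k - c)) = -1) :
    thetaSlice ((n + 1 : ℕ) * T) c u ∈ thetaSpace (n + 1) (π * T) := by
  set s : ℝ := (n + 1 : ℕ) * T with hs
  refine ⟨?_, fun z => ?_, fun z => ?_⟩
  · have hdiff := differentiable_thetaAngle (s := s) (by positivity)
    exact (hdiff.comp (differentiable_id.add_const c)).mul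
      (Differentiable.fun_finsetProd fun k _ => hdiff.comp (differentiable_id.const_sub (u k)))
  · simp only [thetaSlice, add_right_comm z _ c, ← sub_sub, thetaAngle_add_two_pi,
      thetaAngle_sub_two_pi, Finset.prod_neg, Finset.card_univ, Fintype.card_fin]
    ring
  · have hperiod : z + 2 * ((n + 1 : ℕ) : ℂ) * ((π * T : ℝ) : ℂ) * Complex.I
        = z + 2 * π * s * Complex.I := by
      push_cast [hs]
      ring
    have hexp : Complex.exp (π * s - Complex.I * (z + c))
        * Complex.exp (∑ k : Fin n, ((π : ℂ) * s + Complex.I * (u k - z)))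
        = -Complex.exp (((n + 1 : ℕ) : ℂ) ^ 2 * ((π * T : ℝ) : ℂ)
          - Complex.I * ((n + 1 : ℕ) : ℂ) * z) := by
      rw [← Complex.exp_add, ← neg_one_mul, ← hc, ← Complex.exp_add, Finset.sum_add_distrib,
        ← Finset.mul_sum Finset.univ _ Complex.I, Finset.sum_sub_distrib, Finset.sum_const,
        Finset.sum_const, Finset.card_univ, Fintype.card_fin]
      congr 1
      push_cast [hs, nsmul_eq_mul]
      ring
    simp only [thetaSlice, hperiod, add_right_comm z _ c, ← sub_sub, thetaAngle_add_quasiPeriod,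
      thetaAngle_sub_quasiPeriod, neg_mul, Finset.prod_neg, Finset.card_univ, Fintype.card_fin,
      Finset.prod_mul_distrib, ← Complex.exp_sum]
    linear_combination (-(-1) ^ n * thetaAngle s (z + c) * (∏ k, thetaAngle s (u k - z))) * hexp

theorem ofReal_thetaProd_update {n : ℕ} (T : ℝ) (y : Fin (n + 1) → ℝ) (t : ℝ) :
    ((thetaProd (n + 1) T (Function.update y 0 t) : ℝ) : ℂ)
      = (∏ j : Fin n, ∏ k ∈ Finset.Ioi j,
          theta1R ((y k.succ - y j.succ) / (2 * π)) ((n + 1 : ℕ) * T) : ℝ)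
        * thetaSlice ((n + 1 : ℕ) * T) (∑ k : Fin n, y k.succ - kappa (n + 1) 1 : ℝ)
          (fun k => y k.succ) t := by
  have hbar : bar 1 (Function.update y 0 t)
      = t + (∑ k : Fin n, y k.succ - kappa (n + 1) 1) := by
    simp [bar, Fin.sum_univ_succ, add_sub_assoc]
  simp only [thetaSlice, ← Complex.ofReal_add, ← Complex.ofReal_sub, thetaAngle_ofReal]
  rw [thetaProd, hbar, Fin.prod_univ_succ, Fin.prod_Ioi_zero]
  simp only [Fin.prod_Ioi_succ, Function.update_self, ne_eq, Fin.succ_ne_zero, not_false_eq_true,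
    Function.update_of_ne]
  push_cast
  ring

theorem parity_of_even {N : ℕ} (h : Even N) : parity N = 1 := h.neg_one_pow

theorem parity_of_odd {N : ℕ} (h : Odd N) : parity N = -1 := h.neg_one_pow

theorem exp_I_mul_kappa (N : ℕ) : Complex.exp (Complex.I * kappa N 1) = -1 := by
  rw [kappa, ← Complex.exp_pi_mul_I, Complex.exp_eq_exp_iff_exists_int]
  rcases N.even_or_odd with h | h
  · obtain ⟨m, rfl⟩ := id h
    refine ⟨m - 1, ?_⟩
    rw [parity_of_even h]
    push_cast
    ring
  · obtain ⟨m, rfl⟩ := id h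
    refine ⟨m - 1, ?_⟩
    rw [parity_of_odd h]
    push_cast
    ring

theorem thetaProd_update_eq {n : ℕ} {T : ℝ} (hT : 0 < T) (y : Fin (n + 1) → ℝ) :
    ∃ f ∈ thetaSpace (n + 1) (π * T),
      ∀ t : ℝ, ((thetaProd (n + 1) T (Function.update y 0 t) : ℝ) : ℂ) = f t := by
  refine ⟨_, Submodule.smul_mem _ _ (thetaSlice_mem_thetaSpace hT ?_), ofReal_thetaProd_update T y⟩
  push_cast
  rw [sub_sub_cancel, exp_I_mul_kappa]

/-- The wrapped heat kernel centred at the `j`-th equidistant point, as an entire function. -/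
def equidistantKernel (N : ℕ) (T : ℝ) (j : Fin N) (z : ℂ) : ℂ :=
  gaussSeries (-(N / 2)) 0 (z - equidistant N 1 j, π * T)

theorem exp_I_mul_equidistant {N : ℕ} (j : Fin N) :
    Complex.exp (Complex.I * N * (equidistant N 1 j : ℂ)) = (-1) ^ (N + 1) := by
  have hN : (N : ℂ) ≠ 0 := Nat.cast_ne_zero.mpr j.pos.ne'
  have harg : Complex.I * N * (equidistant N 1 j : ℂ)
      = Complex.I * (π / 2 * (4 * ((j : ℂ) + 1) - 3 + (parity N : ℂ))) := by
    rw [equidistant]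
    push_cast
    field_simp
  rw [harg]
  rcases N.even_or_odd with h | h
  · rw [parity_of_even h, h.add_one.neg_one_pow, ← Complex.exp_pi_mul_I,
      Complex.exp_eq_exp_iff_exists_int]
    exact ⟨j, by push_cast; ring⟩
  · rw [parity_of_odd h, h.add_one.neg_one_pow, Complex.exp_eq_one_iff]
    exact ⟨j, by push_cast; ring⟩

theorem equidistantKernel_mem_thetaSpace {N : ℕ} {T : ℝ} (hT : 0 < T) (j : Fin N) :
    equidistantKernel N T j ∈ thetaSpace N (π * T) := by
  refine ⟨(differentiable_gaussSeries_fst _ _ (re_pi_mul_pos hT)).comp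
    (differentiable_id.sub_const _), fun y => ?_, fun y => ?_⟩
  · have hexp : Complex.exp (2 * π * Complex.I * ((-(N / 2) : ℝ) : ℂ)) = (-1) ^ N := by
      rw [← Complex.exp_neg_pi_mul_I, ← Complex.exp_nat_mul]
      congr 1
      push_cast
      ring
    rw [equidistantKernel, equidistantKernel, add_sub_right_comm, gaussSeries_add_two_pi, hexp]
  · have hquasi := gaussSeries_add_quasiPeriod (-(N / 2)) N (y - equidistant N 1 j) (π * T)
    have hexp : Complex.exp (((N : ℤ) : ℂ) ^ 2 * (π * T)
        - Complex.I * ((N : ℤ) : ℂ) * (y - equidistant N 1 j))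
        = (-1) ^ (N + 1) * Complex.exp (N ^ 2 * (π * T : ℝ) - Complex.I * N * y) := by
      rw [← exp_I_mul_equidistant j, ← Complex.exp_add]
      congr 1
      push_cast
      ring
    rw [equidistantKernel, equidistantKernel, ← hexp, ← hquasi]
    congr 2
    push_cast
    ring

theorem thetaProd_mul_det {N : ℕ} (hN : 0 < N) {T : ℝ} (hT : 0 < T)
    (hdet : (Matrix.of fun j k => equidistantKernel N T j (equidistant N 1 k)).det ≠ 0)
    (y : Fin N → ℝ) :
    (thetaProd N T y : ℂ) * (Matrix.of fun j k => equidistantKernel N T j (equidistant N 1 k)).det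
      = thetaProd N T (equidistant N 1)
        * (Matrix.of fun j k => equidistantKernel N T j (y k)).det := by
  obtain ⟨n, rfl⟩ := Nat.exists_eq_add_one.mpr hN
  refine alternating_mul_det_eq (P := fun j (x : ℝ) => equidistantKernel (n + 1) T j x) hdet
    (F := fun y => (thetaProd (n + 1) T y : ℂ)) (i := 0) (fun σ y => ?_) (fun y => ?_) y
  · rw [thetaProd_comp_perm]
    push_cast
    rfl
  · obtain ⟨f, hf, hfy⟩ := thetaProd_update_eq hT y
    rw [funext hfy]
    exact restrict_mem_span_of_mem_thetaSpace hN (equidistantKernel_mem_thetaSpace hT) hdet hf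

/-! ### Values at equidistant points -/

/-- The Gaussian sum over the lattice `ℤ + (i + 1) / N - 1 / 2`; the matrix of the kernels
`equidistantKernel N T j` at the equidistant points is diagonalized by the discrete Fourier
transform, with these eigenvalues up to the factor `N`. -/
def latticeEigenvalue (N : ℕ) (T : ℝ) (i : ℕ) : ℝ :=
  ∑' m : ℤ, Real.exp (-(π * (N * (N * T))) * ((((i : ℝ) + 1) / N - 1 / 2) + m) ^ 2)

theorem latticeEigenvalue_pos {N : ℕ} (hN : 0 < N) {T : ℝ} (hT : 0 < T) (i : ℕ) :
    0 < latticeEigenvalue N T i := by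
  have hs : 0 < π * (N * (N * T)) := by positivity
  have hsum : Summable fun m : ℤ =>
      Real.exp (-(π * (N * (N * T))) * ((((i : ℝ) + 1) / N - 1 / 2) + m) ^ 2) := by
    refine (summable_gaussTerm (((i : ℝ) + 1) / N - 1 / 2) 0
      (p := (0, ((π * (N * (N * T)) : ℝ) : ℂ))) (by simpa using hs)).norm.congr fun m => ?_
    have hexp : -((π * (N * (N * T)) : ℝ) : ℂ) * (m + (((i + 1) / N - 1 / 2 : ℝ) : ℂ)) ^ 2
        = ((-(π * (N * (N * T))) * (((i + 1) / N - 1 / 2) + m) ^ 2 : ℝ) : ℂ) := by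
      push_cast
      ring
    rw [gaussTerm, pow_zero, one_mul, mul_zero, add_zero, hexp, Complex.norm_exp,
      Complex.ofReal_re]
  exact hsum.tsum_pos (fun m => (Real.exp_pos _).le) 0 (Real.exp_pos _)

/-- The discrete Fourier transform. The shift of the frequencies by `1 / N - 1 / 2` matches the
parametrization of `latticeEigenvalue`. -/
def dft (N : ℕ) : Matrix (Fin N) (Fin N) ℂ :=
  Matrix.of fun i k => Complex.exp (2 * π * Complex.I * ((((i : ℂ) + 1) / N - 1 / 2) * k))

theorem dft_apply_mul_star {N : ℕ} (hN : 0 < N) (i l k : Fin N) :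
    dft N i k * star (dft N l k)
      = (Complex.exp (2 * π * Complex.I / N) ^ (i : ℕ)
        / Complex.exp (2 * π * Complex.I / N) ^ (l : ℕ)) ^ (k : ℕ) := by
  have hNc : (N : ℂ) ≠ 0 := Nat.cast_ne_zero.mpr hN.ne'
  rw [dft, Matrix.of_apply, Matrix.of_apply, ← Complex.exp_nat_mul, ← Complex.exp_nat_mul,
    ← Complex.exp_sub, ← Complex.exp_nat_mul, ← starRingEnd_apply, ← Complex.exp_conj,
    ← Complex.exp_add]
  congr 1
  simp only [map_mul, map_sub, map_div₀, map_add, map_one, map_natCast, map_ofNat,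
    Complex.conj_I, Complex.conj_ofReal]
  field_simp
  ring

theorem dft_mul_conjTranspose {N : ℕ} (hN : 0 < N) :
    dft N * (dft N).conjTranspose = (N : ℂ) • (1 : Matrix (Fin N) (Fin N) ℂ) := by
  have hζ := Complex.isPrimitiveRoot_exp N hN.ne'
  have hζ0 : Complex.exp (2 * π * Complex.I / N) ≠ 0 := Complex.exp_ne_zero _
  ext i l
  simp only [Matrix.mul_apply, Matrix.conjTranspose_apply, dft_apply_mul_star hN]
  generalize Complex.exp (2 * π * Complex.I / N) = ζ at hζ hζ0
  rw [Fin.sum_univ_eq_sum_range (fun k => (ζ ^ (i : ℕ) / ζ ^ (l : ℕ)) ^ k) N]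
  by_cases h : i = l
  · simp [h, hζ0]
  · have hne : ζ ^ (i : ℕ) / ζ ^ (l : ℕ) ≠ 1 := fun h1 =>
      h (Fin.ext (hζ.pow_inj i.2 l.2 ((div_eq_one_iff_eq (pow_ne_zero _ hζ0)).mp h1)))
    rw [geom_sum_eq hne, div_pow, ← pow_mul, ← pow_mul, mul_comm (i : ℕ),
      mul_comm (l : ℕ), pow_mul, pow_mul, hζ.pow_eq_one]
    simp [h]

theorem tsum_int_eq_sum_tsum {N : ℕ} (hN : 0 < N) {G : ℤ → ℂ} (hG : Summable G) :
    ∑' n, G n = ∑ i : Fin N, ∑' m : ℤ, G (m * N + i + 1) := by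
  have : NeZero N := ⟨hN.ne'⟩
  let e : Fin N × ℤ ≃ ℤ :=
    (Equiv.prodComm _ _).trans ((Int.divModEquiv N).symm.trans (Equiv.addRight 1))
  have he (p : Fin N × ℤ) : e p = p.2 * N + p.1 + 1 := by simp [e]
  rw [← e.tsum_eq, Summable.tsum_prod (f := fun p => G (e p)) (e.summable_iff.mpr hG),
    tsum_fintype]
  simp only [he]

theorem gaussTerm_equidistant {N : ℕ} (T : ℝ) (i j k : Fin N) (m : ℤ) :
    gaussTerm (-(N / 2)) 0 (m * N + i + 1)
        ((equidistant N 1 k : ℂ) - equidistant N 1 j, (π : ℂ) * T)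
      = star (dft N i j) * dft N i k
        * (Real.exp (-(π * (N * (N * T))) * ((((i : ℝ) + 1) / N - 1 / 2) + m) ^ 2) : ℝ) := by
  have hNc : (N : ℂ) ≠ 0 := Nat.cast_ne_zero.mpr i.pos.ne'
  rw [gaussTerm, pow_zero, one_mul, equidistant, equidistant, dft, Matrix.of_apply,
    Matrix.of_apply, ← starRingEnd_apply, ← Complex.exp_conj, Complex.ofReal_exp,
    ← Complex.exp_add, ← Complex.exp_add]
  refine Complex.exp_eq_exp_iff_exists_int.mpr ⟨m * ((k : ℤ) - j), ?_⟩
  simp only [map_mul, map_sub, map_div₀, map_add, map_one, map_natCast, map_ofNat,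
    Complex.conj_I, Complex.conj_ofReal]
  push_cast
  field_simp
  ring

theorem equidistantKernel_equidistant {N : ℕ} (hN : 0 < N) {T : ℝ} (hT : 0 < T) :
    (Matrix.of fun j k => equidistantKernel N T j (equidistant N 1 k))
      = (dft N).conjTranspose * Matrix.diagonal (fun i : Fin N => (latticeEigenvalue N T i : ℂ))
        * dft N := by
  ext j k
  rw [Matrix.mul_assoc, Matrix.mul_apply]
  simp only [Matrix.diagonal_mul, Matrix.of_apply, Matrix.conjTranspose_apply]
  rw [equidistantKernel, gaussSeries, tsum_int_eq_sum_tsum hN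
    (summable_gaussTerm _ _ (re_pi_mul_pos hT))]
  refine Finset.sum_congr rfl fun i _ => ?_
  rw [tsum_congr (gaussTerm_equidistant T i j k), tsum_mul_left, latticeEigenvalue,
    Complex.ofReal_tsum]
  ring

theorem det_equidistantKernel_equidistant {N : ℕ} (hN : 0 < N) {T : ℝ} (hT : 0 < T) :
    (Matrix.of fun j k => equidistantKernel N T j (equidistant N 1 k)).det
      = ((N : ℝ) ^ N * ∏ i ∈ Finset.range N, latticeEigenvalue N T i : ℝ) := by
  have h := congrArg Matrix.det (dft_mul_conjTranspose hN)
  rw [Matrix.det_mul, Matrix.det_smul, Matrix.det_one, mul_one, Fintype.card_fin] at h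
  rw [equidistantKernel_equidistant hN hT, Matrix.det_mul, Matrix.det_mul, Matrix.det_diagonal,
    Finset.prod_range]
  push_cast
  rw [← h]
  ring

theorem prod_prod_Ioi_sub {N : ℕ} (f : ℕ → ℝ) :
    ∏ j : Fin N, ∏ k ∈ Finset.Ioi j, f (k - j)
      = ∏ m ∈ Finset.range N, ∏ d ∈ Finset.range m, f (d + 1) := by
  rw [Finset.prod_range,
    Finset.prod_comm' (t' := Finset.univ) (s' := fun k => Finset.Iio k) (by simp)]
  refine Finset.prod_congr rfl fun k _ => ?_
  have hval : ∏ j ∈ Finset.Iio k, f ((k : ℕ) - j)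
      = ∏ j ∈ (Finset.Iio k).map Fin.valEmbedding, f ((k : ℕ) - j) := by
    rw [Finset.prod_map]
    rfl
  rw [hval, Fin.map_valEmbedding_Iio, Nat.Iio_eq_range, ← Finset.prod_range_reflect]
  refine Finset.prod_congr rfl fun d hd => ?_
  rw [Finset.mem_range] at hd
  congr 1
  omega

theorem sq_prod_range_prod_range {N : ℕ} (f : ℕ → ℝ) (hf : ∀ d ≤ N, f (N - d) = f d) :
    (∏ m ∈ Finset.range N, ∏ d ∈ Finset.range m, f (d + 1)) ^ 2
      = (∏ d ∈ Finset.range (N - 1), f (d + 1)) ^ N := by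
  rw [sq]
  nth_rewrite 2 [← Finset.prod_range_reflect]
  rw [← Finset.prod_mul_distrib, Finset.prod_congr rfl, Finset.prod_const, Finset.card_range]
  intro m hm
  rw [Finset.mem_range] at hm
  have hreflect : ∏ d ∈ Finset.range (N - 1 - m), f (d + 1)
      = ∏ d ∈ Finset.Ico m (N - 1), f (d + 1) := by
    rw [Finset.prod_Ico_eq_prod_range, ← Finset.prod_range_reflect]
    refine Finset.prod_congr rfl fun d hd => ?_
    rw [Finset.mem_range] at hd
    rw [← hf _ (by omega)]
    congr 1
    omega
  rw [hreflect, Finset.prod_range_mul_prod_Ico _ (by omega)]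

theorem bar_equidistant {N : ℕ} (hN : 0 < N) : bar 1 (equidistant N 1) = π := by
  have hNR : (N : ℝ) ≠ 0 := Nat.cast_ne_zero.mpr hN.ne'
  have hsum : (∑ j : Fin N, ((j : ℕ) : ℝ)) * 2 = N * (N - 1) := by
    have h := congrArg (Nat.cast : ℕ → ℝ) (Finset.sum_range_id_mul_two N)
    push_cast [Nat.cast_pred hN] at h
    rwa [Fin.sum_univ_eq_sum_range (fun j => (j : ℝ)) N]
  simp only [bar, kappa, equidistant, ← Finset.mul_sum, Finset.sum_add_distrib,
    Finset.sum_sub_distrib, Finset.sum_const, Finset.card_univ, Fintype.card_fin, nsmul_eq_mul]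
  field_simp
  linear_combination 2 * hsum

theorem thetaProd_equidistant {N : ℕ} (hN : 0 < N) (T : ℝ) :
    thetaProd N T (equidistant N 1) = theta1R (1 / 2) (N * T)
      * ∏ m ∈ Finset.range N, ∏ d ∈ Finset.range m, theta1R (((d : ℝ) + 1) / N) (N * T) := by
  have hNR : (N : ℝ) ≠ 0 := Nat.cast_ne_zero.mpr hN.ne'
  have h := prod_prod_Ioi_sub (N := N) fun d => theta1R ((d : ℝ) / N) (N * T)
  push_cast at h
  rw [thetaProd, bar_equidistant hN, ← h, show π / (2 * π) = 1 / 2 by field_simp]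
  congr 1
  refine Finset.prod_congr rfl fun j _ => Finset.prod_congr rfl fun k hk => ?_
  rw [Nat.cast_sub (show (j : ℕ) ≤ k from (Finset.mem_Ioi.mp hk).le), equidistant, equidistant]
  congr 1
  field_simp
  ring

theorem thetaProd_equidistant_pos {N : ℕ} (hN : 0 < N) {T : ℝ} (hT : 0 < T) :
    0 < thetaProd N T (equidistant N 1) := by
  have hs : 0 < N * T := by positivity
  rw [thetaProd_equidistant hN]
  refine mul_pos (theta1R_pos (by norm_num) hs) (Finset.prod_pos fun m hm =>
    Finset.prod_pos fun d hd => theta1R_pos ⟨by positivity, ?_⟩ hs)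
  rw [Finset.mem_range] at hm hd
  rw [div_lt_one (by positivity)]
  exact_mod_cast show d + 1 < N by omega

theorem sq_thetaProd_equidistant {N : ℕ} (hN : 0 < N) {T : ℝ} (hT : 0 < T) :
    thetaProd N T (equidistant N 1) ^ 2 = etaR (N * T) ^ ((N - 1) * (N - 2)) * (N : ℝ) ^ N
      * (∏ i ∈ Finset.range N, latticeEigenvalue N T i) ^ 2 := by
  have hNR : (N : ℝ) ≠ 0 := Nat.cast_ne_zero.mpr hN.ne'
  have h := sq_prod_range_prod_range (N := N) (fun d => theta1R ((d : ℝ) / N) (N * T))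
    (fun d hd => by rw [Nat.cast_sub hd, sub_div, div_self hNR, theta1R_one_sub])
  push_cast at h
  rw [thetaProd_equidistant hN, mul_pow, h, sq_theta1R_half_mul_prod hN (by positivity)]
  rfl

/-- The exponent of `η` in the product of theta functions, `(N - 1)(N - 2) / 2`. -/
def etaExp (N : ℕ) : ℝ := ((N : ℝ) - 1) * (N - 2) / 2

theorem thetaProd_equidistant_eq {N : ℕ} (hN : 0 < N) {T : ℝ} (hT : 0 < T) :
    thetaProd N T (equidistant N 1) = etaR (N * T) ^ etaExp N * √N ^ N
      * ∏ i ∈ Finset.range N, latticeEigenvalue N T i := by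
  have hη : 0 < etaR (N * T) := etaR_pos (by positivity)
  have hL : 0 < ∏ i ∈ Finset.range N, latticeEigenvalue N T i :=
    Finset.prod_pos fun i _ => latticeEigenvalue_pos hN hT i
  have hcast : (((N - 1) * (N - 2) : ℕ) : ℝ) = ((N : ℝ) - 1) * (N - 2) := by
    obtain rfl | hN2 := (Nat.succ_le_of_lt hN).eq_or_lt
    · norm_num
    · push_cast [Nat.cast_sub hN, Nat.cast_sub (Nat.succ_le_of_lt hN2)]
      ring
  refine (sq_eq_sq₀ (thetaProd_equidistant_pos hN hT).le (by positivity)).mp ?_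
  rw [sq_thetaProd_equidistant hN hT, mul_pow, mul_pow, pow_right_comm √N,
    Real.sq_sqrt N.cast_nonneg, ← Real.rpow_mul_natCast hη.le, ← Real.rpow_natCast (etaR _), hcast]
  congr 3
  rw [etaExp]
  push_cast
  ring

/-! ### The determinantal formula -/

theorem ofReal_qDet {N : ℕ} {r t : ℝ} (hr : 0 < r) (ht : 0 < t) (x : Fin N → ℝ) :
    ((qDet N r t (equidistant N r) x : ℝ) : ℂ) = (1 / (2 * π * r)) ^ N * (Matrix.of fun j k =>
      equidistantKernel N (t / (2 * π * r ^ 2)) j ((x k / r : ℝ) : ℂ)).det := by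
  have hrc : (r : ℂ) ≠ 0 := by exact_mod_cast hr.ne'
  have hpi : (π : ℂ) ≠ 0 := by exact_mod_cast Real.pi_ne_zero
  have hmatrix : Complex.ofRealHom.mapMatrix (Matrix.of fun j k : Fin N =>
        pWrapped (parity N) r t (equidistant N r j) (x k))
      = ((1 : ℂ) / (2 * π * r)) • Matrix.of fun j k =>
          equidistantKernel N (t / (2 * π * r ^ 2)) j ((x k / r : ℝ) : ℂ) := by
    ext j k
    simp only [RingHom.mapMatrix_apply, Matrix.map_apply, Matrix.of_apply, Matrix.smul_apply,
      smul_eq_mul, Complex.ofRealHom_eq_coe]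
    rw [ofReal_pWrapped N hr ht, equidistantKernel, ← gaussSeries_neg]
    congr 3
    · rw [equidistant, equidistant]
      push_cast
      field_simp
      ring
    · push_cast
      field_simp
  rw [qDet, ← Complex.ofRealHom_eq_coe, RingHom.map_det, hmatrix, Matrix.det_smul,
    Fintype.card_fin]

theorem thetaProd_eq_qDet {N : ℕ} (hN : 0 < N) {r t : ℝ} (hr : 0 < r) (ht : 0 < t)
    (x : Fin N → ℝ) :
    thetaProd N (t / (2 * π * r ^ 2)) (fun j => x j / r)
      = etaR (N * (t / (2 * π * r ^ 2))) ^ etaExp N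
        * (2 * π * r / √N) ^ N * qDet N r t (equidistant N r) x := by
  have hT : 0 < t / (2 * π * r ^ 2) := by positivity
  have hq := ofReal_qDet hr ht x
  generalize t / (2 * π * r ^ 2) = T at hT hq
  have hL : 0 < ∏ i ∈ Finset.range N, latticeEigenvalue N T i :=
    Finset.prod_pos fun i _ => latticeEigenvalue_pos hN hT i
  have hdet := det_equidistantKernel_equidistant hN hT
  have hinterp := thetaProd_mul_det hN hT (by
    rw [hdet]
    exact_mod_cast (mul_pos (pow_pos (Nat.cast_pos.mpr hN) N) hL).ne') fun j => x j / r
  have hscale : (2 * π * r : ℂ) ≠ 0 := by exact_mod_cast (mul_pos Real.two_pi_pos hr).ne'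
  have hq' := congrArg ((2 * π * r : ℂ) ^ N * ·) hq
  simp only [← mul_assoc, ← mul_pow, mul_one_div_cancel hscale, one_pow, one_mul] at hq'
  rw [hdet, ← hq', thetaProd_equidistant_eq hN hT] at hinterp
  have hreal : thetaProd N T (fun j => x j / r)
        * (N ^ N * ∏ i ∈ Finset.range N, latticeEigenvalue N T i)
      = etaR (N * T) ^ etaExp N * √N ^ N
        * (∏ i ∈ Finset.range N, latticeEigenvalue N T i)
        * ((2 * π * r) ^ N * qDet N r t (equidistant N r) x) := by
    exact_mod_cast hinterp
  have hsq : (N : ℝ) ^ N = √N ^ N * √N ^ N := by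
    rw [← mul_pow, Real.mul_self_sqrt N.cast_nonneg]
  have hs0 : 0 < √(N : ℝ) ^ N := by positivity
  rw [hsq] at hreal
  refine mul_right_cancel₀ (mul_pos (mul_pos hs0 hs0) hL).ne' (hreal.trans ?_)
  rw [div_pow]
  field_simp

theorem tauIm_pos {r ts t : ℝ} (hr : 0 < r) (ht : t < ts) : 0 < tauIm r ts t :=
  div_pos (sub_pos.mpr ht) (by positivity)

theorem etaR_tauIm_pos {N : ℕ} (hN0 : 0 < N) {r ts t : ℝ} (hr : 0 < r) (ht : t < ts) :
    0 < etaR (N * tauIm r ts t) :=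
  etaR_pos (mul_pos (Nat.cast_pos.mpr hN0) (tauIm_pos hr ht))

/-- The function `h_N^r` without its power of `η`. -/
def thetaH (N : ℕ) (r ts t : ℝ) (x : Fin N → ℝ) : ℝ :=
  theta1R (bar r x / (2 * π * r)) (N * tauIm r ts t)
    * ∏ j : Fin N, ∏ k ∈ Finset.Ioi j, theta1R ((x k - x j) / (2 * π * r)) (N * tauIm r ts t)

theorem thetaH_eq_thetaProd (N : ℕ) {r : ℝ} (hr : 0 < r) (ts t : ℝ) (x : Fin N → ℝ) :
    thetaH N r ts t x = thetaProd N (tauIm r ts t) fun j => x j / r := by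
  rw [thetaH, thetaProd]
  congr 1
  · congr 1
    rw [bar, bar, kappa, kappa, ← Finset.sum_div]
    field_simp
  · refine Finset.prod_congr rfl fun j _ => Finset.prod_congr rfl fun k _ => ?_
    congr 1
    field_simp

theorem thetaH_eq_qDet {N : ℕ} (hN0 : 0 < N) {r ts t : ℝ} (hr : 0 < r) (ht : t < ts)
    (x : Fin N → ℝ) :
    thetaH N r ts t x = etaR (N * tauIm r ts t) ^ etaExp N * (2 * π * r / √N) ^ N
      * qDet N r (ts - t) (equidistant N r) x :=
  (thetaH_eq_thetaProd N hr ts t x).trans (thetaProd_eq_qDet hN0 hr (sub_pos.mpr ht) x)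

theorem hN_eq_mul_thetaH (N : ℕ) (r ts β t : ℝ) (x : Fin N → ℝ) :
    hN N r ts β t x = etaR (N * tauIm r ts t) ^ (-β * ((N : ℝ) - 1) * ((N : ℝ) - 2) / 4)
      * thetaH N r ts t x := by
  rw [hN, thetaH, mul_assoc]

theorem hN_eq_qDet {N : ℕ} (hN0 : 0 < N) {r ts t : ℝ} (β : ℝ) (hr : 0 < r) (ht : t < ts)
    (x : Fin N → ℝ) :
    hN N r ts β t x
      = etaR (N * tauIm r ts t) ^ (-(β - 2) * ((N : ℝ) - 1) * ((N : ℝ) - 2) / 4)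
        * (2 * π * r / √N) ^ N * qDet N r (ts - t) (equidistant N r) x := by
  rw [hN_eq_mul_thetaH, thetaH_eq_qDet hN0 hr ht, ← mul_assoc, ← mul_assoc,
    ← Real.rpow_add (etaR_tauIm_pos hN0 hr ht), etaExp]
  congr 3
  ring

/-! ### Heat equations -/

theorem contDiffOn_re_gaussSeries (a : ℝ) (m n : ℕ) :
    ContDiffOn ℝ n (fun z : ℝ × ℝ => (gaussSeries a m ((z.1 : ℂ), (z.2 : ℂ))).re)
      {z | 0 < z.2} := by
  have hcast : ContDiff ℝ n fun z : ℝ × ℝ => ((z.1 : ℂ), (z.2 : ℂ)) :=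
    (Complex.ofRealCLM.contDiff.comp contDiff_fst).prodMk
      (Complex.ofRealCLM.contDiff.comp contDiff_snd)
  exact Complex.reCLM.contDiff.comp_contDiffOn
    (((contDiffOn_gaussSeries a n m).restrict_scalars ℝ).comp hcast.contDiffOn fun z hz => hz)

theorem hasDerivAt_re_gaussSeries_fst (a : ℝ) (m : ℕ) (y : ℝ) {s : ℝ} (hs : 0 < s) :
    HasDerivAt (fun y : ℝ => (gaussSeries a m ((y : ℂ), (s : ℂ))).re)
      (gaussSeries a (m + 1) ((y : ℂ), (s : ℂ))).re y :=
  (hasDerivAt_gaussSeries_fst a m y (s := s) hs).real_of_complex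

theorem hasDerivAt_re_gaussSeries_snd (a : ℝ) (m : ℕ) (y : ℝ) {s : ℝ} (hs : 0 < s) :
    HasDerivAt (fun s : ℝ => (gaussSeries a m ((y : ℂ), (s : ℂ))).re)
      (gaussSeries a (m + 2) ((y : ℂ), (s : ℂ))).re s :=
  (hasDerivAt_gaussSeries_snd a m y (s := s) hs).real_of_complex

theorem theta1R_eq_gaussSeries (v s : ℝ) :
    theta1R v s = -(gaussSeries (-1 / 2) 0 (((2 * π * v + π : ℝ) : ℂ), ((π * s : ℝ) : ℂ))).re := by
  rw [theta1R, theta1_eq_gaussSeries, Complex.neg_re]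
  push_cast
  rfl

theorem contDiffOn_theta1R (n : ℕ) :
    ContDiffOn ℝ n (fun z : ℝ × ℝ => theta1R z.1 z.2) {z | 0 < z.2} := by
  simp only [theta1R_eq_gaussSeries]
  refine ((contDiffOn_re_gaussSeries (-1 / 2) 0 n).comp
    (g := fun z : ℝ × ℝ => (gaussSeries (-1 / 2) 0 ((z.1 : ℂ), (z.2 : ℂ))).re)
    (f := fun z : ℝ × ℝ => (2 * π * z.1 + π, π * z.2)) ?_ fun z hz => ?_).neg
  · exact ContDiff.contDiffOn (by fun_prop)
  · exact mul_pos Real.pi_pos hz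

theorem contDiffOn_etaR (n : ℕ) : ContDiffOn ℝ n etaR (Ioi 0) := by
  have heta : ContDiffOn ℂ n ModularForm.eta {z : ℂ | 0 < z.im} :=
    DifferentiableOn.contDiffOn (fun z hz =>
      (ModularForm.differentiableAt_eta_of_mem_upperHalfPlaneSet hz).differentiableWithinAt)
      (isOpen_lt continuous_const Complex.continuous_im)
  have haxis : ContDiff ℝ n fun s : ℝ => Complex.I * (s : ℂ) :=
    contDiff_const.mul Complex.ofRealCLM.contDiff
  exact Complex.reCLM.contDiff.comp_contDiffOn
    ((heta.restrict_scalars ℝ).comp haxis.contDiffOn fun s hs => by simpa using hs)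

theorem hasDerivAt_tauIm (r ts t : ℝ) : HasDerivAt (tauIm r ts) (-1 / (2 * π * r ^ 2)) t :=
  ((hasDerivAt_id t).const_sub ts).div_const _

/-- The `m`-th derivative in `y` of `ϑ₁(y / 2πr; N τ(t))`. -/
def thetaAt (N : ℕ) (r ts : ℝ) (m : ℕ) (t y : ℝ) : ℝ :=
  -(gaussSeries (-1 / 2) m (((y / r + π : ℝ) : ℂ), ((π * (N * tauIm r ts t) : ℝ) : ℂ))).re / r ^ m

theorem thetaAt_zero (N : ℕ) {r : ℝ} (hr : 0 < r) (ts t y : ℝ) :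
    thetaAt N r ts 0 t y = theta1R (y / (2 * π * r)) (N * tauIm r ts t) := by
  rw [thetaAt, theta1R_eq_gaussSeries, pow_zero, div_one]
  congr 5
  field_simp

theorem pi_mul_tauIm_pos {N : ℕ} (hN0 : 0 < N) {r ts t : ℝ} (hr : 0 < r) (ht : t < ts) :
    0 < π * (N * tauIm r ts t) :=
  mul_pos Real.pi_pos (mul_pos (Nat.cast_pos.mpr hN0) (tauIm_pos hr ht))

theorem hasDerivAt_thetaAt_space {N : ℕ} (hN0 : 0 < N) {r ts t : ℝ} (hr : 0 < r) (ht : t < ts)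
    (m : ℕ) (y : ℝ) : HasDerivAt (thetaAt N r ts m t) (thetaAt N r ts (m + 1) t y) y := by
  refine (((hasDerivAt_re_gaussSeries_fst (-1 / 2) m (y / r + π)
    (pi_mul_tauIm_pos hN0 hr ht)).comp y
      (((hasDerivAt_id y).div_const r).add_const π)).neg.div_const (r ^ m)).congr_deriv ?_
  rw [thetaAt]
  field_simp
  ring

theorem hasDerivAt_thetaAt_time {N : ℕ} (hN0 : 0 < N) {r ts t : ℝ} (hr : 0 < r) (ht : t < ts)
    (m : ℕ) (y : ℝ) :
    HasDerivAt (fun t => thetaAt N r ts m t y) (-(N / 2) * thetaAt N r ts (m + 2) t y) t := by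
  refine (((hasDerivAt_re_gaussSeries_snd (-1 / 2) m (y / r + π)
    (pi_mul_tauIm_pos hN0 hr ht)).comp t
      (((hasDerivAt_tauIm r ts t).const_mul (N : ℝ)).const_mul π)).neg.div_const
        (r ^ m)).congr_deriv ?_
  rw [thetaAt]
  field_simp
  ring

/-- The `m`-th derivative in `x` of the wrapped heat kernel at remaining time `ts - t`. -/
def kernelAt (N : ℕ) (r ts v : ℝ) (m : ℕ) (t x : ℝ) : ℝ :=
  1 / (2 * π * r)
    * (gaussSeries (-(N / 2)) m (((x - v) / r : ℝ), ((ts - t) / (2 * r ^ 2) : ℝ))).re / r ^ m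

theorem kernelAt_zero (N : ℕ) {r ts t : ℝ} (hr : 0 < r) (ht : t < ts) (v x : ℝ) :
    kernelAt N r ts v 0 t x = pWrapped (parity N) r (ts - t) v x := by
  have hwrapped := congrArg Complex.re (ofReal_pWrapped N hr (sub_pos.mpr ht) v x)
  rw [← gaussSeries_neg, show (1 / (2 * π * r) : ℂ) = ((1 / (2 * π * r) : ℝ) : ℂ) by push_cast; rfl,
    Complex.ofReal_re, Complex.re_ofReal_mul] at hwrapped
  rw [hwrapped, kernelAt, pow_zero, div_one]
  push_cast
  congr 4
  ring

theorem hasDerivAt_kernelAt_space (N : ℕ) {r ts t : ℝ} (hr : 0 < r) (ht : t < ts) (v : ℝ)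
    (m : ℕ) (x : ℝ) : HasDerivAt (kernelAt N r ts v m t) (kernelAt N r ts v (m + 1) t x) x := by
  have hs : 0 < (ts - t) / (2 * r ^ 2) := div_pos (sub_pos.mpr ht) (by positivity)
  refine ((((hasDerivAt_re_gaussSeries_fst (-(N / 2)) m ((x - v) / r) hs).comp x
    (((hasDerivAt_id x).sub_const v).div_const r)).const_mul (1 / (2 * π * r))).div_const
      (r ^ m)).congr_deriv ?_
  rw [kernelAt]
  field_simp
  ring

theorem hasDerivAt_kernelAt_time (N : ℕ) {r ts t : ℝ} (hr : 0 < r) (ht : t < ts) (v : ℝ)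
    (m : ℕ) (x : ℝ) :
    HasDerivAt (fun t => kernelAt N r ts v m t x) (-(1 / 2) * kernelAt N r ts v (m + 2) t x) t := by
  have hs : 0 < (ts - t) / (2 * r ^ 2) := div_pos (sub_pos.mpr ht) (by positivity)
  refine ((((hasDerivAt_re_gaussSeries_snd (-(N / 2)) m ((x - v) / r) hs).comp t
    (((hasDerivAt_id t).const_sub ts).div_const (2 * r ^ 2))).const_mul
      (1 / (2 * π * r))).div_const (r ^ m)).congr_deriv ?_
  rw [kernelAt]
  field_simp
  ring

section Multilinear

variable {N : ℕ} {E : Type*} [NormedAddCommGroup E] [NormedSpace ℝ E]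
  (f : ContinuousMultilinearMap ℝ (fun _ : Fin N => E) ℝ)

theorem hasDerivAt_multilinear_comp {c : Fin N → ℝ → E} {c' : Fin N → E} {t : ℝ}
    (h : ∀ k, HasDerivAt (c k) (c' k) t) :
    HasDerivAt (fun t => f fun k => c k t)
      (∑ l, f (Function.update (fun k => c k t) l (c' l))) t := by
  refine (HasFDerivAt.multilinear_comp f fun k => (h k).hasFDerivAt).hasDerivAt.congr_deriv ?_
  simp

theorem pd_multilinear_comp {c : Fin N → ℝ → E} {l : Fin N} {c' : ℝ → E}
    (hc : ∀ k, Differentiable ℝ (c k)) (hl : ∀ s, HasDerivAt (c l) (c' s) s) :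
    pd l (fun x => f fun k => c k (x k))
      = fun x => f fun k => Function.update c l c' k (x k) := by
  funext x
  have hcoord : ∀ k, HasFDerivAt (fun x : Fin N → ℝ => c k (x k))
      ((ContinuousLinearMap.toSpanSingleton ℝ (deriv (c k) (x k))).comp
        (ContinuousLinearMap.proj k)) x := fun k =>
    (hc k (x k)).hasDerivAt.hasFDerivAt.comp x (hasFDerivAt_apply k x)
  rw [pd, (HasFDerivAt.multilinear_comp f hcoord).fderiv]
  have hupdate : (fun k => Function.update c l c' k (x k))
      = Function.update (fun k => c k (x k)) l (c' (x l)) :=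
    funext fun k => Function.apply_update (fun k (g : ℝ → E) => g (x k)) c l c' k
  simp only [hupdate, FunLike.coe_sum, Finset.sum_apply, ContinuousLinearMap.comp_apply,
    ContinuousLinearMap.proj_apply, ContinuousLinearMap.toSpanSingleton_apply, Pi.single_apply,
    ContinuousMultilinearMap.toContinuousLinearMap_apply, ite_smul, one_smul, zero_smul]
  rw [Finset.sum_eq_single l (fun i _ hi => f.map_coord_zero i (by simp [hi]))
    (fun h => absurd (Finset.mem_univ l) h), if_pos rfl, (hl (x l)).deriv]

theorem pd_pd_multilinear_comp {c c' c'' : Fin N → ℝ → E}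
    (hc : ∀ k s, HasDerivAt (c k) (c' k s) s) (hc' : ∀ k s, HasDerivAt (c' k) (c'' k s) s)
    (l : Fin N) (x : Fin N → ℝ) :
    pd l (pd l fun x => f fun k => c k (x k)) x
      = f (Function.update (fun k => c k (x k)) l (c'' l (x l))) := by
  rw [pd_multilinear_comp f (fun k s => (hc k s).differentiableAt) (hc l),
    pd_multilinear_comp f (c' := c'' l) (fun k => ?_) (fun s => by simpa using hc' l s)]
  · rw [Function.update_idem]
    exact congrArg f
      (funext fun k => Function.apply_update (fun k (g : ℝ → E) => g (x k)) c l (c'' l) k)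
  · obtain rfl | hk := eq_or_ne k l
    · simpa using show Differentiable ℝ (c' k) from fun s => (hc' k s).differentiableAt
    · simpa [hk] using show Differentiable ℝ (c k) from fun s => (hc k s).differentiableAt

theorem hasDerivAt_multilinear_heat {c c' c'' : ℝ → Fin N → ℝ → E} {t a : ℝ}
    (hc : ∀ k s, HasDerivAt (c t k) (c' t k s) s) (hc' : ∀ k s, HasDerivAt (c' t k) (c'' t k s) s)
    (hheat : ∀ k s, HasDerivAt (fun t => c t k s) (a • c'' t k s) t) (x : Fin N → ℝ) :
    HasDerivAt (fun t => f fun k => c t k (x k))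
      (a * ∑ l, pd l (pd l fun x => f fun k => c t k (x k)) x) t := by
  refine (hasDerivAt_multilinear_comp f (c := fun k t => c t k (x k))
    fun k => hheat k (x k)).congr_deriv ?_
  simp only [pd_pd_multilinear_comp f hc hc', f.map_update_smul, Finset.mul_sum, smul_eq_mul]

end Multilinear

/-- The determinant as a continuous multilinear function of the columns. -/
def detColumns (N : ℕ) : ContinuousMultilinearMap ℝ (fun _ : Fin N => Fin N → ℝ) ℝ where
  toMultilinearMap := (Matrix.detRowAlternating (R := ℝ) (n := Fin N)).toMultilinearMap
  cont := Continuous.matrix_det continuous_id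

theorem detColumns_apply {N : ℕ} (c : Fin N → Fin N → ℝ) :
    detColumns N c = (Matrix.of fun j k => c k j).det :=
  (Matrix.det_transpose (Matrix.of c)).symm

theorem qDet_eq_detColumns (N : ℕ) {r ts t : ℝ} (hr : 0 < r) (ht : t < ts) (x : Fin N → ℝ) :
    qDet N r (ts - t) (equidistant N r) x
      = detColumns N fun k j => kernelAt N r ts (equidistant N r j) 0 t (x k) := by
  simp only [detColumns_apply, qDet, kernelAt_zero N hr ht]

theorem hasDerivAt_qDet (N : ℕ) {r ts t : ℝ} (hr : 0 < r) (ht : t < ts) (x : Fin N → ℝ) :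
    HasDerivAt (fun t => qDet N r (ts - t) (equidistant N r) x)
      (-(1 / 2) * ∑ l, pd l (pd l (qDet N r (ts - t) (equidistant N r))) x) t := by
  rw [funext (qDet_eq_detColumns N hr ht)]
  refine (hasDerivAt_multilinear_heat (detColumns N)
    (c := fun t _ s j => kernelAt N r ts (equidistant N r j) 0 t s)
    (c' := fun t _ s j => kernelAt N r ts (equidistant N r j) 1 t s)
    (c'' := fun t _ s j => kernelAt N r ts (equidistant N r j) 2 t s)
    (fun _ s => hasDerivAt_pi.mpr fun j => hasDerivAt_kernelAt_space N hr ht _ 0 s)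
    (fun _ s => hasDerivAt_pi.mpr fun j => hasDerivAt_kernelAt_space N hr ht _ 1 s)
    (fun _ s => hasDerivAt_pi.mpr fun j => hasDerivAt_kernelAt_time N hr ht _ 0 s)
    x).congr_of_eventuallyEq ?_
  filter_upwards [Iio_mem_nhds ht] with t' ht'
  exact qDet_eq_detColumns N hr ht' x

theorem differentiableAt_etaR_tauIm {N : ℕ} (hN0 : 0 < N) {r ts t : ℝ} (hr : 0 < r)
    (ht : t < ts) : DifferentiableAt ℝ (fun t => etaR (N * tauIm r ts t)) t := by
  have hs : 0 < N * tauIm r ts t := mul_pos (Nat.cast_pos.mpr hN0) (tauIm_pos hr ht)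
  have heta : DifferentiableAt ℝ etaR (N * tauIm r ts t) :=
    ((contDiffOn_etaR 1).differentiableOn (by simp)).differentiableAt (Ioi_mem_nhds hs)
  exact heta.comp (f := fun t => N * tauIm r ts t) t
    ((hasDerivAt_tauIm r ts t).const_mul _).differentiableAt

/-- The logarithmic time derivative of `η(N τ(t))`. -/
def etaLogDeriv (N : ℕ) (r ts t : ℝ) : ℝ := logDeriv (fun t => etaR (N * tauIm r ts t)) t

theorem hasDerivAt_etaR_rpow {N : ℕ} (hN0 : 0 < N) {r ts t : ℝ} (hr : 0 < r) (ht : t < ts)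
    (p : ℝ) :
    HasDerivAt (fun t => etaR (N * tauIm r ts t) ^ p)
      (p * etaLogDeriv N r ts t * etaR (N * tauIm r ts t) ^ p) t := by
  have hη := etaR_tauIm_pos hN0 hr ht
  refine ((differentiableAt_etaR_tauIm hN0 hr ht).hasDerivAt.rpow_const
    (Or.inl hη.ne')).congr_deriv ?_
  rw [etaLogDeriv, logDeriv_apply, Real.rpow_sub_one hη.ne']
  ring

theorem pd_const_mul {N : ℕ} (c : ℝ) (f : (Fin N → ℝ) → ℝ) (j : Fin N) :
    pd j (fun x => c * f x) = fun x => c * pd j f x := by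
  funext x
  rw [pd, pd, show (fun x => c * f x) = c • f from rfl, fderiv_const_smul_field]
  rfl

theorem hasDerivAt_thetaH {N : ℕ} (hN0 : 0 < N) {r ts t : ℝ} (hr : 0 < r) (ht : t < ts)
    (x : Fin N → ℝ) :
    HasDerivAt (fun t => thetaH N r ts t x) (etaExp N * etaLogDeriv N r ts t * thetaH N r ts t x
      - 1 / 2 * ∑ l, pd l (pd l (thetaH N r ts t)) x) t := by
  refine ((((hasDerivAt_etaR_rpow hN0 hr ht (etaExp N)).mul_const
    ((2 * π * r / √N) ^ N)).mul
    (hasDerivAt_qDet N hr ht x)).congr_of_eventuallyEq ?_).congr_deriv ?_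
  · filter_upwards [Iio_mem_nhds ht] with t' ht'
    exact thetaH_eq_qDet hN0 hr ht' x
  · rw [funext (thetaH_eq_qDet hN0 hr ht)]
    simp only [pd_const_mul, ← Finset.mul_sum]
    ring

/-! ### Partial derivatives and affine forms -/

section PartialDerivatives

variable {N : ℕ} {f g : (Fin N → ℝ) → ℝ} {x : Fin N → ℝ} {D : Set (Fin N → ℝ)}

theorem pd_eventuallyEq (h : f =ᶠ[𝓝 x] g) (j : Fin N) : pd j f =ᶠ[𝓝 x] pd j g :=
  h.fderiv.mono fun y hy => by rw [pd, pd, hy]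

theorem pd_eqOn (hD : IsOpen D) (h : EqOn f g D) (j : Fin N) : EqOn (pd j f) (pd j g) D :=
  fun _ hx => (pd_eventuallyEq (h.eventuallyEq_of_mem (hD.mem_nhds hx)) j).eq_of_nhds

theorem pd_add (hf : DifferentiableAt ℝ f x) (hg : DifferentiableAt ℝ g x) (j : Fin N) :
    pd j (fun x => f x + g x) x = pd j f x + pd j g x := by
  simp only [pd, fderiv_fun_add hf hg, FunLike.coe_add, Pi.add_apply]

theorem pd_mul (hf : DifferentiableAt ℝ f x) (hg : DifferentiableAt ℝ g x) (j : Fin N) :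
    pd j (fun x => f x * g x) x = pd j f x * g x + f x * pd j g x := by
  simp only [pd, fderiv_fun_mul hf hg, FunLike.coe_add, Pi.add_apply, FunLike.coe_smul,
    Pi.smul_apply, smul_eq_mul]
  ring

theorem pd_exp (hf : DifferentiableAt ℝ f x) (j : Fin N) :
    pd j (fun x => Real.exp (f x)) x = Real.exp (f x) * pd j f x := by
  rw [pd, hf.hasFDerivAt.exp.fderiv, pd]
  rfl

theorem eventually_differentiableAt (hf : ContDiffAt ℝ 2 f x) :
    ∀ᶠ y in 𝓝 x, DifferentiableAt ℝ f y :=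
  (hf.eventually (by simp)).mono fun _ hy => hy.differentiableAt (by simp)

theorem differentiableAt_pd (hf : ContDiffAt ℝ 2 f x) (j : Fin N) :
    DifferentiableAt ℝ (pd j f) x :=
  ((hf.fderiv_right (m := 1) (by norm_num)).differentiableAt (by simp)).clm_apply
    (differentiableAt_const _)

theorem pd_pd_mul (hf : ContDiffAt ℝ 2 f x) (hg : ContDiffAt ℝ 2 g x) (j k : Fin N) :
    pd k (pd j fun x => f x * g x) x
      = (pd k (pd j f) x * g x + pd j f x * pd k g x)
        + (pd k f x * pd j g x + f x * pd k (pd j g) x) := by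
  have hfd := hf.differentiableAt (by simp)
  have hgd := hg.differentiableAt (by simp)
  have hpd : (pd j fun x => f x * g x) =ᶠ[𝓝 x] fun y => pd j f y * g y + f y * pd j g y := by
    filter_upwards [eventually_differentiableAt hf, eventually_differentiableAt hg]
      with y hfy hgy using pd_mul hfy hgy j
  have hfj := differentiableAt_pd hf j
  have hgj := differentiableAt_pd hg j
  rw [(pd_eventuallyEq hpd k).eq_of_nhds, pd_add (hfj.fun_mul hgd) (hfd.fun_mul hgj),
    pd_mul hfj hgd, pd_mul hfd hgj]

theorem pd_pd_exp (hf : ContDiffAt ℝ 2 f x) (j : Fin N) :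
    pd j (pd j fun x => Real.exp (f x)) x
      = Real.exp (f x) * (pd j (pd j f) x + pd j f x ^ 2) := by
  have hfd := hf.differentiableAt (by simp)
  have hpd : (pd j fun x => Real.exp (f x)) =ᶠ[𝓝 x] fun y => Real.exp (f y) * pd j f y :=
    (eventually_differentiableAt hf).mono fun y hy => pd_exp hy j
  rw [(pd_eventuallyEq hpd j).eq_of_nhds, pd_mul hfd.exp (differentiableAt_pd hf j), pd_exp hfd]
  ring

end PartialDerivatives

section AffineForms

variable {N : ℕ} {x : Fin N → ℝ}

/-- The affine forms `x_k - x_j` (at `some ⟨j, k⟩`) and `x̄` (at `none`), whose values are the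
arguments of the theta functions in `h_N`. -/
def affineForm (r : ℝ) : Option (Σ _ : Fin N, Fin N) → (Fin N → ℝ) → ℝ
  | none, x => bar r x
  | some p, x => x p.2 - x p.1

/-- The entries of the (constant) gradients of the affine forms. -/
def affineCoeff : Option (Σ _ : Fin N, Fin N) → Fin N → ℝ
  | none, _ => 1
  | some p, l => (if l = p.2 then 1 else 0) - (if l = p.1 then 1 else 0)

/-- The index set of the affine forms: pairs `j < k`, and the point `none`. -/
def formIndex (N : ℕ) : Finset (Option (Σ _ : Fin N, Fin N)) :=
  Finset.insertNone (Finset.univ.sigma fun j => Finset.Ioi j)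

/-- The derivatives of the affine forms. -/
def affineGrad (i : Option (Σ _ : Fin N, Fin N)) : (Fin N → ℝ) →L[ℝ] ℝ :=
  ∑ l, affineCoeff i l • ContinuousLinearMap.proj l

theorem affineGrad_single (i : Option (Σ _ : Fin N, Fin N)) (j : Fin N) :
    affineGrad i (Pi.single j 1) = affineCoeff i j := by
  simp [affineGrad, Pi.single_apply]

theorem hasFDerivAt_affineForm (r : ℝ) (i : Option (Σ _ : Fin N, Fin N)) (x : Fin N → ℝ) :
    HasFDerivAt (affineForm r i) (affineGrad i) x := by
  cases i with
  | none =>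
    refine ((HasFDerivAt.fun_sum (u := Finset.univ)
      fun (l : Fin N) _ => hasFDerivAt_apply (𝕜 := ℝ) l x).sub_const (kappa N r)).congr_fderiv ?_
    simp [affineGrad, affineCoeff]
  | some p =>
    refine ((hasFDerivAt_apply (𝕜 := ℝ) p.2 x).fun_sub (hasFDerivAt_apply p.1 x)).congr_fderiv ?_
    ext v
    simp [affineGrad, affineCoeff, sub_mul, Finset.sum_sub_distrib]

theorem sum_formIndex (F : Option (Σ _ : Fin N, Fin N) → ℝ) :
    ∑ i ∈ formIndex N, F i = (∑ j : Fin N, ∑ k ∈ Finset.Ioi j, F (some ⟨j, k⟩)) + F none := by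
  rw [formIndex, Finset.sum_insertNone, Finset.sum_sigma, add_comm]

theorem prod_formIndex (F : Option (Σ _ : Fin N, Fin N) → ℝ) :
    ∏ i ∈ formIndex N, F i = F none * ∏ j : Fin N, ∏ k ∈ Finset.Ioi j, F (some ⟨j, k⟩) := by
  rw [formIndex, Finset.prod_insertNone, Finset.prod_sigma]

theorem sum_affineCoeff_sq_none :
    ∑ l, affineCoeff (none : Option (Σ _ : Fin N, Fin N)) l ^ 2 = N := by
  simp [affineCoeff]

theorem sum_affineCoeff_sq_some {j k : Fin N} (hjk : j < k) :
    ∑ l, affineCoeff (some ⟨j, k⟩) l ^ 2 = 2 := by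
  have hsq : ∀ l, affineCoeff (some ⟨j, k⟩ : Option (Σ _ : Fin N, Fin N)) l ^ 2
      = (if l = k then 1 else 0) + (if l = j then 1 else 0) := by
    intro l
    simp only [affineCoeff]
    split_ifs with hlk hlj
    · exact absurd (hlj.symm.trans hlk) hjk.ne
    all_goals norm_num
  simp only [hsq, Finset.sum_add_distrib, Finset.sum_ite_eq', Finset.mem_univ, if_true]
  norm_num

theorem affineForm_mem {r : ℝ} (hx : x ∈ alcove N r) {i : Option (Σ _ : Fin N, Fin N)}
    (hi : i ∈ formIndex N) : affineForm r i x ∈ Ioo 0 (2 * π * r) := by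
  cases i with
  | none => exact hx.2.2
  | some p =>
    have hp : p.1 < p.2 := by simpa [formIndex] using hi
    exact ⟨sub_pos.mpr (hx.1 hp), sub_lt_iff_lt_add'.mpr (hx.2.1 p.1 p.2)⟩

theorem sub_mem_of_mem_alcove {r : ℝ} (hx : x ∈ alcove N r) {j k : Fin N}
    (hk : k ∈ Finset.Ioi j) : x k - x j ∈ Ioo 0 (2 * π * r) :=
  affineForm_mem hx (i := some ⟨j, k⟩) (by simpa [formIndex] using hk)

theorem pd_sum_affineForm (r : ℝ) (w : Option (Σ _ : Fin N, Fin N) → ℝ) {G G' : ℝ → ℝ}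
    (h : ∀ i ∈ formIndex N, HasDerivAt G (G' (affineForm r i x)) (affineForm r i x)) (j : Fin N) :
    pd j (fun x => ∑ i ∈ formIndex N, w i * G (affineForm r i x)) x
      = ∑ i ∈ formIndex N, (w i * affineCoeff i j) * G' (affineForm r i x) := by
  have hsum : HasFDerivAt (fun x => ∑ i ∈ formIndex N, w i * G (affineForm r i x))
      (∑ i ∈ formIndex N, w i • G' (affineForm r i x) • affineGrad i) x :=
    HasFDerivAt.fun_sum fun i hi =>
      ((h i hi).comp_hasFDerivAt x (hasFDerivAt_affineForm r i x)).const_mul (w i)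
  rw [pd, hsum.fderiv]
  simp only [FunLike.coe_sum, Finset.sum_apply, FunLike.coe_smul, Pi.smul_apply, smul_eq_mul,
    affineGrad_single]
  exact Finset.sum_congr rfl fun i _ => by ring

theorem isOpen_alcove (N : ℕ) (r : ℝ) : IsOpen (alcove N r) := by
  have hset : alcove N r = (⋂ j, ⋂ k, {x : Fin N → ℝ | j < k → x j < x k})
      ∩ ((⋂ j, ⋂ k, {x : Fin N → ℝ | x k < x j + 2 * π * r})
        ∩ bar r ⁻¹' Ioo 0 (2 * π * r)) := by
    ext x
    simp only [alcove, mem_ofPred_eq, mem_inter_iff, mem_iInter, mem_preimage, StrictMono]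
  have hbar : Continuous (bar r : (Fin N → ℝ) → ℝ) := by unfold bar; fun_prop
  rw [hset]
  refine (isOpen_iInter_of_finite fun j => isOpen_iInter_of_finite fun k => ?_).inter
    ((isOpen_iInter_of_finite fun j => isOpen_iInter_of_finite fun k =>
      isOpen_lt (by fun_prop) (by fun_prop)).inter (isOpen_Ioo.preimage hbar))
  by_cases hjk : j < k
  · simpa only [hjk, true_imp_iff] using isOpen_lt (continuous_apply j) (continuous_apply k)
  · simp [hjk]

end AffineForms

/-! ### Potentials -/

section Potentials

variable {N : ℕ} {r ts t : ℝ}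

theorem contDiffOn_theta1R_tauIm (hN0 : 0 < N) (hr : 0 < r) {n : ℕ} {g : (Fin N → ℝ) → ℝ}
    (hg : ContDiff ℝ n g) : ContDiffOn ℝ n
      (fun z : ℝ × (Fin N → ℝ) => theta1R (g z.2 / (2 * π * r)) (N * tauIm r ts z.1))
      (Iio ts ×ˢ univ) := by
  have hτ : ContDiff ℝ n fun z : ℝ × (Fin N → ℝ) => (N : ℝ) * tauIm r ts z.1 := by
    unfold tauIm
    fun_prop
  exact ContDiffOn.comp (g := fun z : ℝ × ℝ => theta1R z.1 z.2)
    (f := fun z : ℝ × (Fin N → ℝ) => (g z.2 / (2 * π * r), N * tauIm r ts z.1))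
    (contDiffOn_theta1R n) (((hg.comp contDiff_snd).div_const _).prodMk hτ).contDiffOn
    fun z hz => mul_pos (Nat.cast_pos.mpr hN0) (tauIm_pos hr hz.1)

theorem contDiffOn_thetaH (hN0 : 0 < N) (hr : 0 < r) (n : ℕ) : ContDiffOn ℝ n
    (fun z : ℝ × (Fin N → ℝ) => thetaH N r ts z.1 z.2) (Iio ts ×ˢ univ) :=
  (contDiffOn_theta1R_tauIm hN0 hr (by unfold bar; fun_prop)).mul
    (contDiffOn_prod fun j _ => contDiffOn_prod fun k _ =>
      contDiffOn_theta1R_tauIm hN0 hr (g := fun x => x k - x j) (by fun_prop))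

theorem thetaH_eq_prod (N : ℕ) (hr : 0 < r) (ts t : ℝ) (x : Fin N → ℝ) :
    thetaH N r ts t x = ∏ i ∈ formIndex N, thetaAt N r ts 0 t (affineForm r i x) := by
  simp only [prod_formIndex, thetaAt_zero N hr]
  rfl

theorem thetaAt_zero_pos (hN0 : 0 < N) (hr : 0 < r) (ht : t < ts) {y : ℝ}
    (hy : y ∈ Ioo 0 (2 * π * r)) : 0 < thetaAt N r ts 0 t y := by
  have hL : 0 < 2 * π * r := hy.1.trans hy.2
  rw [thetaAt_zero N hr]
  exact theta1R_pos ⟨div_pos hy.1 hL, (div_lt_one hL).mpr hy.2⟩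
    (mul_pos (Nat.cast_pos.mpr hN0) (tauIm_pos hr ht))

theorem potU_eq (N : ℕ) (hr : 0 < r) (ts t y : ℝ) :
    potU N r ts t y = -Real.log (thetaAt N r ts 0 t y) := by
  rw [potU, thetaAt_zero N hr]

/-- The first space derivative of `U_N`. -/
def potU₁ (N : ℕ) (r ts t y : ℝ) : ℝ := -thetaAt N r ts 1 t y / thetaAt N r ts 0 t y

/-- The second space derivative of `U_N`. -/
def potU₂ (N : ℕ) (r ts t y : ℝ) : ℝ :=
  (thetaAt N r ts 1 t y ^ 2 - thetaAt N r ts 2 t y * thetaAt N r ts 0 t y)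
    / thetaAt N r ts 0 t y ^ 2

theorem hasDerivAt_potU (hN0 : 0 < N) (hr : 0 < r) (ht : t < ts) {y : ℝ}
    (hy : y ∈ Ioo 0 (2 * π * r)) : HasDerivAt (potU N r ts t) (potU₁ N r ts t y) y := by
  rw [show potU N r ts t = fun y => -Real.log (thetaAt N r ts 0 t y) from
    funext (potU_eq N hr ts t), potU₁, neg_div]
  exact ((hasDerivAt_thetaAt_space hN0 hr ht 0 y).log (thetaAt_zero_pos hN0 hr ht hy).ne').neg

theorem hasDerivAt_potU₁ (hN0 : 0 < N) (hr : 0 < r) (ht : t < ts) {y : ℝ}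
    (hy : y ∈ Ioo 0 (2 * π * r)) : HasDerivAt (potU₁ N r ts t) (potU₂ N r ts t y) y := by
  refine ((hasDerivAt_thetaAt_space hN0 hr ht 1 y).fun_neg.fun_div
    (hasDerivAt_thetaAt_space hN0 hr ht 0 y) (thetaAt_zero_pos hN0 hr ht hy).ne').congr_deriv ?_
  rw [potU₂]
  congr 1
  ring

theorem deriv_deriv_potU (hN0 : 0 < N) (hr : 0 < r) (ht : t < ts) {y : ℝ}
    (hy : y ∈ Ioo 0 (2 * π * r)) : deriv (deriv (potU N r ts t)) y = potU₂ N r ts t y := by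
  refine ((hasDerivAt_potU₁ hN0 hr ht hy).congr_of_eventuallyEq ?_).deriv
  filter_upwards [isOpen_Ioo.mem_nhds hy] with z hz using (hasDerivAt_potU hN0 hr ht hz).deriv

/-- `ϑ₁` solves a heat equation, and `(log ϑ)'' = ϑ'' / ϑ - ((log ϑ)')²`. -/
theorem hasDerivAt_potU_time (hN0 : 0 < N) (hr : 0 < r) (ht : t < ts) {y : ℝ}
    (hy : y ∈ Ioo 0 (2 * π * r)) : HasDerivAt (fun t => potU N r ts t y)
      (N / 2 * (potU₁ N r ts t y ^ 2 - potU₂ N r ts t y)) t := by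
  have hne := (thetaAt_zero_pos hN0 hr ht hy).ne'
  simp only [potU_eq N hr]
  refine ((hasDerivAt_thetaAt_time hN0 hr ht 0 y).log hne).fun_neg.congr_deriv ?_
  rw [potU₁, potU₂]
  field_simp
  ring

theorem potW_eq_sum (N : ℕ) (r ts t : ℝ) (x : Fin N → ℝ) :
    potW N r ts t x = ∑ i ∈ formIndex N, potU N r ts t (affineForm r i x) :=
  (sum_formIndex fun i => potU N r ts t (affineForm r i x)).symm

theorem thetaH_pos (hN0 : 0 < N) (hr : 0 < r) (ht : t < ts) {x : Fin N → ℝ}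
    (hx : x ∈ alcove N r) : 0 < thetaH N r ts t x := by
  rw [thetaH_eq_prod N hr]
  exact Finset.prod_pos fun i hi => thetaAt_zero_pos hN0 hr ht (affineForm_mem hx hi)

theorem potW_eq_neg_log (hN0 : 0 < N) (hr : 0 < r) (ht : t < ts) {x : Fin N → ℝ}
    (hx : x ∈ alcove N r) : potW N r ts t x = -Real.log (thetaH N r ts t x) := by
  rw [potW_eq_sum, thetaH_eq_prod N hr, Real.log_prod fun i hi =>
    (thetaAt_zero_pos hN0 hr ht (affineForm_mem hx hi)).ne', ← Finset.sum_neg_distrib]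
  simp only [potU_eq N hr]

theorem thetaH_eq_exp (hN0 : 0 < N) (hr : 0 < r) (ht : t < ts) {x : Fin N → ℝ}
    (hx : x ∈ alcove N r) : thetaH N r ts t x = Real.exp (-potW N r ts t x) := by
  rw [potW_eq_neg_log hN0 hr ht hx, neg_neg, Real.exp_log (thetaH_pos hN0 hr ht hx)]

theorem contDiffAt_potW (hN0 : 0 < N) (hr : 0 < r) (ht : t < ts) {x : Fin N → ℝ}
    (hx : x ∈ alcove N r) (n : ℕ) : ContDiffAt ℝ n (potW N r ts t) x := by
  have hthetaH : ContDiff ℝ n (thetaH N r ts t) := contDiffOn_univ.mp <|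
    (contDiffOn_thetaH hN0 hr n).comp (f := fun x => (t, x))
      (contDiff_prodMk_right t).contDiffOn fun x _ => ⟨ht, mem_univ x⟩
  refine (hthetaH.contDiffAt.log (thetaH_pos hN0 hr ht hx).ne').neg.congr_of_eventuallyEq ?_
  filter_upwards [(isOpen_alcove N r).mem_nhds hx] with y hy using potW_eq_neg_log hN0 hr ht hy

theorem pd_potW (hN0 : 0 < N) (hr : 0 < r) (ht : t < ts) (j : Fin N) :
    EqOn (pd j (potW N r ts t))
      (fun x => ∑ i ∈ formIndex N, affineCoeff i j * potU₁ N r ts t (affineForm r i x))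
      (alcove N r) := fun x hx => by
  simpa only [one_mul, ← potW_eq_sum] using pd_sum_affineForm r (fun _ => 1)
    (fun i hi => hasDerivAt_potU hN0 hr ht (affineForm_mem hx hi)) j

theorem sum_pd_pd_potW (hN0 : 0 < N) (hr : 0 < r) (ht : t < ts) {x : Fin N → ℝ}
    (hx : x ∈ alcove N r) : ∑ j, pd j (pd j (potW N r ts t)) x
      = 2 * (∑ j : Fin N, ∑ k ∈ Finset.Ioi j, potU₂ N r ts t (x k - x j))
        + N * potU₂ N r ts t (bar r x) := by
  have hpd : ∀ j, pd j (pd j (potW N r ts t)) x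
      = ∑ i ∈ formIndex N, affineCoeff i j ^ 2 * potU₂ N r ts t (affineForm r i x) := by
    intro j
    rw [pd_eqOn (isOpen_alcove N r) (pd_potW hN0 hr ht j) j hx, pd_sum_affineForm r
      (fun i => affineCoeff i j) (fun i hi => hasDerivAt_potU₁ hN0 hr ht (affineForm_mem hx hi))]
    simp only [sq]
  simp only [hpd]
  rw [Finset.sum_comm]
  simp only [← Finset.sum_mul, sum_formIndex, sum_affineCoeff_sq_none, Finset.mul_sum]
  congr 1
  refine Finset.sum_congr rfl fun j _ => Finset.sum_congr rfl fun k hk => ?_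
  rw [sum_affineCoeff_sq_some (Finset.mem_Ioi.mp hk)]
  rfl

theorem hasDerivAt_potW_time (hN0 : 0 < N) (hr : 0 < r) (ht : t < ts) {x : Fin N → ℝ}
    (hx : x ∈ alcove N r) : HasDerivAt (fun t => potW N r ts t x) (∑ i ∈ formIndex N,
      N / 2 * (potU₁ N r ts t (affineForm r i x) ^ 2 - potU₂ N r ts t (affineForm r i x))) t := by
  simp only [potW_eq_sum]
  exact HasDerivAt.fun_sum fun i hi => hasDerivAt_potU_time hN0 hr ht (affineForm_mem hx hi)

theorem potV_eq (hN0 : 0 < N) (hr : 0 < r) (β : ℝ) (ht : t < ts) {x : Fin N → ℝ}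
    (hx : x ∈ alcove N r) : potV N r ts β t x
      = β * (β - 2) / 8 * (2 * deriv (fun t => potW N r ts t x) t
        + ∑ j, pd j (pd j (potW N r ts t)) x) := by
  have hN : (N : ℝ) ≠ 0 := Nat.cast_ne_zero.mpr hN0.ne'
  have hU₁ : ∀ j : Fin N, ∑ k ∈ Finset.Ioi j, deriv (potU N r ts t) (x k - x j) ^ 2
      = ∑ k ∈ Finset.Ioi j, potU₁ N r ts t (x k - x j) ^ 2 := fun j =>
    Finset.sum_congr rfl fun k hk => by
      rw [(hasDerivAt_potU hN0 hr ht (sub_mem_of_mem_alcove hx hk)).deriv]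
  have hU₂ : ∀ j : Fin N, ∑ k ∈ Finset.Ioi j, deriv (deriv (potU N r ts t)) (x k - x j)
      = ∑ k ∈ Finset.Ioi j, potU₂ N r ts t (x k - x j) := fun j =>
    Finset.sum_congr rfl fun k hk =>
      deriv_deriv_potU hN0 hr ht (sub_mem_of_mem_alcove hx hk)
  rw [(hasDerivAt_potW_time hN0 hr ht hx).deriv, sum_pd_pd_potW hN0 hr ht hx, potV,
    ← Finset.mul_sum, Finset.sum_sub_distrib, sum_formIndex, sum_formIndex,
    (hasDerivAt_potU hN0 hr ht hx.2.2).deriv]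
  simp only [hU₁, hU₂, affineForm]
  field_simp
  ring

theorem pd_pd_thetaH (hN0 : 0 < N) (hr : 0 < r) (ht : t < ts) {x : Fin N → ℝ}
    (hx : x ∈ alcove N r) (j : Fin N) : pd j (pd j (thetaH N r ts t)) x
      = thetaH N r ts t x * (pd j (potW N r ts t) x ^ 2 - pd j (pd j (potW N r ts t)) x) := by
  have hD := isOpen_alcove N r
  have hexp : EqOn (thetaH N r ts t) (fun x => Real.exp (-1 * potW N r ts t x)) (alcove N r) :=
    fun y hy => by simp only [thetaH_eq_exp hN0 hr ht hy, neg_one_mul]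
  rw [pd_eqOn hD (pd_eqOn hD hexp j) j hx,
    pd_pd_exp (contDiffAt_const.mul (contDiffAt_potW hN0 hr ht hx 2)), hexp hx]
  simp only [pd_const_mul]
  ring

/-- The heat equation for `thetaH`, written for its logarithm. -/
theorem deriv_potW_time (hN0 : 0 < N) (hr : 0 < r) (ht : t < ts) {x : Fin N → ℝ}
    (hx : x ∈ alcove N r) : deriv (fun t => potW N r ts t x) t
      = -(etaExp N * etaLogDeriv N r ts t) - 1 / 2 * ∑ j, pd j (pd j (potW N r ts t)) x
        + 1 / 2 * ∑ j, pd j (potW N r ts t) x ^ 2 := by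
  have hpos := thetaH_pos hN0 hr ht hx
  have hlog : (fun t => potW N r ts t x) =ᶠ[𝓝 t] fun t => -Real.log (thetaH N r ts t x) := by
    filter_upwards [Iio_mem_nhds ht] with s hs using potW_eq_neg_log hN0 hr hs hx
  rw [hlog.deriv_eq, ((hasDerivAt_thetaH hN0 hr ht x).log hpos.ne').fun_neg.deriv]
  simp only [pd_pd_thetaH hN0 hr ht hx, ← Finset.mul_sum, Finset.sum_sub_distrib]
  field_simp
  ring

end Potentials

/-! ### Conjugation of the operators by the multiplier -/

section Conjugation

variable {N : ℕ} {r ts t t' : ℝ} {x x' : Fin N → ℝ}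

theorem hN_pos (hN0 : 0 < N) (hr : 0 < r) (β : ℝ) (ht : t < ts) (hx : x ∈ alcove N r) :
    0 < hN N r ts β t x := by
  rw [hN_eq_mul_thetaH]
  exact mul_pos (Real.rpow_pos_of_pos (etaR_tauIm_pos hN0 hr ht) _) (thetaH_pos hN0 hr ht hx)

theorem multiplier_pos (hN0 : 0 < N) (hr : 0 < r) (β : ℝ) (ht' : t' < ts)
    (hx' : x' ∈ alcove N r) (ht : t < ts) (hx : x ∈ alcove N r) :
    0 < multiplier N r ts β t' x' t x :=
  Real.rpow_pos_of_pos (div_pos (hN_pos hN0 hr β ht hx) (hN_pos hN0 hr β ht' hx')) _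

theorem multiplier_eq (hN0 : 0 < N) (hr : 0 < r) (β : ℝ) (ht' : t' < ts)
    (hx' : x' ∈ alcove N r) (ht : t < ts) (hx : x ∈ alcove N r) :
    multiplier N r ts β t' x' t x
      = hN N r ts β t' x' ^ (-(β / 2)) * etaR (N * tauIm r ts t) ^ (-(β ^ 2 / 4) * etaExp N)
        * Real.exp (-(β / 2) * potW N r ts t x) := by
  have hη := etaR_tauIm_pos hN0 hr ht
  have hh' := (hN_pos hN0 hr β ht' hx').le
  rw [multiplier, Real.div_rpow (hN_pos hN0 hr β ht hx).le hh', hN_eq_mul_thetaH N r ts β t,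
    thetaH_eq_exp hN0 hr ht hx, Real.mul_rpow (Real.rpow_nonneg hη.le _) (Real.exp_pos _).le,
    ← Real.rpow_mul hη.le, ← Real.exp_mul, div_eq_mul_inv, ← Real.rpow_neg hh',
    show -β * ((N : ℝ) - 1) * ((N : ℝ) - 2) / 4 * (β / 2) = -(β ^ 2 / 4) * etaExp N by
      rw [etaExp]; ring,
    show -potW N r ts t x * (β / 2) = -(β / 2) * potW N r ts t x by ring]
  ring

theorem contDiffAt_multiplier (hN0 : 0 < N) (hr : 0 < r) (β : ℝ) (ht' : t' < ts)
    (hx' : x' ∈ alcove N r) (ht : t < ts) (hx : x ∈ alcove N r) (n : ℕ) :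
    ContDiffAt ℝ n (multiplier N r ts β t' x' t) x :=
  (contDiffAt_const.mul (contDiffAt_const.mul (contDiffAt_potW hN0 hr ht hx n)).exp)
    |>.congr_of_eventuallyEq (EqOn.eventuallyEq_of_mem
      (fun _ hy => multiplier_eq hN0 hr β ht' hx' ht hy) ((isOpen_alcove N r).mem_nhds hx))

theorem pd_multiplier (hN0 : 0 < N) (hr : 0 < r) (β : ℝ) (ht' : t' < ts)
    (hx' : x' ∈ alcove N r) (ht : t < ts) (hx : x ∈ alcove N r) (j : Fin N) :
    pd j (multiplier N r ts β t' x' t) x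
      = -(β / 2) * pd j (potW N r ts t) x * multiplier N r ts β t' x' t x := by
  have hW := (contDiffAt_potW hN0 hr ht hx 1).differentiableAt (by simp)
  rw [pd_eqOn (isOpen_alcove N r) (fun y hy => multiplier_eq hN0 hr β ht' hx' ht hy) j hx,
    multiplier_eq hN0 hr β ht' hx' ht hx]
  simp only [pd_const_mul, pd_exp (hW.const_mul (-(β / 2)))]
  ring

theorem pd_pd_multiplier (hN0 : 0 < N) (hr : 0 < r) (β : ℝ) (ht' : t' < ts)
    (hx' : x' ∈ alcove N r) (ht : t < ts) (hx : x ∈ alcove N r) (j : Fin N) :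
    pd j (pd j (multiplier N r ts β t' x' t)) x
      = (β ^ 2 / 4 * pd j (potW N r ts t) x ^ 2 - β / 2 * pd j (pd j (potW N r ts t)) x)
        * multiplier N r ts β t' x' t x := by
  have hD := isOpen_alcove N r
  rw [pd_eqOn hD (pd_eqOn hD (fun y hy => multiplier_eq hN0 hr β ht' hx' ht hy) j) j hx,
    multiplier_eq hN0 hr β ht' hx' ht hx]
  simp only [pd_const_mul,
    pd_pd_exp (contDiffAt_const (c := -(β / 2)).mul (contDiffAt_potW hN0 hr ht hx 2))]
  ring

theorem kolmogorovOp_multiplier_mul (hN0 : 0 < N) (hr : 0 < r) (β : ℝ) (ht' : t' < ts)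
    (hx' : x' ∈ alcove N r) (ht : t < ts) (hx : x ∈ alcove N r) {f : (Fin N → ℝ) → ℝ}
    (hf : ContDiffAt ℝ 2 f x) :
    kolmogorovOp N r ts β t (fun x => multiplier N r ts β t' x' t x * f x) x
      = multiplier N r ts β t' x' t x * (1 / 2 * ∑ j, pd j (pd j f) x
        + (β / 4 * ∑ j, pd j (pd j (potW N r ts t)) x
          - β ^ 2 / 8 * ∑ j, pd j (potW N r ts t) x ^ 2) * f x) := by
  have hm := contDiffAt_multiplier hN0 hr β ht' hx' ht hx 2
  have hmd := hm.differentiableAt (by simp)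
  have hfd := hf.differentiableAt (by simp)
  have hdrift : ∀ j, pd j (fun y => pd j (potW N r ts t) y
        * (multiplier N r ts β t' x' t y * f y)) x
      = pd j (pd j (potW N r ts t)) x * (multiplier N r ts β t' x' t x * f x)
        + pd j (potW N r ts t) x * (pd j (multiplier N r ts β t' x' t) x * f x
          + multiplier N r ts β t' x' t x * pd j f x) := fun j => by
    rw [pd_mul (differentiableAt_pd (contDiffAt_potW hN0 hr ht hx 2) j) (hmd.fun_mul hfd),
      pd_mul hmd hfd]
  rw [kolmogorovOp]
  simp only [hdrift, pd_pd_mul hm hf, pd_pd_multiplier hN0 hr β ht' hx' ht hx,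
    pd_multiplier hN0 hr β ht' hx' ht hx, Finset.mul_sum, Finset.sum_mul,
    ← Finset.sum_add_distrib, ← Finset.sum_sub_distrib]
  exact Finset.sum_congr rfl fun j _ => by ring

theorem hasDerivAt_multiplier_time (hN0 : 0 < N) (hr : 0 < r) (β : ℝ) (ht' : t' < ts)
    (hx' : x' ∈ alcove N r) (ht : t < ts) (hx : x ∈ alcove N r) :
    HasDerivAt (fun s => multiplier N r ts β t' x' s x)
      ((-(β ^ 2 / 4) * etaExp N * etaLogDeriv N r ts t
        - β / 2 * deriv (fun t => potW N r ts t x) t) * multiplier N r ts β t' x' t x) t := by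
  have hW := (hasDerivAt_potW_time hN0 hr ht hx).differentiableAt.hasDerivAt
  refine ((((hasDerivAt_etaR_rpow hN0 hr ht (-(β ^ 2 / 4) * etaExp N)).const_mul
    (hN N r ts β t' x' ^ (-(β / 2)))).fun_mul
    (hW.const_mul (-(β / 2))).exp).congr_of_eventuallyEq ?_).congr_deriv ?_
  · filter_upwards [Iio_mem_nhds ht] with s hs using multiplier_eq hN0 hr β ht' hx' hs hx
  · rw [multiplier_eq hN0 hr β ht' hx' ht hx]
    ring

theorem deriv_sub_kolmogorovOp (hN0 : 0 < N) (hr : 0 < r) (β : ℝ) (ht' : t' < ts)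
    (hx' : x' ∈ alcove N r) (ht : t < ts) (hx : x ∈ alcove N r) {f : ℝ → (Fin N → ℝ) → ℝ}
    (hf : ContDiffAt ℝ 2 (f t) x) (hft : DifferentiableAt ℝ (fun t => f t x) t) :
    deriv (fun s => multiplier N r ts β t' x' s x * f s x) t
        - kolmogorovOp N r ts β t (fun x => multiplier N r ts β t' x' t x * f t x) x
      = multiplier N r ts β t' x' t x
        * (deriv (fun s => f s x) t + hamiltonian N r ts β t (f t) x) := by
  rw [((hasDerivAt_multiplier_time hN0 hr β ht' hx' ht hx).fun_mul hft.hasDerivAt).deriv,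
    kolmogorovOp_multiplier_mul hN0 hr β ht' hx' ht hx hf, hamiltonian, potV_eq hN0 hr β ht hx]
  linear_combination
    (-(β ^ 2 / 4) * (multiplier N r ts β t' x' t x * f t x)) * deriv_potW_time hN0 hr ht hx

end Conjugation

/-! ### Classical regularity -/

section Regularity

variable {N : ℕ} {D : Set (Fin N → ℝ)} {a b : ℝ} {u v : ℝ → (Fin N → ℝ) → ℝ}

theorem deriv_time_congr (h : ∀ t ∈ Ioo a b, EqOn (u t) (v t) D) {t : ℝ} (ht : t ∈ Ioo a b)
    {x : Fin N → ℝ} (hx : x ∈ D) : deriv (fun s => u s x) t = deriv (fun s => v s x) t :=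
  EventuallyEq.deriv_eq (by filter_upwards [isOpen_Ioo.mem_nhds ht] with s hs using h s hs hx)

theorem IsC12On.congr (hu : IsC12On u a b D) (hD : IsOpen D)
    (h : ∀ t ∈ Ioo a b, EqOn (u t) (v t) D) : IsC12On v a b D where
  continuousOn := hu.continuousOn.congr fun z hz => (h z.1 hz.1 hz.2).symm
  time_differentiable x hx := (hu.time_differentiable x hx).congr fun t ht => (h t ht hx).symm
  space_contDiff t ht := (hu.space_contDiff t ht).congr fun _ hx => (h t ht hx).symm
  time_continuousOn := hu.time_continuousOn.congr fun _ hz => (deriv_time_congr h hz.1 hz.2).symm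
  pd_continuousOn j := (hu.pd_continuousOn j).congr fun z hz =>
    (pd_eqOn hD (h z.1 hz.1) j hz.2).symm
  pd2_continuousOn j k := (hu.pd2_continuousOn j k).congr fun z hz =>
    (pd_eqOn hD (pd_eqOn hD (h z.1 hz.1) j) k hz.2).symm

theorem IsC12On.contDiffAt (hu : IsC12On u a b D) (hD : IsOpen D) {t : ℝ} (ht : t ∈ Ioo a b)
    {x : Fin N → ℝ} (hx : x ∈ D) : ContDiffAt ℝ 2 (u t) x :=
  (hu.space_contDiff t ht).contDiffAt (hD.mem_nhds hx)

theorem IsC12On.differentiableAt_time (hu : IsC12On u a b D) {t : ℝ} (ht : t ∈ Ioo a b)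
    {x : Fin N → ℝ} (hx : x ∈ D) : DifferentiableAt ℝ (fun s => u s x) t :=
  (hu.time_differentiable x hx).differentiableAt (isOpen_Ioo.mem_nhds ht)

theorem IsC12On.mul (hu : IsC12On u a b D) (hv : IsC12On v a b D) (hD : IsOpen D) :
    IsC12On (fun t x => u t x * v t x) a b D where
  continuousOn := hu.continuousOn.mul hv.continuousOn
  time_differentiable x hx := (hu.time_differentiable x hx).mul (hv.time_differentiable x hx)
  space_contDiff t ht := (hu.space_contDiff t ht).mul (hv.space_contDiff t ht)
  time_continuousOn :=
    ((hu.time_continuousOn.mul hv.continuousOn).add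
      (hu.continuousOn.mul hv.time_continuousOn)).congr fun z hz =>
        deriv_fun_mul (hu.differentiableAt_time hz.1 hz.2) (hv.differentiableAt_time hz.1 hz.2)
  pd_continuousOn j :=
    (((hu.pd_continuousOn j).mul hv.continuousOn).add
      (hu.continuousOn.mul (hv.pd_continuousOn j))).congr fun z hz =>
        pd_mul ((hu.contDiffAt hD hz.1 hz.2).differentiableAt (by simp))
          ((hv.contDiffAt hD hz.1 hz.2).differentiableAt (by simp)) j
  pd2_continuousOn j k :=
    ((((hu.pd2_continuousOn j k).mul hv.continuousOn).add
      ((hu.pd_continuousOn j).mul (hv.pd_continuousOn k))).add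
      (((hu.pd_continuousOn k).mul (hv.pd_continuousOn j)).add
        (hu.continuousOn.mul (hv.pd2_continuousOn j k)))).congr fun z hz =>
          pd_pd_mul (hu.contDiffAt hD hz.1 hz.2) (hv.contDiffAt hD hz.1 hz.2) j k

theorem pd_eq_fderiv_prod {F : ℝ × (Fin N → ℝ) → ℝ} {t : ℝ} {x : Fin N → ℝ}
    (h : DifferentiableAt ℝ F (t, x)) (j : Fin N) :
    pd j (fun x => F (t, x)) x = fderiv ℝ F (t, x) (0, Pi.single j 1) := by
  have hcomp : HasFDerivAt (fun x => F (t, x)) _ x :=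
    h.hasFDerivAt.comp x (hasFDerivAt_prodMk_right t x)
  rw [pd, hcomp.fderiv]
  rfl

theorem deriv_eq_fderiv_prod {F : ℝ × (Fin N → ℝ) → ℝ} {t : ℝ} {x : Fin N → ℝ}
    (h : DifferentiableAt ℝ F (t, x)) :
    deriv (fun t => F (t, x)) t = fderiv ℝ F (t, x) (1, 0) :=
  (h.hasFDerivAt.comp (f := fun s : ℝ => (s, x)) t (hasFDerivAt_prodMk_left t x)).hasDerivAt.deriv

theorem isC12On_of_contDiffOn (hD : IsOpen D)
    (h : ContDiffOn ℝ 2 (fun z : ℝ × (Fin N → ℝ) => u z.1 z.2) (Ioo a b ×ˢ D)) :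
    IsC12On u a b D := by
  let F : ℝ × (Fin N → ℝ) → ℝ := fun z => u z.1 z.2
  have hΩ : IsOpen (Ioo a b ×ˢ D) := isOpen_Ioo.prod hD
  have hF : ∀ z ∈ Ioo a b ×ˢ D, DifferentiableAt ℝ F z := fun z hz =>
    (h.contDiffAt (hΩ.mem_nhds hz)).differentiableAt (by simp)
  have hF' : ContDiffOn ℝ 1 (fderiv ℝ F) (Ioo a b ×ˢ D) := h.fderiv_of_isOpen hΩ (by norm_num)
  let G : Fin N → ℝ × (Fin N → ℝ) → ℝ := fun j z => fderiv ℝ F z (0, Pi.single j 1)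
  have hG : ∀ j, ContDiffOn ℝ 1 (G j) (Ioo a b ×ˢ D) := fun j => hF'.clm_apply contDiffOn_const
  have hpd : ∀ j, ∀ t ∈ Ioo a b, EqOn (pd j (u t)) (fun x => G j (t, x)) D :=
    fun j t ht x hx => pd_eq_fderiv_prod (hF (t, x) ⟨ht, hx⟩) j
  exact {
    continuousOn := h.continuousOn
    time_differentiable := fun x hx t ht => ((hF (t, x) ⟨ht, hx⟩).comp (f := fun s : ℝ => (s, x)) t
      (by fun_prop)).differentiableWithinAt
    space_contDiff := fun t ht => h.comp (f := fun x => (t, x))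
      (contDiff_prodMk_right t).contDiffOn fun x hx => ⟨ht, hx⟩
    time_continuousOn := (hF'.clm_apply contDiffOn_const).continuousOn.congr fun z hz =>
      deriv_eq_fderiv_prod (hF z hz)
    pd_continuousOn := fun j => (hG j).continuousOn.congr fun z hz => hpd j z.1 hz.1 hz.2
    pd2_continuousOn := fun j k => by
      have hG' : ContDiffOn ℝ 0 (fderiv ℝ (G j)) (Ioo a b ×ˢ D) :=
        (hG j).fderiv_of_isOpen hΩ (by norm_num)
      refine (hG'.clm_apply (contDiffOn_const (c := (0, Pi.single k 1)))).continuousOn.congr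
        fun z hz => ?_
      rw [pd_eqOn hD (hpd j z.1 hz.1) k hz.2]
      exact pd_eq_fderiv_prod (((hG j).contDiffAt (hΩ.mem_nhds hz)).differentiableAt (by simp)) k }

end Regularity

section Multiplier

variable {N : ℕ} {r ts t' : ℝ} {x' : Fin N → ℝ}

theorem contDiffOn_hN (hN0 : 0 < N) (hr : 0 < r) (β : ℝ) (n : ℕ) : ContDiffOn ℝ n
    (fun z : ℝ × (Fin N → ℝ) => hN N r ts β z.1 z.2) (Iio ts ×ˢ univ) := by
  have hη : ContDiffOn ℝ n (fun z : ℝ × (Fin N → ℝ) => etaR (N * tauIm r ts z.1))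
      (Iio ts ×ˢ univ) :=
    (contDiffOn_etaR n).comp (f := fun z : ℝ × (Fin N → ℝ) => N * tauIm r ts z.1)
      (by unfold tauIm; fun_prop)
      fun z hz => mul_pos (Nat.cast_pos.mpr hN0) (tauIm_pos hr hz.1)
  simp only [hN_eq_mul_thetaH]
  exact (hη.rpow_const_of_ne fun z hz => (etaR_tauIm_pos hN0 hr hz.1).ne').mul
    (contDiffOn_thetaH hN0 hr n)

theorem continuousOn_multiplier (hN0 : 0 < N) (hr : 0 < r) {β : ℝ} (hβ : 0 < β) (t' : ℝ)
    (x' : Fin N → ℝ) : ContinuousOn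
      (fun z : ℝ × (Fin N → ℝ) => multiplier N r ts β t' x' z.1 z.2) (Iio ts ×ˢ univ) :=
  ((contDiffOn_hN hN0 hr β 0).continuousOn.div_const _).rpow_const
    fun _ _ => Or.inr (half_pos hβ).le

theorem contDiffOn_multiplier (hN0 : 0 < N) (hr : 0 < r) (β : ℝ) (ht' : t' < ts)
    (hx' : x' ∈ alcove N r) (n : ℕ) : ContDiffOn ℝ n
      (fun z : ℝ × (Fin N → ℝ) => multiplier N r ts β t' x' z.1 z.2)
      (Ioo t' ts ×ˢ alcove N r) :=
  (((contDiffOn_hN hN0 hr β n).mono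
    (prod_mono Ioo_subset_Iio_self (subset_univ _))).div_const _).rpow_const_of_ne fun _ hz =>
      (div_pos (hN_pos hN0 hr β hz.1.2 hz.2) (hN_pos hN0 hr β ht' hx')).ne'

theorem SolvesKolmogorov.congr {β : ℝ} {u v : ℝ → (Fin N → ℝ) → ℝ}
    (hu : SolvesKolmogorov N r ts β t' u)
    (h : ∀ t ∈ Ioo t' ts, EqOn (u t) (v t) (alcove N r)) : SolvesKolmogorov N r ts β t' v := by
  have hD := isOpen_alcove N r
  refine ⟨hu.1.congr hD h, fun t ht x hx => ?_⟩
  have hdrift : ∀ j, EqOn (fun y => pd j (potW N r ts t) y * u t y)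
      (fun y => pd j (potW N r ts t) y * v t y) (alcove N r) := fun j y hy => by
    simp only [h t ht hy]
  rw [← hu.2 t ht x hx, ← deriv_time_congr h ht hx, kolmogorovOp, kolmogorovOp]
  simp only [pd_eqOn hD (hdrift _) _ hx, pd_eqOn hD (pd_eqOn hD (h t ht) _) _ hx]

theorem solvesSchrodinger_iff (hN0 : 0 < N) (hr : 0 < r) (β : ℝ) (ht' : t' < ts)
    (hx' : x' ∈ alcove N r) (f : ℝ → (Fin N → ℝ) → ℝ) :
    SolvesSchrodinger N r ts β t' f ↔
      SolvesKolmogorov N r ts β t' fun t x => multiplier N r ts β t' x' t x * f t x := by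
  have hD := isOpen_alcove N r
  have hm := contDiffOn_multiplier hN0 hr β ht' hx' 2
  have hm0 : ∀ z ∈ Ioo t' ts ×ˢ alcove N r, multiplier N r ts β t' x' z.1 z.2 ≠ 0 :=
    fun z hz => (multiplier_pos hN0 hr β ht' hx' hz.1.2 hz.2).ne'
  have hequation (hf : IsC12On f t' ts (alcove N r)) (t) (ht : t ∈ Ioo t' ts) (x)
      (hx : x ∈ alcove N r) := deriv_sub_kolmogorovOp hN0 hr β ht' hx' ht.2 hx
    (hf.contDiffAt hD ht hx) (hf.differentiableAt_time ht hx)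
  constructor
  · rintro ⟨hf, hsolves⟩
    refine ⟨(isC12On_of_contDiffOn hD hm).mul hf hD, fun t ht x hx => ?_⟩
    rw [hequation hf t ht x hx, hsolves t ht x hx, mul_zero]
  · rintro ⟨hmf, hsolves⟩
    have hf : IsC12On f t' ts (alcove N r) :=
      ((isC12On_of_contDiffOn hD (hm.inv hm0)).mul hmf hD).congr hD fun t ht x hx =>
        inv_mul_cancel_left₀ (hm0 (t, x) ⟨ht, hx⟩) _
    refine ⟨hf, fun t ht x hx => ?_⟩
    exact (mul_eq_zero.mp ((hequation hf t ht x hx).symm.trans (hsolves t ht x hx))).resolve_left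
      (hm0 (t, x) ⟨ht, hx⟩)

end Multiplier

/-! ### Initial and boundary conditions -/

section Conditions

open MeasureTheory

variable {N : ℕ} {r ts t' β : ℝ} {x' : Fin N → ℝ}

theorem isBounded_alcove (hN0 : 0 < N) (r : ℝ) : Bornology.IsBounded (alcove N r) := by
  have hN : (0 : ℝ) < N := Nat.cast_pos.mpr hN0
  refine (Metric.isBounded_Icc (fun _ => kappa N r / N - 2 * π * r)
    (fun _ => (kappa N r + 2 * π * r) / N + 2 * π * r)).subset fun x ⟨_, hgap, hbar⟩ => ?_
  rw [bar, mem_Ioo] at hbar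
  refine ⟨fun j => sub_le_iff_le_add.mpr <| (div_le_iff₀ hN).mpr ?_,
    fun j => sub_le_iff_le_add.mp <| (le_div_iff₀ hN).mpr ?_⟩
  · have hsum : ∑ k, x k ≤ ∑ _ : Fin N, (x j + 2 * π * r) :=
      Finset.sum_le_sum fun k _ => (hgap j k).le
    rw [Fin.sum_const, nsmul_eq_mul] at hsum
    linarith
  · have hsum : ∑ _ : Fin N, (x j - 2 * π * r) ≤ ∑ k, x k :=
      Finset.sum_le_sum fun k _ => (sub_lt_iff_lt_add.mpr (hgap k j)).le
    rw [Fin.sum_const, nsmul_eq_mul] at hsum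
    linarith

theorem isCompact_closure_alcove (hN0 : 0 < N) (r : ℝ) : IsCompact (closure (alcove N r)) :=
  (isBounded_alcove hN0 r).isCompact_closure

theorem measurableSet_alcove (N : ℕ) (r : ℝ) : MeasurableSet (alcove N r) :=
  (isOpen_alcove N r).measurableSet

theorem integrableOn_continuous_mul (hN0 : 0 < N) {g u : (Fin N → ℝ) → ℝ} (hg : Continuous g)
    (hu : IntegrableOn u (alcove N r)) : IntegrableOn (fun x => g x * u x) (alcove N r) :=
  hu.continuousOn_mul_of_subset hg.continuousOn (isCompact_closure_alcove hN0 r)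
    (measurableSet_alcove N r) subset_closure

theorem continuous_of_continuousOn_prod {T X Y : Type*} [TopologicalSpace T] [TopologicalSpace X]
    [TopologicalSpace Y] {g : T × X → Y} {s : Set T} (hg : ContinuousOn g (s ×ˢ univ)) {t : T}
    (ht : t ∈ s) : Continuous fun x => g (t, x) :=
  hg.comp_continuous (by fun_prop) fun x => ⟨ht, mem_univ x⟩

theorem tendsto_setIntegral_mul_zero {T X : Type*} [MeasurableSpace X] {μ : Measure X} {A : Set X}
    (hA : MeasurableSet A) {l : Filter T} {g u : T → X → ℝ} {c : ℝ}
    (hu : ∀ᶠ t in l, IntegrableOn (u t) A μ) (hu0 : ∀ᶠ t in l, ∀ x ∈ A, 0 ≤ u t x)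
    (hlim : Tendsto (fun t => ∫ x in A, u t x ∂μ) l (𝓝 c)) (hg : TendstoUniformlyOn g 0 l A) :
    Tendsto (fun t => ∫ x in A, g t x * u t x ∂μ) l (𝓝 0) := by
  rw [Metric.tendsto_nhds]
  intro ε hε
  have hc : 0 < |c| + 1 := by positivity
  have hδ : 0 < ε / (|c| + 1) := div_pos hε hc
  filter_upwards [hu, hu0, hlim.eventually (gt_mem_nhds (lt_add_of_le_of_pos (le_abs_self c)
    one_pos)), Metric.tendstoUniformlyOn_iff.mp hg _ hδ] with t hut hu0t hlt hgt
  have hbound : ‖∫ x in A, g t x * u t x ∂μ‖ ≤ ∫ x in A, ε / (|c| + 1) * u t x ∂μ := by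
    refine norm_integral_le_of_norm_le (hut.const_mul _) ?_
    filter_upwards [ae_restrict_mem hA] with x hx
    rw [norm_mul, Real.norm_of_nonneg (hu0t x hx)]
    refine mul_le_mul_of_nonneg_right ?_ (hu0t x hx)
    simpa using (hgt x hx).le
  rw [dist_zero_right]
  calc ‖∫ x in A, g t x * u t x ∂μ‖ ≤ ε / (|c| + 1) * ∫ x in A, u t x ∂μ := by
        rwa [← integral_const_mul]
    _ < ε / (|c| + 1) * (|c| + 1) := mul_lt_mul_of_pos_left hlt hδ
    _ = ε := div_mul_cancel₀ ε hc.ne'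

theorem tendstoUniformlyOn_sub_of_isCompact {T X : Type*} [TopologicalSpace T]
    [TopologicalSpace X] {K : Set X} (hK : IsCompact K) {s : Set T} {t₀ : T} (ht₀ : t₀ ∈ s)
    {g : T × X → ℝ} (hg : ContinuousOn g (s ×ˢ K)) :
    TendstoUniformlyOn (fun t x => g (t, x) - g (t₀, x)) 0 (𝓝[s] t₀) K := by
  rw [Metric.tendstoUniformlyOn_iff]
  intro ε hε
  obtain ⟨v, hv, hgv⟩ := hK.mem_uniformity_of_prod (f := fun t x => g (t, x)) hg ht₀
    (Metric.dist_mem_uniformity hε)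
  filter_upwards [hv] with t ht x hx
  simpa [Real.dist_eq, abs_sub_comm] using hgv t ht x hx

theorem StartsAtDelta.tendsto_of_continuousOn (hN0 : 0 < N) {u : ℝ → (Fin N → ℝ) → ℝ}
    (hu : StartsAtDelta N r ts t' x' u) (hpos : PositiveInside N r ts t' u) (ht' : t' < ts)
    {g : ℝ × (Fin N → ℝ) → ℝ} (hg : ContinuousOn g (Iio ts ×ˢ univ)) :
    Tendsto (fun t => ∫ x in alcove N r, g (t, x) * u t x) (𝓝[>] t') (𝓝 (g (t', x'))) := by
  have hIoo : ∀ᶠ t in 𝓝[>] t', t ∈ Ioo t' ts := Ioo_mem_nhdsGT ht'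
  have hg' := continuous_of_continuousOn_prod hg ht'
  have hmass : Tendsto (fun t => ∫ x in alcove N r, u t x) (𝓝[>] t') (𝓝 1) := by
    simpa using hu.2 (fun _ => 1) continuous_const
  have huniform : TendstoUniformlyOn (fun t x => g (t, x) - g (t', x)) 0 (𝓝[>] t')
      (alcove N r) := fun s hs =>
    ((tendstoUniformlyOn_sub_of_isCompact (isCompact_closure_alcove hN0 r) (mem_Iio.mpr ht')
      (hg.mono (prod_mono_right (subset_univ _)))).mono subset_closure s hs).filter_mono
      (nhdsWithin_eq_nhds.mpr (Iio_mem_nhds ht') ▸ nhdsWithin_le_nhds)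
  have herror := tendsto_setIntegral_mul_zero (measurableSet_alcove N r) (hIoo.mono hu.1)
    (hIoo.mono fun t ht x hx => (hpos t ht x hx).le) hmass huniform
  refine (add_zero (g (t', x')) ▸ (hu.2 (fun x => g (t', x)) hg').add herror).congr' ?_
  filter_upwards [hIoo] with t ht
  rw [← integral_add (integrableOn_continuous_mul hN0 hg' (hu.1 t ht)) (integrableOn_continuous_mul
    hN0 ((continuous_of_continuousOn_prod hg ht.2).fun_sub hg') (hu.1 t ht))]
  simp only [← add_mul, add_sub_cancel]

theorem StartsAtDelta.mul_of_continuousOn (hN0 : 0 < N) {u : ℝ → (Fin N → ℝ) → ℝ}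
    (hu : StartsAtDelta N r ts t' x' u) (hpos : PositiveInside N r ts t' u) (ht' : t' < ts)
    {m : ℝ × (Fin N → ℝ) → ℝ} (hm : ContinuousOn m (Iio ts ×ˢ univ)) (hm1 : m (t', x') = 1) :
    StartsAtDelta N r ts t' x' fun t x => m (t, x) * u t x := by
  refine ⟨fun t ht => integrableOn_continuous_mul hN0 (continuous_of_continuousOn_prod hm ht.2)
    (hu.1 t ht), fun φ hφ => ?_⟩
  simpa only [mul_assoc, hm1, mul_one] using hu.tendsto_of_continuousOn hN0 hpos ht'
    (g := fun z => φ z.2 * m z) ((hφ.comp continuous_snd).continuousOn.mul hm)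

/-- The difference `f - m f` is at most `|1 - m| ψ`, whose integral tends to `|1 - m| = 0` at the
starting point. -/
theorem StartsAtDelta.of_mul_of_le (hN0 : 0 < N) (ht' : t' < ts) {m : ℝ × (Fin N → ℝ) → ℝ}
    (hm : ContinuousOn m (Iio ts ×ˢ univ)) (hm1 : m (t', x') = 1) {p ψ f : ℝ → (Fin N → ℝ) → ℝ}
    (hp : StartsAtDelta N r ts t' x' p) (hψ : StartsAtDelta N r ts t' x' ψ)
    (hfcont : ∀ t ∈ Ioo t' ts, ContinuousOn (f t) (alcove N r)) (hf : PositiveInside N r ts t' f)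
    (hfψ : ∀ t ∈ Ioo t' ts, ∀ x ∈ alcove N r, f t x ≤ ψ t x)
    (hpf : ∀ t ∈ Ioo t' ts, ∀ x ∈ alcove N r, p t x = m (t, x) * f t x) :
    StartsAtDelta N r ts t' x' f := by
  have hA := measurableSet_alcove N r
  have hIoo : ∀ᶠ t in 𝓝[>] t', t ∈ Ioo t' ts := Ioo_mem_nhdsGT ht'
  have hfint : ∀ t ∈ Ioo t' ts, IntegrableOn (f t) (alcove N r) := fun t ht =>
    (hψ.1 t ht).mono' ((hfcont t ht).aestronglyMeasurable hA) <| by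
      filter_upwards [ae_restrict_mem hA] with x hx
      rw [Real.norm_of_nonneg (hf t ht x hx).le]
      exact hfψ t ht x hx
  refine ⟨hfint, fun φ hφ => ?_⟩
  have hg : ContinuousOn (fun z : ℝ × (Fin N → ℝ) => |φ z.2| * |1 - m z|) (Iio ts ×ˢ univ) :=
    (hφ.comp continuous_snd).abs.continuousOn.mul (continuousOn_const.sub hm).abs
  have hgψ := hψ.tendsto_of_continuousOn hN0
    (fun t ht x hx => (hf t ht x hx).trans_le (hfψ t ht x hx)) ht' hg
  simp only [hm1, sub_self, abs_zero, mul_zero] at hgψ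
  have herror : Tendsto (fun t => ∫ x in alcove N r, φ x * (f t x - p t x)) (𝓝[>] t') (𝓝 0) := by
    refine squeeze_zero_norm' (hIoo.mono fun t ht => norm_integral_le_of_norm_le
      (integrableOn_continuous_mul hN0 (continuous_of_continuousOn_prod hg ht.2) (hψ.1 t ht)) ?_)
      hgψ
    filter_upwards [ae_restrict_mem hA] with x hx
    calc ‖φ x * (f t x - p t x)‖ = |φ x| * |1 - m (t, x)| * f t x := by
          rw [hpf t ht x hx, ← one_sub_mul, norm_mul, norm_mul,
            Real.norm_of_nonneg (hf t ht x hx).le, Real.norm_eq_abs, Real.norm_eq_abs, mul_assoc]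
      _ ≤ |φ x| * |1 - m (t, x)| * ψ t x :=
          mul_le_mul_of_nonneg_left (hfψ t ht x hx) (by positivity)
  refine (add_zero (φ x') ▸ (hp.2 φ hφ).add herror).congr' (hIoo.mono fun t ht => ?_)
  beta_reduce
  have hint := integrableOn_continuous_mul hN0 hφ ((hfint t ht).sub (hp.1 t ht))
  simp only [Pi.sub_apply] at hint
  rw [← integral_add (integrableOn_continuous_mul hN0 hφ (hp.1 t ht)) hint]
  simp only [← mul_add, add_sub_cancel]

theorem VanishesAtBoundary.of_le {ψ f : ℝ → (Fin N → ℝ) → ℝ} (hψ : VanishesAtBoundary N r ts t' ψ)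
    (hf : PositiveInside N r ts t' f)
    (hfψ : ∀ t ∈ Ioo t' ts, ∀ x ∈ alcove N r, f t x ≤ ψ t x) : VanishesAtBoundary N r ts t' f := by
  refine fun t ht y hy => squeeze_zero' ?_ ?_ (hψ t ht y hy)
  · filter_upwards [self_mem_nhdsWithin] with z hz using (hf z.1 hz.1 z.2 hz.2).le
  · filter_upwards [self_mem_nhdsWithin] with z hz using hfψ z.1 hz.1 z.2 hz.2

theorem VanishesAtBoundary.of_eq_mul {m : ℝ × (Fin N → ℝ) → ℝ}
    (hm : ContinuousOn m (Iio ts ×ˢ univ)) {p ψ : ℝ → (Fin N → ℝ) → ℝ}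
    (hψ : VanishesAtBoundary N r ts t' ψ)
    (hp : ∀ t ∈ Ioo t' ts, ∀ x ∈ alcove N r, p t x = m (t, x) * ψ t x) :
    VanishesAtBoundary N r ts t' p := by
  intro t ht y hy
  have hmt : ContinuousAt m (t, y) := hm.continuousAt (prod_mem_nhds (Iio_mem_nhds ht.2) univ_mem)
  have hlim := (hmt.tendsto.mono_left nhdsWithin_le_nhds).mul (hψ t ht y hy)
  rw [mul_zero] at hlim
  refine hlim.congr' ?_
  filter_upwards [self_mem_nhdsWithin] with z hz using (hp z.1 hz.1 z.2 hz.2).symm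

end Conditions

/-! ### The minimal solutions -/

section Minimal

variable {N : ℕ} {r ts t' β : ℝ} {x' : Fin N → ℝ}

theorem multiplier_self (hN0 : 0 < N) (hr : 0 < r) (β : ℝ) (ht' : t' < ts)
    (hx' : x' ∈ alcove N r) : multiplier N r ts β t' x' t' x' = 1 := by
  rw [multiplier, div_self (hN_pos hN0 hr β ht' hx').ne', Real.one_rpow]

theorem IsSchrodingerSolution.multiplier_mul (hN0 : 0 < N) (hr : 0 < r) (hβ : 0 < β)
    (ht' : t' < ts) (hx' : x' ∈ alcove N r) {ψ : ℝ → (Fin N → ℝ) → ℝ}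
    (hψ : IsSchrodingerSolution N r ts β t' x' ψ) :
    IsKolmogorovSolution N r ts β t' x' fun t x => multiplier N r ts β t' x' t x * ψ t x where
  equation := (solvesSchrodinger_iff hN0 hr β ht' hx' ψ).mp hψ.equation
  initial := hψ.initial.mul_of_continuousOn hN0 hψ.positive ht'
    (continuousOn_multiplier hN0 hr hβ t' x') (multiplier_self hN0 hr β ht' hx')
  positive t ht x hx := mul_pos (multiplier_pos hN0 hr β ht' hx' ht.2 hx) (hψ.positive t ht x hx)

theorem IsKolmogorovSolution.isSchrodingerSolution_of_le (hN0 : 0 < N) (hr : 0 < r) (hβ : 0 < β)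
    (ht' : t' < ts) (hx' : x' ∈ alcove N r) {p ψ f : ℝ → (Fin N → ℝ) → ℝ}
    (hp : IsKolmogorovSolution N r ts β t' x' p) (hψ : IsSchrodingerSolution N r ts β t' x' ψ)
    (hpf : ∀ t ∈ Ioo t' ts, ∀ x ∈ alcove N r, p t x = multiplier N r ts β t' x' t x * f t x)
    (hfψ : ∀ t ∈ Ioo t' ts, ∀ x ∈ alcove N r, f t x ≤ ψ t x) :
    IsSchrodingerSolution N r ts β t' x' f := by
  have hequation := (solvesSchrodinger_iff hN0 hr β ht' hx' f).mpr (hp.equation.congr hpf)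
  have hpositive : PositiveInside N r ts t' f := fun t ht x hx =>
    pos_of_mul_pos_right (hpf t ht x hx ▸ hp.positive t ht x hx)
      (multiplier_pos hN0 hr β ht' hx' ht.2 hx).le
  exact ⟨hequation, StartsAtDelta.of_mul_of_le hN0 ht' (continuousOn_multiplier hN0 hr hβ t' x')
    (multiplier_self hN0 hr β ht' hx') hp.initial hψ.initial
    (fun t ht => (hequation.1.space_contDiff t ht).continuousOn) hpositive hfψ hpf,
    hpositive, hψ.boundary.of_le hpositive hfψ⟩

theorem transitionDensity_eq (hN0 : 0 < N) (hr : 0 < r) (hβ : 0 < β) (ht' : t' < ts)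
    (hx' : x' ∈ alcove N r) {p ψ : ℝ → (Fin N → ℝ) → ℝ}
    (hp : IsTransitionDensity N r ts β t' x' p) (hψ : IsPsi N r ts β t' x' ψ) :
    ∀ t ∈ Ioo t' ts, ∀ x ∈ alcove N r, p t x = multiplier N r ts β t' x' t x * ψ t x := by
  have hpos : ∀ t ∈ Ioo t' ts, ∀ x ∈ alcove N r, 0 < multiplier N r ts β t' x' t x :=
    fun t ht x hx => multiplier_pos hN0 hr β ht' hx' ht.2 hx
  have hle := hp.2 _ (hψ.1.multiplier_mul hN0 hr hβ ht' hx')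
  have hdiv : IsSchrodingerSolution N r ts β t' x'
      fun t x => (multiplier N r ts β t' x' t x)⁻¹ * p t x :=
    hp.1.isSchrodingerSolution_of_le hN0 hr hβ ht' hx' hψ.1
      (fun t ht x hx => (mul_inv_cancel_left₀ (hpos t ht x hx).ne' _).symm)
      fun t ht x hx => (inv_mul_le_iff₀ (hpos t ht x hx)).mpr (hle t ht x hx)
  exact fun t ht x hx => (hle t ht x hx).antisymm
    ((le_inv_mul_iff₀ (hpos t ht x hx)).mp (hψ.2 _ hdiv t ht x hx))

end Minimal

end EllipticDyson

end

open EllipticDyson in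
theorem proposition3p2 (N : ℕ) (hN2 : 2 ≤ N) (r ts β : ℝ) (hr : 0 < r) (hts : 0 < ts)
    (hβ : 0 < β) :
    -- (i)
    (∀ t' ∈ Ico 0 ts, ∀ x' ∈ alcove N r,
      -- the two equations correspond to each other under multiplication
      (∀ f : ℝ → (Fin N → ℝ) → ℝ,
        SolvesSchrodinger N r ts β t' f ↔
          SolvesKolmogorov N r ts β t' fun t x => multiplier N r ts β t' x' t x * f t x) ∧
      -- solutions of the Schrödinger-type problem give positive fundamental solutions
      (∀ ψ : ℝ → (Fin N → ℝ) → ℝ, IsSchrodingerSolution N r ts β t' x' ψ →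
        IsKolmogorovSolution N r ts β t' x' fun t x => multiplier N r ts β t' x' t x * ψ t x) ∧
      -- the transition density, inside the alcove and at its boundary
      (∀ p ψ : ℝ → (Fin N → ℝ) → ℝ, IsTransitionDensity N r ts β t' x' p →
        IsPsi N r ts β t' x' ψ →
        (∀ t ∈ Ioo t' ts, ∀ x ∈ alcove N r, p t x
          = (hN N r ts β t x / hN N r ts β t' x') ^ (β / 2) * ψ t x) ∧
        VanishesAtBoundary N r ts t' p)) ∧
    -- (ii)
    (∀ t ∈ Ico 0 ts, ∀ x : Fin N → ℝ,
      hN N r ts β t x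
        = etaR (N * tauIm r ts t) ^ (-(β - 2) * ((N : ℝ) - 1) * ((N : ℝ) - 2) / 4)
          * (2 * π * r / Real.sqrt N) ^ N
          * qDet N r (ts - t) (equidistant N r) x) := by
  have hN0 : 0 < N := by lia
  refine ⟨fun t' ht' x' hx' => ⟨fun f => solvesSchrodinger_iff hN0 hr β ht'.2 hx' f,
    fun ψ hψ => hψ.multiplier_mul hN0 hr hβ ht'.2 hx', fun p ψ hp hψ => ?_⟩,
    fun t ht x => hN_eq_qDet hN0 β hr ht.2 x⟩
  have hpψ := transitionDensity_eq hN0 hr hβ ht'.2 hx' hp hψ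
  exact ⟨hpψ, hψ.1.boundary.of_eq_mul (continuousOn_multiplier hN0 hr hβ t' x') hpψ⟩
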